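/- An affine interval exchange transformation (AIET) with $d$ intervals is a bijection $T:[0,1)\to[0,1)$ for which $[0,1)$ is a disjoint union of $d$ non-empty right-open intervals such that, on each of them, $T$ has the form $x\mapsto \lambda x+\delta$ with $\lambda>0$ (the images are then again right-open intervals partitioning $[0,1)$). The orbit of $x$ is $\mathcal O(x)=\mathcal O^+(x)\cup\mathcal O^-(x)$, where $\mathcal O^{\pm}(x)=\{T^{\pm n}(x):n\ge 0\}$; it is periodic if it is finite. The limit sets $\omega(x)$ and $\alpha(x)$ are the sets of accumulation points in $[0,1)$ of $\mathcal O^+(x)$ and $\mathcal O^-(x)$, respectively. A non-periodic orbit $\mathcal O(x)$ is non-trivially recurrent if $\mathcal O(x)\subseteq\omega(x)\cap\alpha(x)$. A quasiminimal of $T$ is the closure in $[0,1)$ of a non-trivially recurrent orbit. Let $T$ be an AIET with $d$ intervals. Then the number $q$ of quasiminimals of $T$ is finite, and the number of periodic orbits of $T$ is either infinite or at most $d-2q$. -/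

import Mathlib

namespace GIET

/-- The half-open unit interval `[0,1)`, with its subspace topology. -/
abbrev I01 : Type := Set.Ico (0 : ℝ) 1

/-- `T : [0,1) → [0,1)` is an affine interval exchange transformation of `d` intervals: a bijection
of `[0,1)` such that `[0,1)` is the disjoint union of `d` non-empty right-open (top) intervals
`[a i, b i)`, on each of which `T` is affine with positive slope. As `T` is a bijection, the images
of the top intervals are automatically `d` right-open (bottom) intervals that partition `[0,1)`. The
endpoints need not be actual discontinuities of `T`. -/
def IsAIET (d : ℕ) (T : Equiv.Perm I01) : Prop :=
  ∃ a b slope shift : Fin d → ℝ,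
    (∀ i, a i < b i) ∧
    (∀ i j, i ≠ j → Disjoint (Set.Ico (a i) (b i)) (Set.Ico (a j) (b j))) ∧
    (⋃ i, Set.Ico (a i) (b i)) = Set.Ico (0 : ℝ) 1 ∧
    (∀ i, 0 < slope i) ∧
    ∀ i, ∀ x : I01, (x : ℝ) ∈ Set.Ico (a i) (b i) → (T x : ℝ) = slope i * (x : ℝ) + shift i

/-- The forward orbit `{x, T x, T² x, …}`. -/
def forwardOrbit (T : Equiv.Perm I01) (x : I01) : Set I01 :=
  Set.range fun n : ℕ => (T ^ n) x

/-- The backward orbit `{x, T⁻¹ x, T⁻² x, …}`. -/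
def backwardOrbit (T : Equiv.Perm I01) (x : I01) : Set I01 :=
  forwardOrbit T⁻¹ x

/-- The full orbit of `x`. -/
def fullOrbit (T : Equiv.Perm I01) (x : I01) : Set I01 :=
  forwardOrbit T x ∪ backwardOrbit T x

/-- The `ω`-limit set: the accumulation points in `[0,1)` of the forward orbit. -/
def omegaLim (T : Equiv.Perm I01) (x : I01) : Set I01 :=
  {y | AccPt y (Filter.principal (forwardOrbit T x))}

/-- The `α`-limit set: the accumulation points in `[0,1)` of the backward orbit. -/
def alphaLim (T : Equiv.Perm I01) (x : I01) : Set I01 :=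
  {y | AccPt y (Filter.principal (backwardOrbit T x))}

/-- The set of periodic (that is, finite) orbits of `T`. -/
def periodicOrbits (T : Equiv.Perm I01) : Set (Set I01) :=
  {O | ∃ x, O = fullOrbit T x ∧ O.Finite}

/-- The orbit of `x` is non-trivially recurrent: it is not periodic, and it is contained in both its
`ω`-limit set and its `α`-limit set. -/
def IsNontriviallyRecurrent (T : Equiv.Perm I01) (x : I01) : Prop :=
  (fullOrbit T x).Infinite ∧ fullOrbit T x ⊆ omegaLim T x ∧ fullOrbit T x ⊆ alphaLim T x

/-- The set of quasiminimals of `T`: the closures in `[0,1)` of non-trivially recurrent orbits. -/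
def quasiminimals (T : Equiv.Perm I01) : Set (Set I01) :=
  {Ω | ∃ x, IsNontriviallyRecurrent T x ∧ Ω = closure (fullOrbit T x)}

end GIET

/-!
A point `x` of `[0,1)` has two germs, `x⁺` and `x⁻`. Replacing every point by its germs makes the
interval a split order: a compact ordered space with dense jumps `x⁻ ⋖ x⁺`, on which `T` becomes a
homeomorphism exchanging `d` clopen intervals `[l i, r i]`. The forward and backward orbits of the
endpoints `l i`, `r i` give `4 d` ends. An end accumulates at the recurrent points of at most one
limit set, whereas each quasiminimal absorbs at least eight ends and, if there are only finitely
many periodic orbits, each of these absorbs at least four. Hence `8 q + 4 p ≤ 4 d`.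
-/

section

open Set Filter Topology

namespace GIET

/-! ### First returns and accumulation -/

section Dynamics

variable {X : Type*} {f : Equiv.Perm X} {J : Set X} {x y : X} {m n : ℕ}

theorem pow_sub_pow_apply (f : Equiv.Perm X) (h : m ≤ n) (x : X) :
    (f ^ (n - m)) ((f ^ m) x) = (f ^ n) x := by
  rw [← Equiv.Perm.mul_apply, ← pow_add, Nat.sub_add_cancel h]

theorem pow_pow_sub_apply (f : Equiv.Perm X) (h : m ≤ n) (x : X) :
    (f ^ m) ((f ^ (n - m)) x) = (f ^ n) x := by
  rw [← Equiv.Perm.mul_apply, ← pow_add, Nat.add_sub_cancel' h]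

/-- `n` is the first return time of `x` to `J` under `f`. -/
def FirstReturn (f : Equiv.Perm X) (J : Set X) (x : X) (n : ℕ) : Prop :=
  0 < n ∧ (f ^ n) x ∈ J ∧ ∀ i, 0 < i → i < n → (f ^ i) x ∉ J

theorem exists_firstReturn (hn : 0 < n) (h : (f ^ n) x ∈ J) : ∃ m ≤ n, FirstReturn f J x m := by
  classical
  have hex : ∃ n, 0 < n ∧ (f ^ n) x ∈ J := ⟨n, hn, h⟩
  exact ⟨Nat.find hex, Nat.find_le ⟨hn, h⟩, (Nat.find_spec hex).1, (Nat.find_spec hex).2,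
    fun i h0 hi hJ => Nat.find_min hex hi ⟨h0, hJ⟩⟩

theorem FirstReturn.le (h : FirstReturn f J x n) (hm : 0 < m) (hJ : (f ^ m) x ∈ J) : n ≤ m :=
  not_lt.1 fun hmn => h.2.2 m hm hmn hJ

theorem FirstReturn.unique (h : FirstReturn f J x n) (h' : FirstReturn f J x m) : n = m :=
  (h.le h'.1 h'.2.1).antisymm (h'.le h.1 h.2.1)

theorem forall_pow_of_forall_firstReturn {p : X → Prop}
    (h : ∀ x ∈ J, ∀ n, FirstReturn f J x n → p ((f ^ n) x)) (hx : x ∈ J) (hn : 0 < n)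
    (hnJ : (f ^ n) x ∈ J) : p ((f ^ n) x) := by
  induction n using Nat.strong_induction_on generalizing x with
  | _ n ih =>
    obtain ⟨m, hmn, hm⟩ := exists_firstReturn hn hnJ
    rcases hmn.eq_or_lt with rfl | hlt
    · exact h x hx m hm
    · rw [← pow_sub_pow_apply f hmn] at hnJ ⊢
      exact ih (n - m) (Nat.sub_lt hn hm.1) hm.2.1 (Nat.sub_pos_of_lt hlt) hnJ

theorem eq_of_pow_eq_of_notMem (hx : x ∈ J) (hy : y ∈ J) (hm : 0 < m) (hn : 0 < n)
    (hmJ : ∀ i, 0 < i → i < m → (f ^ i) x ∉ J) (hnJ : ∀ i, 0 < i → i < n → (f ^ i) y ∉ J)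
    (h : (f ^ m) x = (f ^ n) y) : x = y := by
  wlog hmn : m ≤ n generalizing x y m n
  · exact (this hy hx hn hm hnJ hmJ h.symm (not_le.1 hmn).le).symm
  have hxy : (f ^ (n - m)) y = x := (f ^ m).injective (by rw [pow_pow_sub_apply f hmn, h])
  rcases hmn.eq_or_lt with rfl | hlt
  · simpa using hxy.symm
  · exact absurd (hxy ▸ hx) (hnJ (n - m) (by omega) (by omega))

/-- The first return map to `J` preserves the relation `r`. -/
def ReturnPreserves (f : Equiv.Perm X) (J : Set X) (r : X → X → Prop) : Prop :=
  ∀ ⦃x y m n⦄, x ∈ J → y ∈ J → r x y → FirstReturn f J x m → FirstReturn f J y n →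
    r ((f ^ m) x) ((f ^ n) y)

theorem ReturnPreserves.pow_eq_or_rel {r : X → X → Prop} [IsTrans X r]
    (h : ReturnPreserves f J r) (hx : x ∈ J) (hm : FirstReturn f J x m) (hr : r ((f ^ m) x) x)
    (hn : 0 < n) (hnJ : (f ^ n) x ∈ J) : (f ^ n) x = (f ^ m) x ∨ r ((f ^ n) x) ((f ^ m) x) := by
  induction n using Nat.strong_induction_on generalizing x m with
  | _ n ih =>
    rcases (hm.le hn hnJ).eq_or_lt with rfl | hlt
    · exact .inl rfl
    · rw [← pow_sub_pow_apply f hlt.le] at hnJ ⊢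
      obtain ⟨k, -, hk⟩ := exists_firstReturn (Nat.sub_pos_of_lt hlt) hnJ
      have hstep := h hm.2.1 hx hr hk hm
      right
      rcases ih (n - m) (Nat.sub_lt hn hm.1) hm.2.1 hk hstep (Nat.sub_pos_of_lt hlt) hnJ
        with heq | hlt'
      · rwa [heq]
      · exact _root_.trans hlt' hstep

theorem mem_periodicPts_iff : x ∈ Function.periodicPts f ↔ ∃ n : ℕ, 0 < n ∧ (f ^ n) x = x := by
  simp only [Function.mem_periodicPts, Function.IsPeriodicPt, Function.IsFixedPt,
    Equiv.Perm.iterate_eq_pow]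

theorem pow_apply_ne_of_notMem_periodicPts (hx : x ∉ Function.periodicPts f) (hn : 0 < n) :
    (f ^ n) x ≠ x :=
  fun h => hx (mem_periodicPts_iff.2 ⟨n, hn, h⟩)

theorem pow_apply_pow_of_isPeriodicPt (h : (f ^ n) x = x) (k : ℕ) :
    (f ^ n) ((f ^ k) x) = (f ^ k) x := by
  rw [← Equiv.Perm.mul_apply, (Commute.refl f).pow_pow n k, Equiv.Perm.mul_apply, h]

theorem finite_range_pow_of_isPeriodicPt (hn : 0 < n) (h : (f ^ n) x = x) :
    (range fun m : ℕ => (f ^ m) x).Finite := by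
  refine ((finite_lt_nat n).image fun m => (f ^ m) x).subset ?_
  rintro - ⟨m, rfl⟩
  refine ⟨m % n, Nat.mod_lt _ hn, ?_⟩
  change (f ^ (m % n)) x = (f ^ m) x
  nth_rw 2 [← Nat.mod_add_div m n]
  rw [pow_add, Equiv.Perm.mul_apply, pow_mul, Equiv.Perm.pow_apply_eq_self_of_apply_eq_self h]

end Dynamics

/-- The orbit `f ^ n g`, `n → ∞`, accumulates (in time) at `x`. -/
def Visits {X : Type*} [TopologicalSpace X] (f : Equiv.Perm X) (x g : X) : Prop :=
  MapClusterPt x atTop fun n : ℕ => (f ^ n) g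

section Visits

variable {X : Type*} [TopologicalSpace X] {f : Equiv.Perm X} {x y g : X}

theorem visits_iff : Visits f x g ↔ ∀ s ∈ 𝓝 x, ∀ N : ℕ, ∃ n, N ≤ n ∧ (f ^ n) g ∈ s := by
  simp only [Visits, mapClusterPt_iff_frequently, frequently_atTop]

theorem Visits.exists_mem (h : Visits f x g) {s : Set X} (hs : s ∈ 𝓝 x) (N : ℕ) :
    ∃ n, N ≤ n ∧ (f ^ n) g ∈ s :=
  visits_iff.1 h s hs N

theorem visits_pow_right (n : ℕ) : Visits f x ((f ^ n) g) ↔ Visits f x g := by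
  simp only [Visits, MapClusterPt, ← Equiv.Perm.mul_apply, ← pow_add]
  conv_rhs => rw [← map_add_atTop_eq_nat n, Filter.map_map]
  rfl

theorem visits_zpow_right (k : ℤ) : Visits f x ((f ^ k) g) ↔ Visits f x g := by
  obtain ⟨n, rfl | rfl⟩ := k.eq_nat_or_neg
  · exact visits_pow_right n
  · rw [← visits_pow_right n, ← zpow_natCast, ← Equiv.Perm.mul_apply, ← zpow_add]
    simp

theorem visits_inv_pow_right (n : ℕ) : Visits f⁻¹ x ((f ^ n) g) ↔ Visits f⁻¹ x g := by
  rw [← visits_zpow_right (f := f⁻¹) (-n : ℤ) (g := g)]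
  simp

theorem isClosed_setOf_visits (f : Equiv.Perm X) (g : X) : IsClosed {x | Visits f x g} := by
  refine isClosed_of_closure_subset fun x h => visits_iff.2 fun s hs N => ?_
  obtain ⟨t, hts, hto, hxt⟩ := mem_nhds_iff.1 hs
  obtain ⟨y, hyt, hy⟩ := mem_closure_iff.1 h t hto hxt
  obtain ⟨n, hn, hmem⟩ := hy.exists_mem (hto.mem_nhds hyt) N
  exact ⟨n, hn, hts hmem⟩

theorem Visits.mem_closure_range (h : Visits f x g) :
    x ∈ closure (range fun n : ℕ => (f ^ n) g) :=
  mem_closure_iff_nhds.2 fun _ hs =>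
    let ⟨n, _, hn⟩ := h.exists_mem hs 0
    ⟨_, hn, n, rfl⟩

theorem Visits.map {h : Equiv.Perm X} (hc : Continuous h) (hcomm : Commute h f)
    (hx : Visits f x g) : Visits f (h x) (h g) := by
  have := MapClusterPt.continuousAt_comp hc.continuousAt hx
  simpa only [Visits, Function.comp_def, ← Equiv.Perm.mul_apply, (hcomm.pow_right _).eq] using this

theorem visits_pow_left (hf : Continuous f) (hf' : Continuous ⇑f⁻¹) (n : ℕ) :
    Visits f ((f ^ n) x) g ↔ Visits f x g := by
  have apply_left (y : X) : Visits f (f y) g ↔ Visits f y g := by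
    refine ⟨fun h => ?_, fun h => ?_⟩
    · simpa using (visits_zpow_right (-1)).1 (h.map hf' (Commute.inv_left (Commute.refl f)))
    · exact (visits_pow_right 1).1 (h.map hf (Commute.refl f))
  induction n with
  | zero => rfl
  | succ n ih => exact pow_succ' f n ▸ (apply_left _).trans ih

theorem Visits.self_of_exists (hf : Continuous f)
    (h : ∀ s ∈ 𝓝 x, ∃ n : ℕ, 0 < n ∧ (f ^ n) x ∈ s) : Visits f x x := by
  refine visits_iff.2 fun s hs N => ?_
  induction N generalizing s with
  | zero => exact (h s hs).imp fun n hn => ⟨n.zero_le, hn.2⟩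
  | succ N ih =>
    obtain ⟨n, hn, hmem⟩ := ih (interior s) (interior_mem_nhds.2 hs)
    obtain ⟨m, hm, hmem'⟩ := h _ ((Equiv.Perm.iterate_eq_pow f n ▸ hf.iterate n).continuousAt
      (isOpen_interior.mem_nhds hmem))
    refine ⟨n + m, by omega, interior_subset ?_⟩
    rwa [pow_add]

theorem visits_self_of_isPeriodicPt {n : ℕ} (hn : 0 < n) (h : (f ^ n) x = x) : Visits f x x := by
  refine visits_iff.2 fun s hs N => ⟨n * N, Nat.le_mul_of_pos_left _ hn, ?_⟩
  have hfix : (f ^ (n * N)) x = x := by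
    rw [pow_mul]
    exact Equiv.Perm.pow_apply_eq_self_of_apply_eq_self h N
  exact hfix.symm ▸ mem_of_mem_nhds hs

theorem Visits.mem_range_of_isPeriodicPt [T1Space X] {n : ℕ} (hn : 0 < n) (hg : (f ^ n) g = g)
    (h : Visits f x g) : x ∈ range fun m : ℕ => (f ^ m) g :=
  (finite_range_pow_of_isPeriodicPt hn hg).isClosed.closure_subset h.mem_closure_range

theorem setOf_visits_of_isPeriodicPt [T1Space X] {n : ℕ} (hn : 0 < n) (hg : (f ^ n) g = g) :
    {x | Visits f x g} = range fun m : ℕ => (f ^ m) g := by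
  refine Subset.antisymm (fun x hx => hx.mem_range_of_isPeriodicPt hn hg) ?_
  rintro - ⟨m, rfl⟩
  exact (visits_pow_right m).1 (visits_self_of_isPeriodicPt hn (pow_apply_pow_of_isPeriodicPt hg m))

end Visits

section IncreasingOnto

variable {X Y Z : Type*} [LinearOrder X] [LinearOrder Y] [LinearOrder Z] {a b c z x y : X}

/-- `f` maps the interval `[a, b]` increasingly onto the interval `[f a, f b]`. -/
def IncreasingOnto (f : X → Y) (a b : X) : Prop :=
  StrictMonoOn f (Icc a b) ∧ SurjOn f (Icc a b) (Icc (f a) (f b))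

variable {f : X → Y}

theorem IncreasingOnto.lt (h : IncreasingOnto f a b) (ha : a ≤ x) (hxy : x < y) (hb : y ≤ b) :
    f x < f y :=
  h.1 ⟨ha, hxy.le.trans hb⟩ ⟨ha.trans hxy.le, hb⟩ hxy

theorem IncreasingOnto.le (h : IncreasingOnto f a b) (ha : a ≤ x) (hxy : x ≤ y) (hb : y ≤ b) :
    f x ≤ f y :=
  h.1.monotoneOn ⟨ha, hxy.trans hb⟩ ⟨ha.trans hxy, hb⟩ hxy

theorem IncreasingOnto.subinterval (h : IncreasingOnto f a b) (ha : a ≤ c) (hcz : c ≤ z)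
    (hb : z ≤ b) : IncreasingOnto f c z := by
  refine ⟨h.1.mono (Icc_subset_Icc ha hb), fun y hy => ?_⟩
  obtain ⟨x, hx, rfl⟩ := h.2 ⟨(h.le le_rfl ha (hcz.trans hb)).trans hy.1,
    hy.2.trans (h.le (ha.trans hcz) hb le_rfl)⟩
  exact ⟨x, ⟨(h.1.le_iff_le ⟨ha, hcz.trans hb⟩ hx).1 hy.1,
    (h.1.le_iff_le hx ⟨ha.trans hcz, hb⟩).1 hy.2⟩, rfl⟩

theorem IncreasingOnto.comp {g : Y → Z} (hg : IncreasingOnto g (f a) (f b))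
    (hf : IncreasingOnto f a b) : IncreasingOnto (g ∘ f) a b :=
  ⟨hg.1.comp hf.1 fun _ hx => ⟨hf.le le_rfl hx.1 hx.2, hf.le hx.1 hx.2 le_rfl⟩, hg.2.comp hf.2⟩

theorem IncreasingOnto.covBy (h : IncreasingOnto f a b) (ha : a ≤ x) (hxy : x ⋖ y) (hb : y ≤ b) :
    f x ⋖ f y := by
  refine ⟨h.lt ha hxy.lt hb, fun w hxw hwy => ?_⟩
  obtain ⟨z, hz, rfl⟩ := (h.subinterval ha hxy.le hb).2 ⟨hxw.le, hwy.le⟩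
  exact hxy.2 (hz.1.lt_of_ne (ne_of_apply_ne f hxw.ne)) (hz.2.lt_of_ne (ne_of_apply_ne f hwy.ne))

theorem IncreasingOnto.apply_mem_Icc_iff (h : IncreasingOnto f a b) (hf : f.Injective) :
    f x ∈ Icc (f a) (f b) ↔ x ∈ Icc a b := by
  refine ⟨fun hx => ?_, fun hx => ⟨h.le le_rfl hx.1 hx.2, h.le hx.1 hx.2 le_rfl⟩⟩
  obtain ⟨y, hy, hyx⟩ := h.2 hx
  exact hf hyx ▸ hy

theorem IncreasingOnto.inv {f : Equiv.Perm X} (h : IncreasingOnto f a b) :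
    IncreasingOnto ⇑f⁻¹ (f a) (f b) := by
  constructor
  · intro y hy y' hy' hlt
    obtain ⟨x, hx, rfl⟩ := h.2 hy
    obtain ⟨x', hx', rfl⟩ := h.2 hy'
    simpa using (h.1.lt_iff_lt hx hx').1 hlt
  · intro x hx
    rw [Equiv.Perm.inv_def, f.symm_apply_apply, f.symm_apply_apply] at hx
    exact ⟨f x, ⟨h.le le_rfl hx.1 hx.2, h.le hx.1 hx.2 le_rfl⟩, by simp⟩

theorem IncreasingOnto.dual (h : IncreasingOnto f a b) :
    IncreasingOnto (OrderDual.toDual ∘ f ∘ OrderDual.ofDual) (OrderDual.toDual b)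
      (OrderDual.toDual a) := by
  refine ⟨fun x hx y hy hxy => h.lt hy.2 hxy hx.1, fun y hy => ?_⟩
  obtain ⟨x, hx, hxy⟩ := h.2 ⟨hy.2, hy.1⟩
  exact ⟨OrderDual.toDual x, ⟨hx.2, hx.1⟩, hxy⟩

theorem IncreasingOnto.lt_of_forall_ne {g : X → Y} (hf : IncreasingOnto f a b)
    (hg : IncreasingOnto g c z) (hab : a ≤ b) (hcz : c ≤ z)
    (hne : ∀ x ∈ Icc a b, ∀ y ∈ Icc c z, f x ≠ g y) (h : f a ≤ g z) : f b < g c := by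
  by_contra! hle
  obtain ⟨x, hx, hxw⟩ := hf.2 ⟨le_max_left (f a) (g c), max_le (hf.le le_rfl hab le_rfl) hle⟩
  obtain ⟨y, hy, hyw⟩ := hg.2 ⟨le_max_right (f a) (g c), max_le h (hg.le le_rfl hcz le_rfl)⟩
  exact hne x hx y hy (hxw.trans hyw.symm)

end IncreasingOnto

/-! ### Split orders -/

/-- A linear order with a side for each point, such that any two distinct points are separated by a
jump `v ⋖ u`, with `v` of side `false` and `u` of side `true`. The model is the split interval, in
which every point `x` of an interval is replaced by its two one-sided germs `x⁻ ⋖ x⁺`. -/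
structure IsSplitOrder (X : Type*) [LinearOrder X] (side : X → Bool) : Prop where
  sep : ∀ ⦃x y : X⦄, x < y → ∃ v u, x ≤ v ∧ v ⋖ u ∧ u ≤ y ∧ side v = false ∧ side u = true
  exists_pred : ∀ ⦃u : X⦄, side u = true → IsBot u ∨ ∃ v, v ⋖ u
  exists_succ : ∀ ⦃v : X⦄, side v = false → IsTop v ∨ ∃ u, v ⋖ u

namespace IsSplitOrder

variable {X : Type*} [LinearOrder X] {side : X → Bool} (h : IsSplitOrder X side) {x u v : X}
include h

theorem side_of_covBy (hc : v ⋖ u) : side v = false ∧ side u = true := by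
  obtain ⟨v', u', hv, hvu, hu, hv', hu'⟩ := h.sep hc.lt
  have ev : v' = v := (hc.le_of_lt (hvu.lt.trans_le hu)).antisymm hv
  have eu : u' = u := hu.antisymm (hc.ge_of_gt (hv.trans_lt hvu.lt))
  exact ⟨ev ▸ hv', eu ▸ hu'⟩

theorem pred_of_lt (hu : side u = true) (hx : x < u) : ∃ v, v ⋖ u ∧ x ≤ v :=
  (h.exists_pred hu).elim (fun hbot => absurd hx (hbot x).not_gt)
    fun ⟨v, hv⟩ => ⟨v, hv, hv.le_of_lt hx⟩

theorem dual : IsSplitOrder Xᵒᵈ (fun x => !side (OrderDual.ofDual x)) where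
  sep x y hxy := by
    obtain ⟨v, u, hv, hvu, hu, hv', hu'⟩ :=
      h.sep (x := OrderDual.ofDual y) (y := OrderDual.ofDual x) hxy
    exact ⟨OrderDual.toDual u, OrderDual.toDual v, hu, hvu.toDual, hv, by simp [hu'], by simp [hv']⟩
  exists_pred u hu :=
    (h.exists_succ (v := OrderDual.ofDual u) (by simpa using hu)).imp (fun h => h.toDual)
      fun ⟨v, hv⟩ => ⟨OrderDual.toDual v, hv.toDual⟩
  exists_succ u hu :=
    (h.exists_pred (u := OrderDual.ofDual u) (by simpa using hu)).imp (fun h => h.toDual)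
      fun ⟨v, hv⟩ => ⟨OrderDual.toDual v, hv.toDual⟩

theorem succ_of_lt (hv : side v = false) (hx : v < x) : ∃ u, v ⋖ u ∧ u ≤ x := by
  obtain ⟨u, hu, hxu⟩ := h.dual.pred_of_lt (u := OrderDual.toDual v) (x := OrderDual.toDual x)
    (by simp [hv]) hx
  exact ⟨OrderDual.ofDual u, hu.ofDual, hxu⟩

variable [TopologicalSpace X] [OrderTopology X]

theorem isOpen_Ici (hu : side u = true) : IsOpen (Ici u) := by
  rcases h.exists_pred hu with hbot | ⟨v, hv⟩
  · exact hbot.Ici_eq ▸ isOpen_univ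
  · exact hv.Ioi_eq ▸ isOpen_Ioi

theorem isOpen_Iic (hv : side v = false) : IsOpen (Iic v) :=
  h.dual.isOpen_Ici (u := OrderDual.toDual v) (by simp [hv])

theorem isOpen_Icc (hu : side u = true) (hv : side v = false) : IsOpen (Icc u v) :=
  (h.isOpen_Ici hu).inter (h.isOpen_Iic hv)

theorem isClopen_Icc (hu : side u = true) (hv : side v = false) : IsClopen (Icc u v) :=
  ⟨isClosed_Icc, h.isOpen_Icc hu hv⟩

theorem Icc_mem_nhds (hu : side u = true) (hv : side v = false) (hx : x ∈ Icc u v) :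
    Icc u v ∈ 𝓝 x :=
  (h.isOpen_Icc hu hv).mem_nhds hx

end IsSplitOrder

/-! ### Interval exchanges of split orders -/

/-- A bijection of a split order that exchanges `d` clopen intervals `[l i, r i]`, increasing on
each of them. -/
structure Exchange (X : Type*) [LinearOrder X] (side : X → Bool) (d : ℕ) where
  T : Equiv.Perm X
  l : Fin d → X
  r : Fin d → X
  le : ∀ i, l i ≤ r i
  cover : ∀ x, ∃ i, x ∈ Icc (l i) (r i)
  uniq : ∀ ⦃i j x⦄, x ∈ Icc (l i) (r i) → x ∈ Icc (l j) (r j) → i = j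
  increasing : ∀ i, IncreasingOnto T (l i) (r i)
  side_l : ∀ i, side (l i) = true
  side_r : ∀ i, side (r i) = false
  side_T : ∀ x, side (T x) = side x
  split : IsSplitOrder X side

namespace Exchange

variable {X : Type*} [LinearOrder X] {side : X → Bool} {d : ℕ} (S : Exchange X side d)
variable {n : ℕ} {c z u v x y : X} {j : Fin d}

/-- The inverse exchange. -/
def inv : Exchange X side d where
  T := S.T⁻¹
  l := fun i => S.T (S.l i)
  r := fun i => S.T (S.r i)
  le := fun i => (S.increasing i).le le_rfl (S.le i) le_rfl
  cover := fun x => by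
    obtain ⟨x, rfl⟩ := S.T.surjective x
    exact (S.cover x).imp fun i => ((S.increasing i).apply_mem_Icc_iff S.T.injective).2
  uniq := fun i j x hi hj => by
    obtain ⟨x, rfl⟩ := S.T.surjective x
    exact S.uniq (((S.increasing i).apply_mem_Icc_iff S.T.injective).1 hi)
      (((S.increasing j).apply_mem_Icc_iff S.T.injective).1 hj)
  increasing := fun i => (S.increasing i).inv
  side_l := fun i => by rw [S.side_T, S.side_l]
  side_r := fun i => by rw [S.side_T, S.side_r]
  side_T := fun x => by rw [← S.side_T (S.T⁻¹ x), Equiv.Perm.inv_def, Equiv.apply_symm_apply]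
  split := S.split

/-- The exchange obtained by reversing the order. -/
def dual : Exchange Xᵒᵈ (fun x => !side (OrderDual.ofDual x)) d where
  T := (OrderDual.ofDual.trans S.T).trans OrderDual.toDual
  l := fun i => OrderDual.toDual (S.r i)
  r := fun i => OrderDual.toDual (S.l i)
  le := S.le
  cover := fun x => (S.cover (OrderDual.ofDual x)).imp fun _ h => h.symm
  uniq := fun _ _ _ hi hj => S.uniq hi.symm hj.symm
  increasing := fun i => (S.increasing i).dual
  side_l := fun i => by simp [S.side_r]
  side_r := fun i => by simp [S.side_l]
  side_T := fun x => by simp [S.side_T]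
  split := S.split.dual

@[simp] theorem inv_T : S.inv.T = S.T⁻¹ := rfl
@[simp] theorem inv_l (i : Fin d) : S.inv.l i = S.T (S.l i) := rfl
@[simp] theorem inv_r (i : Fin d) : S.inv.r i = S.T (S.r i) := rfl

theorem side_pow (n : ℕ) (x : X) : side ((S.T ^ n) x) = side x := by
  induction n with
  | zero => rfl
  | succ n ih => rw [pow_succ', Equiv.Perm.mul_apply, S.side_T, ih]

theorem exists_piece_of_forall_notMem (h : ∀ j, S.l j ∉ Ioc x y) :
    ∃ i, S.l i ≤ x ∧ y ≤ S.r i := by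
  obtain ⟨j, hj⟩ := S.cover y
  exact ⟨j, not_lt.1 fun hx => h j ⟨hx, hj.1⟩, hj.2⟩

theorem covBy_apply (h : x ⋖ y) (hy : ∀ j, y ≠ S.l j) : S.T x ⋖ S.T y := by
  obtain ⟨i, hx, hy⟩ := S.exists_piece_of_forall_notMem (x := x) (y := y) fun j hj =>
    hy j ((h.ge_of_gt hj.1).antisymm hj.2)
  exact (S.increasing i).covBy hx h hy

theorem covBy_pow (h : x ⋖ y) (hy : ∀ (k : ℕ) j, (S.T ^ k) y ≠ S.l j) (k : ℕ) :
    (S.T ^ k) x ⋖ (S.T ^ k) y := by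
  induction k with
  | zero => exact h
  | succ k ih =>
    rw [pow_succ', Equiv.Perm.mul_apply, Equiv.Perm.mul_apply]
    exact S.covBy_apply ih (hy k)

theorem eq_r_of_covBy_l (h : x ⋖ S.l j) : ∃ i, x = S.r i := by
  obtain ⟨i, hi⟩ := S.cover x
  refine ⟨i, hi.2.antisymm (not_lt.1 fun hlt => ?_)⟩
  obtain rfl := S.uniq ⟨hi.1.trans h.le, h.ge_of_gt hlt⟩ ⟨le_rfl, S.le j⟩
  exact h.lt.not_ge hi.1

theorem eq_l_of_r_covBy (h : S.r j ⋖ x) : ∃ i, x = S.l i :=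
  S.dual.eq_r_of_covBy_l h.toDual

theorem eq_l_of_isBot (h : IsBot x) : ∃ i, x = S.l i :=
  (S.cover x).imp fun _ hi => (h _).antisymm hi.1

theorem eq_r_of_isTop (h : IsTop x) : ∃ i, x = S.r i :=
  (S.cover x).imp fun _ hi => hi.2.antisymm (h _)

/-- `[c, z]` is not cut by a left endpoint during the first `n` steps. -/
def Uncut (n : ℕ) (c z : X) : Prop :=
  ∀ i < n, ∀ x ∈ Ioc c z, ∀ j, (S.T ^ i) x ≠ S.l j

variable {S}

theorem Uncut.mono {m : ℕ} {c' z' : X} (h : S.Uncut n c z) (hm : m ≤ n) (hc : c ≤ c')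
    (hz : z' ≤ z) : S.Uncut m c' z' :=
  fun i hi x hx => h i (hi.trans_le hm) x (Ioc_subset_Ioc hc hz hx)

theorem Uncut.exists_piece (h : S.Uncut (n + 1) c z) (hinc : IncreasingOnto ⇑(S.T ^ n) c z) :
    ∃ i, S.l i ≤ (S.T ^ n) c ∧ (S.T ^ n) z ≤ S.r i := by
  refine S.exists_piece_of_forall_notMem ?_
  rintro j ⟨hcj, hjz⟩
  obtain ⟨x, hx, hxj⟩ := hinc.2 ⟨hcj.le, hjz⟩
  refine h n n.lt_succ_self x ⟨hx.1.lt_of_ne ?_, hx.2⟩ j hxj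
  rintro rfl
  exact hcj.ne hxj

theorem Uncut.increasingOnto (h : S.Uncut n c z) (hcz : c ≤ z) :
    IncreasingOnto ⇑(S.T ^ n) c z := by
  induction n with
  | zero => exact ⟨fun _ _ _ _ h => h, fun x hx => ⟨x, hx, rfl⟩⟩
  | succ n ih =>
    have hinc := ih (h.mono n.le_succ le_rfl le_rfl)
    obtain ⟨i, hl, hr⟩ := h.exists_piece hinc
    rw [pow_succ', Equiv.Perm.coe_mul]
    exact ((S.increasing i).subinterval hl (hinc.le le_rfl hcz le_rfl) hr).comp hinc

variable (S)

section Topology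

variable [TopologicalSpace X] [OrderTopology X] {s : Set X}

theorem exists_Icc_subset_left (S : Exchange X side d) (hs : s ∈ 𝓝 x) :
    ∃ u, side u = true ∧ u ≤ x ∧ Icc u x ⊆ s := by
  by_cases hx : ∃ y, y < x
  · obtain ⟨y, hy, hys⟩ := exists_Ioc_subset_of_mem_nhds hs hx
    obtain ⟨v, u, hv, hvu, hu, -, hu'⟩ := S.split.sep hy
    exact ⟨u, hu', hu, (Icc_subset_Ioc_iff hu).2 ⟨hv.trans_lt hvu.lt, le_rfl⟩ |>.trans hys⟩
  · push Not at hx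
    obtain ⟨i, hi⟩ := S.eq_l_of_isBot hx
    refine ⟨x, hi ▸ S.side_l i, le_rfl, ?_⟩
    rw [Icc_self, singleton_subset_iff]
    exact mem_of_mem_nhds hs

theorem exists_Icc_subset_right (S : Exchange X side d) (hs : s ∈ 𝓝 x) :
    ∃ v, side v = false ∧ x ≤ v ∧ Icc x v ⊆ s := by
  obtain ⟨v, hv, hxv, hvs⟩ := S.dual.exists_Icc_subset_left (x := OrderDual.toDual x) hs
  exact ⟨OrderDual.ofDual v, by simpa using hv, hxv, fun y hy => hvs ⟨hy.2, hy.1⟩⟩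

theorem exists_Icc_subset (S : Exchange X side d) (hs : s ∈ 𝓝 x) :
    ∃ u v, side u = true ∧ side v = false ∧ x ∈ Icc u v ∧ Icc u v ⊆ s := by
  obtain ⟨u, hu, hux, hus⟩ := S.exists_Icc_subset_left hs
  obtain ⟨v, hv, hxv, hvs⟩ := S.exists_Icc_subset_right hs
  refine ⟨u, v, hu, hv, ⟨hux, hxv⟩, ?_⟩
  rw [← Icc_union_Icc_eq_Icc hux hxv]
  exact union_subset hus hvs

theorem continuous_T : Continuous S.T := by
  refine continuous_iff_continuousAt.2 fun x s hs => ?_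
  obtain ⟨i, hi⟩ := S.cover x
  have himg : Icc (S.T (S.l i)) (S.T (S.r i)) ∈ 𝓝 (S.T x) :=
    S.split.Icc_mem_nhds (S.inv.side_l i) (S.inv.side_r i)
      (((S.increasing i).apply_mem_Icc_iff S.T.injective).2 hi)
  obtain ⟨u, v, hu, hv, hx, huv⟩ := S.exists_Icc_subset (inter_mem hs himg)
  obtain ⟨u, hui, rfl⟩ := (S.increasing i).2 (huv (left_mem_Icc.2 (hx.1.trans hx.2))).2
  obtain ⟨v, hvi, rfl⟩ := (S.increasing i).2 (huv (right_mem_Icc.2 (hx.1.trans hx.2))).2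
  rw [S.side_T] at hu hv
  refine mem_map.2 <| mem_of_superset (S.split.Icc_mem_nhds hu hv ⟨?_, ?_⟩) fun y hy => (huv ?_).1
  · exact ((S.increasing i).1.le_iff_le hui hi).1 hx.1
  · exact ((S.increasing i).1.le_iff_le hi hvi).1 hx.2
  · exact ⟨(S.increasing i).le hui.1 hy.1 (hy.2.trans hvi.2),
      (S.increasing i).le (hui.1.trans hy.1) hy.2 hvi.2⟩

theorem continuous_pow (n : ℕ) : Continuous ⇑(S.T ^ n) :=
  Equiv.Perm.iterate_eq_pow S.T n ▸ S.continuous_T.iterate n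

end Topology

end Exchange

namespace Exchange

variable {X : Type*} [LinearOrder X] {side : X → Bool} {d : ℕ} (S : Exchange X side d)
variable {n : ℕ} {c z u v x y : X}

/-- The points at which an orbit may be torn apart from its neighbours, or at which neighbouring
orbits may disagree about lying in `[u, v]`: the left endpoints, `u`, and the successor of `v`. -/
def landmarks (u v : X) : Set X := range S.l ∪ insert u {w | v ⋖ w}

/-- The points of `(u, v]` at which the first return to `[u, v]` may be discontinuous. -/
def IsCut (u v x : X) : Prop :=
  x ∈ Ioc u v ∧ ∃ i : ℕ, (S.T ^ i) x ∈ S.landmarks u v ∧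
    ∀ i', 0 < i' → i' < i → (S.T ^ i') x ∉ Icc u v

theorem finite_isCut (u v : X) : {x | S.IsCut u v x}.Finite := by
  have hmarks : (S.landmarks u v).Finite :=
    (finite_range S.l).union
      ((Set.Subsingleton.finite fun _ hx _ hy => CovBy.unique_right hx hy).insert u)
  have hhit (w : X) : {x | x ∈ Icc u v ∧ ∃ i, 0 < i ∧ (S.T ^ i) x = w ∧
      ∀ i', 0 < i' → i' < i → (S.T ^ i') x ∉ Icc u v}.Subsingleton := by
    rintro x ⟨hx, i, hi, rfl, hout⟩ y ⟨hy, i', hi', heq, hout'⟩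
    exact eq_of_pow_eq_of_notMem hx hy hi hi' hout hout' heq.symm
  refine (hmarks.union (hmarks.biUnion fun w _ => (hhit w).finite)).subset ?_
  rintro x ⟨hx, i, hi, hout⟩
  rcases i.eq_zero_or_pos with rfl | hpos
  · exact Or.inl hi
  · exact Or.inr (mem_biUnion hi ⟨Ioc_subset_Icc_self hx, i, hpos, rfl, hout⟩)

variable {S}

theorem uncut_of_not_isCut (hv : side v = false) (hu : u ≤ c) (hcz : c ≤ z) (hz : z ≤ v)
    (hcut : ∀ x ∈ Ioc c z, ¬ S.IsCut u v x)
    (h : ∀ i, 0 < i → i < n → ∃ x ∈ Icc c z, (S.T ^ i) x ∉ Icc u v) :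
    S.Uncut n c z ∧ ∀ i, 0 < i → i < n → ∀ x ∈ Icc c z, (S.T ^ i) x ∉ Icc u v := by
  have hJ {x : X} (hx : x ∈ Ioc c z) : x ∈ Ioc u v := Ioc_subset_Ioc hu hz hx
  induction n with
  | zero => exact ⟨fun i hi => absurd hi i.not_lt_zero, fun i _ hi => absurd hi i.not_lt_zero⟩
  | succ n ih =>
    obtain ⟨huncut, hout⟩ := ih fun i h0 hi => h i h0 (hi.trans n.lt_succ_self)
    have hinc := huncut.increasingOnto hcz
    have hcut' {q : X} (hq : q ∈ Ioc c z) : (S.T ^ n) q ∉ S.landmarks u v := fun hmark =>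
      hcut q hq ⟨hJ hq, n, hmark, fun i h0 hi => hout i h0 hi q (Ioc_subset_Icc_self hq)⟩
    have hout_n (hn : 0 < n) (x : X) (hx : x ∈ Icc c z) : (S.T ^ n) x ∉ Icc u v := by
      intro hxJ
      obtain ⟨p, hp, hpJ⟩ := h n hn n.lt_succ_self
      rcases lt_or_ge v ((S.T ^ n) p) with hvp | hpv
      · obtain ⟨w, hvw, hwp⟩ := S.split.succ_of_lt hv hvp
        have hxp : x ≤ p := ((hinc.1.lt_iff_lt hx hp).1 (hxJ.2.trans_lt hvp)).le
        obtain ⟨q, hq, rfl⟩ := (hinc.subinterval hx.1 hxp hp.2).2 ⟨hxJ.2.trans hvw.le, hwp⟩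
        refine hcut' ⟨(hx.1.trans hq.1).lt_of_ne ?_, hq.2.trans hp.2⟩ (Or.inr (Or.inr hvw))
        rintro rfl
        exact hvw.lt.not_ge ((hinc.le le_rfl hx.1 hx.2).trans hxJ.2)
      · have hpu : (S.T ^ n) p < u := lt_of_not_ge fun hup => hpJ ⟨hup, hpv⟩
        have hpx : p ≤ x := ((hinc.1.lt_iff_lt hp hx).1 (hpu.trans_le hxJ.1)).le
        obtain ⟨q, hq, hqu⟩ := (hinc.subinterval hp.1 hpx hx.2).2 ⟨hpu.le, hxJ.1⟩
        refine hcut' ⟨(hp.1.trans hq.1).lt_of_ne ?_, hq.2.trans hx.2⟩ (Or.inr (Or.inl hqu))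
        rintro rfl
        exact (hqu ▸ hpu).not_ge (hinc.le le_rfl hp.1 hp.2)
    refine ⟨fun i hi x hx j hj => ?_, fun i h0 hi => ?_⟩
    · exact hcut x hx ⟨hJ hx, i, Or.inl ⟨j, hj.symm⟩, fun i' h0 hi' =>
        hout i' h0 (by omega) x (Ioc_subset_Icc_self hx)⟩
    · rcases (Nat.lt_succ_iff.1 hi).eq_or_lt with rfl | hi
      · exact hout_n h0
      · exact hout i h0 hi

theorem uncut_of_firstReturn (hv : side v = false) (hu : u ≤ c) (hcz : c ≤ z) (hz : z ≤ v)
    (hcut : ∀ x ∈ Ioc c z, ¬ S.IsCut u v x) (hx : x ∈ Icc c z)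
    (h : FirstReturn S.T (Icc u v) x n) : S.Uncut n c z :=
  (uncut_of_not_isCut hv hu hcz hz hcut fun i h0 hi => ⟨x, hx, h.2.2 i h0 hi⟩).1

theorem firstReturn_of_not_isCut (hv : side v = false) (hu : u ≤ c) (hcz : c ≤ z) (hz : z ≤ v)
    (hcut : ∀ x ∈ Ioc c z, ¬ S.IsCut u v x) (hx : x ∈ Icc c z) (hy : y ∈ Icc c z)
    (h : FirstReturn S.T (Icc u v) x n) : FirstReturn S.T (Icc u v) y n := by
  have hout := (uncut_of_not_isCut hv hu hcz hz hcut fun i h0 hi => ⟨x, hx, h.2.2 i h0 hi⟩).2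
  refine ⟨h.1, by_contra fun hyJ => ?_, fun i h0 hi => hout i h0 hi y hy⟩
  have hexit (i : ℕ) (h0 : 0 < i) (hi : i < n + 1) : ∃ w ∈ Icc c z, (S.T ^ i) w ∉ Icc u v := by
    rcases (Nat.lt_succ_iff.1 hi).eq_or_lt with rfl | hi
    · exact ⟨y, hy, hyJ⟩
    · exact ⟨x, hx, h.2.2 i h0 hi⟩
  exact (uncut_of_not_isCut hv hu hcz hz hcut hexit).2 n h.1 n.lt_succ_self x hx h.2.1

variable (S)

theorem exists_bound_firstReturn (u : X) (hv : side v = false) :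
    ∃ M, ∀ z ∈ Icc u v, ∀ n, FirstReturn S.T (Icc u v) z n → n ≤ M := by
  have hfin := (S.finite_isCut u v).insert u
  have hbdd (c : X) : BddAbove {n | FirstReturn S.T (Icc u v) c n} :=
    (Set.Subsingleton.finite fun _ hm _ hn => FirstReturn.unique hm hn).bddAbove
  obtain ⟨M, hM⟩ := (hfin.bddAbove_biUnion (S := fun c => {n | FirstReturn S.T (Icc u v) c n})).2
    fun c _ => hbdd c
  refine ⟨M, fun z hz n hn => ?_⟩
  obtain ⟨c, ⟨hcut, hcz⟩, hmax⟩ := Set.exists_max_image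
    (insert u {x | S.IsCut u v x} ∩ Iic z) id (hfin.inter_of_left _) ⟨u, mem_insert _ _, hz.1⟩
  have hnocut (x : X) (hx : x ∈ Ioc c z) : ¬ S.IsCut u v x := fun h =>
    hx.1.not_ge (hmax x ⟨mem_insert_of_mem _ h, hx.2⟩)
  exact hM (mem_biUnion hcut (firstReturn_of_not_isCut hv (hmax u ⟨mem_insert _ _, hz.1⟩) hcz hz.2
    hnocut ⟨hcz, le_rfl⟩ ⟨le_rfl, hcz⟩ hn))

end Exchange

namespace Exchange

variable {X : Type*} [LinearOrder X] [TopologicalSpace X] [OrderTopology X] {side : X → Bool}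
variable {d : ℕ} (S : Exchange X side d) {f : Equiv.Perm X} {u v x x' g : X} {s : Set X}

theorem visits_pow_left (n : ℕ) : Visits S.T ((S.T ^ n) x) g ↔ Visits S.T x g :=
  GIET.visits_pow_left S.continuous_T S.inv.continuous_T n

theorem visits_inv_pow_left (n : ℕ) : Visits S.T ((S.T⁻¹ ^ n) x) g ↔ Visits S.T x g := by
  rw [← S.visits_pow_left n, inv_pow, Equiv.Perm.inv_def, Equiv.apply_symm_apply]

theorem visits_inv_pow_apply (n : ℕ) : Visits S.T⁻¹ ((S.T ^ n) x) g ↔ Visits S.T⁻¹ x g := by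
  simpa using S.inv.visits_inv_pow_left n (x := x) (g := g)

theorem eventually_pow_notMem_Icc (hu : side u = true) (hv : side v = false) {I : Set ℕ}
    (hI : I.Finite) (h : ∀ n ∈ I, (S.T ^ n) x ∉ Icc u v) :
    ∀ᶠ y in 𝓝 x, ∀ n ∈ I, (S.T ^ n) y ∉ Icc u v :=
  (eventually_all_finite hI).2 fun n hn => (S.continuous_pow n).continuousAt.eventually
    ((S.split.isClopen_Icc hu hv).compl.isOpen.mem_nhds (h n hn))

theorem exists_pow_mem_of_visits (hx : Visits S.T x g) (hx' : Visits S.T x' g) (hs : s ∈ 𝓝 x') :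
    ∃ n : ℕ, (S.T ^ n) x ∈ s := by
  obtain ⟨u, v, hu, hv, hJ, hJs⟩ := S.exists_Icc_subset hs
  obtain ⟨M, hM⟩ := S.exists_bound_firstReturn u hv
  by_contra! hout
  have hnear : ∀ᶠ y in 𝓝 x, ∀ n ∈ Iic M, (S.T ^ n) y ∉ Icc u v :=
    S.eventually_pow_notMem_Icc hu hv (finite_Iic M) fun n _ h => hout n (hJs h)
  have hnhds := S.split.Icc_mem_nhds hu hv hJ
  obtain ⟨n₀, -, hn₀⟩ := hx'.exists_mem hnhds 0
  obtain ⟨n₁, hn₀₁, hn₁⟩ := hx.exists_mem hnear n₀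
  obtain ⟨n₂, hn₁₂, hn₂⟩ := hx'.exists_mem hnhds (n₁ + 1)
  classical
  let P : ℕ → Prop := fun n => (S.T ^ n) g ∈ Icc u v
  -- the last visit of the orbit to `[u, v]` before it comes close to `x`
  let a := Nat.findGreatest P n₁
  have ha : (S.T ^ a) g ∈ Icc u v := Nat.findGreatest_spec (P := P) hn₀₁ hn₀
  have hle : a ≤ n₁ := Nat.findGreatest_le _
  obtain ⟨m, -, hm⟩ := exists_firstReturn (x := (S.T ^ a) g) (n := n₂ - a) (by omega)
    (by rwa [pow_sub_pow_apply S.T (by omega)])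
  have hreturn : (S.T ^ (m + a)) g ∈ Icc u v := by
    rw [pow_add]
    exact hm.2.1
  have hlt : n₁ < m + a := not_le.1 fun h =>
    Nat.findGreatest_is_greatest (P := P) (Nat.lt_add_of_pos_left hm.1) h hreturn
  have hmM := hM _ ha m hm
  exact hn₁ (m + a - n₁) (by simp only [mem_Iic]; omega)
    ((pow_sub_pow_apply S.T hlt.le g).symm ▸ hreturn)

theorem visits_inv_self (hx : Visits S.T x x) : Visits S.T⁻¹ x x := by
  refine Visits.self_of_exists S.inv.continuous_T fun s hs => ?_
  obtain ⟨u, v, hu, hv, hJ, hJs⟩ := S.exists_Icc_subset hs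
  obtain ⟨M, hM⟩ := S.inv.exists_bound_firstReturn u hv
  by_contra! hout
  have hnear : ∀ᶠ y in 𝓝 x, ∀ n ∈ Ioc 0 M, (S.T⁻¹ ^ n) y ∉ Icc u v :=
    S.inv.eventually_pow_notMem_Icc hu hv (finite_Ioc 0 M) fun n hn h => hout n hn.1 (hJs h)
  obtain ⟨n, hn, hfar, hnJ⟩ :=
    hx.exists_mem (inter_mem hnear (S.split.Icc_mem_nhds hu hv hJ)) 1
  obtain ⟨m, -, hm⟩ := exists_firstReturn (f := S.T⁻¹) (x := (S.T ^ n) x) (J := Icc u v) hn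
    (by simpa using hJ)
  exact hfar m ⟨hm.1, hM _ hnJ m hm⟩ hm.2.1

/-- The `ω`-limit set. -/
def limitSet (x : X) : Set X := {y | Visits S.T y x}

theorem limitSet_subset (h : x' ∈ S.limitSet x) : S.limitSet x' ⊆ S.limitSet x := by
  have horbit : range (fun n : ℕ => (S.T ^ n) x') ⊆ S.limitSet x := by
    rintro - ⟨n, rfl⟩
    exact (S.visits_pow_left n).2 h
  exact fun z hz => closure_minimal horbit (isClosed_setOf_visits S.T x) hz.mem_closure_range

theorem mem_limitSet_of_visits (hf : f = S.T ∨ f = S.T⁻¹) (hrec : Visits S.T x x)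
    (hx : Visits f x g) (hx' : Visits f x' g) : x' ∈ S.limitSet x := by
  refine (isClosed_setOf_visits S.T x).closure_subset (mem_closure_iff_nhds.2 fun s hs => ?_)
  rcases hf with rfl | rfl
  · obtain ⟨n, hn⟩ := S.exists_pow_mem_of_visits hx hx' hs
    exact ⟨_, hn, (S.visits_pow_left n).2 hrec⟩
  · obtain ⟨n, hn⟩ := S.inv.exists_pow_mem_of_visits hx hx' hs
    exact ⟨_, hn, (S.visits_inv_pow_left n).2 hrec⟩

theorem limitSet_eq_of_visits (hf : f = S.T ∨ f = S.T⁻¹) (hrec : Visits S.T x x)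
    (hrec' : Visits S.T x' x') (hx : Visits f x g) (hx' : Visits f x' g) :
    S.limitSet x = S.limitSet x' :=
  (S.limitSet_subset (S.mem_limitSet_of_visits hf hrec' hx' hx)).antisymm
    (S.limitSet_subset (S.mem_limitSet_of_visits hf hrec hx hx'))

end Exchange

namespace Exchange

variable {X : Type*} [LinearOrder X] {side : X → Bool} {d : ℕ} {S : Exchange X side d}
variable {m n : ℕ} {c z u v w x x' y y' : X}

theorem lt_of_firstReturn_of_not_isCut (hv : side v = false) (hu : u ≤ c) (hz : z ≤ v)
    (hcut : ∀ x ∈ Ioc c z, ¬ S.IsCut u v x) (hx : x ∈ Icc c z) (hx' : x' ∈ Icc c z) (hlt : x < x')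
    (hm : FirstReturn S.T (Icc u v) x m) (hn : FirstReturn S.T (Icc u v) x' n) :
    (S.T ^ m) x < (S.T ^ n) x' := by
  have hcz := hx.1.trans hx.2
  obtain rfl := (firstReturn_of_not_isCut hv hu hcz hz hcut hx hx' hm).unique hn
  exact ((uncut_of_firstReturn hv hu hcz hz hcut hx hm).increasingOnto hcz).lt hx.1 hlt hx'.2

variable [TopologicalSpace X] [OrderTopology X]

theorem not_returnPreserves_lt (hu : side u = true) (hv : side v = false) (hw : w ∈ Icc u v)
    (hrec : Visits S.T w w) (hper : w ∉ Function.periodicPts S.T) :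
    ¬ ReturnPreserves S.T (Icc u v) (· < ·) := by
  intro hmono
  have hmono' : ReturnPreserves S.T (Icc u v) (· > ·) := fun x y m n hx hy hxy hm hn =>
    hmono hy hx hxy hn hm
  obtain ⟨n, hn, hnJ⟩ := hrec.exists_mem (S.split.Icc_mem_nhds hu hv hw) 1
  obtain ⟨m, -, hm⟩ := exists_firstReturn hn hnJ
  rcases (pow_apply_ne_of_notMem_periodicPts hper hm.1).lt_or_gt with hlt | hgt
  · obtain ⟨b, a, hb, hba, ha, -, ha'⟩ := S.split.sep hlt
    obtain ⟨i, hi, hia⟩ := hrec.exists_mem (S.split.Icc_mem_nhds ha' hv ⟨ha, hw.2⟩) 1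
    have hle := (hmono.pow_eq_or_rel hw hm hlt hi
      ⟨(hm.2.1.1.trans hb).trans (hba.le.trans hia.1), hia.2⟩).elim Eq.le le_of_lt
    exact ((hle.trans hb).trans_lt hba.lt).not_ge hia.1
  · obtain ⟨b, a, hb, hba, ha, hb', -⟩ := S.split.sep hgt
    obtain ⟨i, hi, hib⟩ := hrec.exists_mem (S.split.Icc_mem_nhds hu hb' ⟨hw.1, hb⟩) 1
    have hge := (hmono'.pow_eq_or_rel hw hm hgt hi
      ⟨hib.1, hib.2.trans (hba.le.trans (ha.trans hm.2.1.2))⟩).elim Eq.ge le_of_lt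
    exact (hba.lt.trans_le (ha.trans hge)).not_ge hib.2

/-- Otherwise the first return would be increasing, so that the recurrent `w` would be periodic. -/
theorem exists_flip (hu : side u = true) (hv : side v = false) (hcov : y' ⋖ y) (hy : y ∈ Ioc u v)
    (hcut : ∀ x, S.IsCut u v x → x = y) (hw : w ∈ Icc u v) (hrec : Visits S.T w w)
    (hper : w ∉ Function.periodicPts S.T) :
    ∃ r₁ r₂, (∀ x ∈ Icc u y', FirstReturn S.T (Icc u v) x r₁) ∧
      (∀ x ∈ Icc y v, FirstReturn S.T (Icc u v) x r₂) ∧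
      S.Uncut r₁ u y' ∧ S.Uncut r₂ y v ∧ (S.T ^ r₂) v < (S.T ^ r₁) u := by
  have huy : u ≤ y' := hcov.le_of_lt hy.1
  have hyv : y' ≤ v := hcov.le.trans hy.2
  have hcut₁ (x : X) (hx : x ∈ Ioc u y') : ¬ S.IsCut u v x := fun h =>
    hcov.lt.not_ge (hcut x h ▸ hx.2)
  have hcut₂ (x : X) (hx : x ∈ Ioc y v) : ¬ S.IsCut u v x := fun h => hx.1.ne' (hcut x h)
  by_contra! hle
  refine not_returnPreserves_lt hu hv hw hrec hper fun x x' m n hx hx' hlt hm hn => ?_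
  rcases le_or_gt x' y' with hx'y | hyx'
  · exact lt_of_firstReturn_of_not_isCut hv le_rfl hyv hcut₁ ⟨hx.1, hlt.le.trans hx'y⟩
      ⟨hx'.1, hx'y⟩ hlt hm hn
  replace hyx' : x' ∈ Icc y v := ⟨hcov.ge_of_gt hyx', hx'.2⟩
  rcases le_or_gt y x with hyx | hxy
  · exact lt_of_firstReturn_of_not_isCut hv hy.1.le le_rfl hcut₂ ⟨hyx, hx.2⟩ hyx' hlt hm hn
  replace hxy : x ∈ Icc u y' := ⟨hx.1, hcov.le_of_lt hxy⟩
  have hm' (p : X) (hp : p ∈ Icc u y') : FirstReturn S.T (Icc u v) p m :=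
    firstReturn_of_not_isCut hv le_rfl huy hyv hcut₁ hxy hp hm
  have hn' (q : X) (hq : q ∈ Icc y v) : FirstReturn S.T (Icc u v) q n :=
    firstReturn_of_not_isCut hv hy.1.le hy.2 le_rfl hcut₂ hyx' hq hn
  have huncut₁ := uncut_of_firstReturn hv le_rfl huy hyv hcut₁ hxy hm
  have huncut₂ := uncut_of_firstReturn hv hy.1.le hy.2 le_rfl hcut₂ hyx' hn
  have hinc₁ := huncut₁.increasingOnto huy
  have hinc₂ := huncut₂.increasingOnto hy.2
  have hne (p : X) (hp : p ∈ Icc u y') (q : X) (hq : q ∈ Icc y v) : (S.T ^ m) p ≠ (S.T ^ n) q :=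
    fun h => (hp.2.trans_lt (hcov.lt.trans_le hq.1)).ne <|
      eq_of_pow_eq_of_notMem (J := Icc u v) ⟨hp.1, hp.2.trans hyv⟩ ⟨hy.1.le.trans hq.1, hq.2⟩
        hm.1 hn.1 (hm' p hp).2.2 (hn' q hq).2.2 h
  exact (hinc₁.le hxy.1 hxy.2 le_rfl).trans_lt <|
    (hinc₁.lt_of_forall_ne hinc₂ huy hy.2 hne (hle m n hm' hn' huncut₁ huncut₂)).trans_le
      (hinc₂.le le_rfl hyx'.1 hyx'.2)

end Exchange

/-! ### Jumps and return gaps -/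

namespace Exchange

variable {X : Type*} [LinearOrder X] {side : X → Bool} {d : ℕ}

/-- The first return to `[u, v]` near the orbits of a jump `b ⋖ a`: both sides of the jump come back
to `[u, v]` at time `t`, no orbit segment with ends in `[u, v]` ends strictly between the two return
points, and the jump is turned over on its way. -/
structure ReturnGap (S : Exchange X side d) (a b u v : X) (t : ℕ) : Prop where
  exists_pow_u : ∃ n : ℕ, (S.T ^ n) u = a
  exists_pow_v : ∃ m : ℕ, (S.T ^ m) v = b
  pow_a_ne : ∀ h : ℕ, 0 < h → (S.T ^ h) a ≠ a
  pow_b_ne : ∀ h : ℕ, 0 < h → (S.T ^ h) b ≠ b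
  not_covBy_u : ∀ h : ℕ, 0 < h → ¬ (S.T ^ h) b ⋖ u
  not_v_covBy : ∀ h : ℕ, 0 < h → ¬ v ⋖ (S.T ^ h) a
  firstReturn_a : FirstReturn S.T (Icc u v) a t
  firstReturn_b : FirstReturn S.T (Icc u v) b t
  lt : (S.T ^ t) b < (S.T ^ t) a
  gap : ∀ x ∈ Icc u v, ∀ i : ℕ, 0 < i → (S.T ^ i) x ∈ Icc u v →
    (S.T ^ i) x ∉ Ioo ((S.T ^ t) b) ((S.T ^ t) a)
  flip : ∃ h : ℕ, 0 < h ∧ h < t ∧ (S.T ^ h) a < (S.T ^ h) b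

/-- The orbits `Q` and `P` of a jump `Q 0 ⋖ P 0` that stays a jump in the past, and an interval
`[P (-n), Q (-m)]` around a recurrent aperiodic point for which this jump is the only source of
cuts; `k` is the first time at which the backward orbit of the jump enters the interval. -/
structure JumpFrame (S : Exchange X side d) [TopologicalSpace X] (P Q : ℤ → X) (n m k : ℕ) :
    Prop where
  pow_P : ∀ (i : ℕ) (s : ℤ), (S.T ^ i) (P s) = P (s + i)
  pow_Q : ∀ (i : ℕ) (s : ℤ), (S.T ^ i) (Q s) = Q (s + i)
  injective_P : Function.Injective P
  injective_Q : Function.Injective Q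
  covBy : ∀ s ≤ 0, Q s ⋖ P s
  n_lt : n < k
  m_lt : m < k
  mem : P (-k) ∈ Ioc (P (-n)) (Q (-m))
  notMem : ∀ i : ℕ, i < k → P (-i) ∉ Ioc (P (-n)) (Q (-m))
  exists_eq_P : ∀ x ∈ Icc (P (-n)) (Q (-m)), ∀ (i : ℕ) (j : Fin d), (S.T ^ i) x = S.l j →
    ∃ h : ℕ, h ≤ i ∧ S.l j = P h
  exists_recurrent : ∃ w ∈ Icc (P (-n)) (Q (-m)), Visits S.T w w ∧ w ∉ Function.periodicPts S.T

namespace JumpFrame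

variable {S : Exchange X side d} [TopologicalSpace X] {P Q : ℤ → X} {n m k : ℕ}
variable (F : S.JumpFrame P Q n m k)
include F

theorem side_P {s : ℤ} (hs : s ≤ 0) : side (P s) = true := (S.split.side_of_covBy (F.covBy s hs)).2

theorem side_Q {s : ℤ} (hs : s ≤ 0) : side (Q s) = false := (S.split.side_of_covBy (F.covBy s hs)).1

theorem eq_of_isCut {x : X} (hx : S.IsCut (P (-n)) (Q (-m)) x) : x = P (-k) := by
  obtain ⟨hx, i, hmark, hout⟩ := hx
  have hnk := F.n_lt
  have hmk := F.m_lt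
  have eq_of_eq (k' : ℕ) (hxk : x = P (-k')) (hk' : k' < k + i) : x = P (-k) := by
    rcases lt_trichotomy k' k with hlt | rfl | hgt
    · exact absurd (hxk ▸ hx) (F.notMem k' hlt)
    · exact hxk
    · refine absurd ?_ (hout (k' - k) (by omega) (by omega))
      rw [hxk, F.pow_P, show -(k' : ℤ) + (k' - k : ℕ) = -k by omega]
      exact Ioc_subset_Icc_self F.mem
  have eq_P {s : ℤ} (h : (S.T ^ i) x = P s) : x = P (s - i) :=
    (S.T ^ i).injective (by rw [h, F.pow_P, sub_add_cancel])
  rcases hmark with ⟨j, hj⟩ | hu | hv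
  · obtain ⟨h, hhi, hh⟩ := F.exists_eq_P x (Ioc_subset_Icc_self hx) i j hj.symm
    refine eq_of_eq (i - h) ?_ (by omega)
    rw [eq_P (hj.symm.trans hh), show (h : ℤ) - i = -(i - h : ℕ) by omega]
  · refine eq_of_eq (n + i) ?_ (by omega)
    rw [eq_P hu, show -(n : ℤ) - i = -(n + i : ℕ) by omega]
  · refine eq_of_eq (m + i) ?_ (by omega)
    rw [eq_P (CovBy.unique_right hv (F.covBy (-m) (by omega))),
      show -(m : ℤ) - i = -(m + i : ℕ) by omega]

theorem firstReturn_P : FirstReturn S.T (Icc (P (-n)) (Q (-m))) (P (-k)) (k - n) := by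
  have hnk := F.n_lt
  refine ⟨by omega, ?_, fun i h0 hi hmem => ?_⟩
  · rw [F.pow_P, show -(k : ℤ) + (k - n : ℕ) = -n by omega]
    exact ⟨le_rfl, F.mem.1.le.trans F.mem.2⟩
  · rw [F.pow_P, show -(k : ℤ) + i = -(k - i : ℕ) by omega] at hmem
    refine F.notMem (k - i) (by omega) ⟨hmem.1.lt_of_ne fun h => ?_, hmem.2⟩
    have := F.injective_P h
    omega

theorem firstReturn_Q : FirstReturn S.T (Icc (P (-n)) (Q (-m))) (Q (-k)) (k - m) := by
  have hmk := F.m_lt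
  refine ⟨by omega, ?_, fun i h0 hi hmem => ?_⟩
  · rw [F.pow_Q, show -(k : ℤ) + (k - m : ℕ) = -m by omega]
    exact ⟨F.mem.1.le.trans F.mem.2, le_rfl⟩
  · rw [F.pow_Q, show -(k : ℤ) + i = -(k - i : ℕ) by omega] at hmem
    have hcov := F.covBy (-(k - i : ℕ)) (by omega)
    refine F.notMem (k - i) (by omega) ⟨hmem.1.trans_lt hcov.lt, hcov.ge_of_gt ?_⟩
    refine hmem.2.lt_of_ne fun h => ?_
    have := F.injective_Q h
    omega

theorem Q_mem : Q (-k) ∈ Ico (P (-n)) (Q (-m)) :=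
  have hcov := F.covBy (-k) (by omega)
  ⟨hcov.le_of_lt F.mem.1, hcov.lt.trans_le F.mem.2⟩

theorem exists_flip [OrderTopology X] :
    (∀ x ∈ Icc (P (-n)) (Q (-k)), FirstReturn S.T (Icc (P (-n)) (Q (-m))) x (k - m)) ∧
      (∀ x ∈ Icc (P (-k)) (Q (-m)), FirstReturn S.T (Icc (P (-n)) (Q (-m))) x (k - n)) ∧
      S.Uncut (k - m) (P (-n)) (Q (-k)) ∧ S.Uncut (k - n) (P (-k)) (Q (-m)) ∧
      Q (k - m - n) < P (k - m - n) := by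
  have hnk := F.n_lt
  have hmk := F.m_lt
  obtain ⟨w, hw, hrec, hper⟩ := F.exists_recurrent
  obtain ⟨r₁, r₂, hret₁, hret₂, huncut₁, huncut₂, hlt⟩ :=
    Exchange.exists_flip (F.side_P (by omega)) (F.side_Q (by omega)) (F.covBy (-k) (by omega))
      F.mem (fun _ => F.eq_of_isCut) hw hrec hper
  obtain rfl := (hret₁ _ ⟨F.Q_mem.1, le_rfl⟩).unique F.firstReturn_Q
  obtain rfl := (hret₂ _ ⟨le_rfl, F.mem.2⟩).unique F.firstReturn_P
  rw [F.pow_P, F.pow_Q, show -(n : ℤ) + (k - m : ℕ) = k - m - n by omega,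
    show -(m : ℤ) + (k - n : ℕ) = k - m - n by omega] at hlt
  exact ⟨hret₁, hret₂, huncut₁, huncut₂, hlt⟩

theorem firstReturn_u [OrderTopology X] :
    FirstReturn S.T (Icc (P (-n)) (Q (-m))) (P (-n)) (k - m) :=
  F.exists_flip.1 _ ⟨le_rfl, F.Q_mem.1⟩

theorem firstReturn_v [OrderTopology X] :
    FirstReturn S.T (Icc (P (-n)) (Q (-m))) (Q (-m)) (k - n) :=
  F.exists_flip.2.1 _ ⟨F.mem.2, le_rfl⟩

theorem add_lt [OrderTopology X] : m + n < k := by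
  have hnk := F.n_lt
  have hmk := F.m_lt
  by_contra! hle
  have hu := F.firstReturn_u.2.1
  have hv := F.firstReturn_v.2.1
  have hlt := F.exists_flip.2.2.2.2
  rw [F.pow_P, show -(n : ℤ) + (k - m : ℕ) = -(m + n - k : ℕ) by omega] at hu
  rw [F.pow_Q, show -(m : ℤ) + (k - n : ℕ) = -(m + n - k : ℕ) by omega] at hv
  rw [show (k : ℤ) - m - n = -(m + n - k : ℕ) by omega] at hlt
  exact F.notMem (m + n - k) (by omega) ⟨hv.1.trans_lt hlt, hu.2⟩

/-- If the jump were never turned over, the least point of the orbit segment of `P` that starts at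
`P (-k)` would have its `Q`-partner below it, and the latter is preceded by a later point of `P`. -/
theorem exists_P_lt_Q [OrderTopology X] :
    ∃ h : ℕ, 0 < h ∧ h < k - m - n ∧ P h < Q h := by
  have hadd := F.add_lt
  obtain ⟨-, -, huncut₁, huncut₂, -⟩ := F.exists_flip
  by_contra! hcon
  obtain ⟨s, hs, hmin⟩ := Finset.exists_min_image (Finset.Ico (-(k : ℤ)) (k - m - n)) P
    ⟨0, Finset.mem_Ico.2 (by omega)⟩
  simp only [Finset.mem_Ico] at hs hmin
  have hQP : Q s < P s := by
    rcases le_or_gt s 0 with hs0 | hs0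
    · exact (F.covBy s hs0).lt
    · lift s to ℕ using hs0.le
      refine (hcon s (by omega) (by omega)).lt_of_ne fun heq => ?_
      have hside := S.side_pow s (P 0)
      rw [F.pow_P, zero_add, ← heq, ← zero_add (s : ℤ), ← F.pow_Q, S.side_pow,
        F.side_P le_rfl, F.side_Q le_rfl] at hside
      exact Bool.false_ne_true hside
  rcases lt_or_ge s (-m) with hsm | hsm
  · obtain ⟨i, rfl⟩ : ∃ i : ℕ, s = -k + i := ⟨(s + k).toNat, by omega⟩
    have hle := ((huncut₁.mono (m := i) (by omega) le_rfl le_rfl).increasingOnto F.Q_mem.1).le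
      le_rfl F.Q_mem.1 le_rfl
    rw [F.pow_P, F.pow_Q] at hle
    exact (hmin _ (by omega)).not_gt (hle.trans_lt hQP)
  · obtain ⟨i, rfl⟩ : ∃ i : ℕ, s = -m + i := ⟨(s + m).toNat, by omega⟩
    have hle := ((huncut₂.mono (m := i) (by omega) le_rfl le_rfl).increasingOnto F.mem.2).le
      le_rfl F.mem.2 le_rfl
    rw [F.pow_P, F.pow_Q] at hle
    exact (hmin _ (by omega)).not_gt (hle.trans_lt hQP)

theorem notMem_Ioo [OrderTopology X] {x : X} (hx : x ∈ Icc (P (-n)) (Q (-m))) {i : ℕ} (hi : 0 < i)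
    (hmem : (S.T ^ i) x ∈ Icc (P (-n)) (Q (-m))) :
    (S.T ^ i) x ∉ Ioo (Q (k - m - n)) (P (k - m - n)) := by
  have hadd := F.add_lt
  obtain ⟨hret₁, hret₂, huncut₁, huncut₂, -⟩ := F.exists_flip
  refine forall_pow_of_forall_firstReturn
    (p := fun y => y ∉ Ioo (Q (k - m - n)) (P (k - m - n))) (fun y hy r hr hgap => ?_) hx hi hmem
  rcases le_or_gt y (Q (-k)) with hyQ | hyQ
  · obtain rfl := hr.unique (hret₁ y ⟨hy.1, hyQ⟩)
    have hle := (huncut₁.increasingOnto F.Q_mem.1).le le_rfl hy.1 hyQ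
    rw [F.pow_P, show -(n : ℤ) + (k - m : ℕ) = k - m - n by omega] at hle
    exact hgap.2.not_ge hle
  · replace hyQ := (F.covBy (-k) (by omega)).ge_of_gt hyQ
    obtain rfl := hr.unique (hret₂ y ⟨hyQ, hy.2⟩)
    have hle := (huncut₂.increasingOnto F.mem.2).le hyQ hy.2 le_rfl
    rw [F.pow_Q, show -(m : ℤ) + (k - n : ℕ) = k - m - n by omega] at hle
    exact hgap.1.not_ge hle

theorem firstReturn_P_zero [OrderTopology X] :
    FirstReturn S.T (Icc (P (-n)) (Q (-m))) (P 0) (k - m - n) := by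
  have hadd := F.add_lt
  have hu := F.firstReturn_u
  have hshift (i : ℕ) : (S.T ^ i) (P 0) = (S.T ^ (i + n)) (P (-n)) := by
    rw [F.pow_P, F.pow_P, show -(n : ℤ) + (i + n : ℕ) = 0 + i by omega]
  refine ⟨by omega, ?_, fun i h0 hi => ?_⟩
  · rw [hshift, Nat.sub_add_cancel (by omega)]
    exact hu.2.1
  · rw [hshift]
    exact hu.2.2 _ (by omega) (by omega)

theorem firstReturn_Q_zero [OrderTopology X] :
    FirstReturn S.T (Icc (P (-n)) (Q (-m))) (Q 0) (k - m - n) := by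
  have hadd := F.add_lt
  have hv := F.firstReturn_v
  have hshift (i : ℕ) : (S.T ^ i) (Q 0) = (S.T ^ (i + m)) (Q (-m)) := by
    rw [F.pow_Q, F.pow_Q, show -(m : ℤ) + (i + m : ℕ) = 0 + i by omega]
  refine ⟨by omega, ?_, fun i h0 hi => ?_⟩
  · rw [hshift, show k - m - n + m = k - n by omega]
    exact hv.2.1
  · rw [hshift]
    exact hv.2.2 _ (by omega) (by omega)

theorem returnGap [OrderTopology X] :
    S.ReturnGap (P 0) (Q 0) (P (-n)) (Q (-m)) (k - m - n) := by
  have hadd := F.add_lt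
  have ht : ((k - m - n : ℕ) : ℤ) = k - m - n := by omega
  have hcov_u := F.covBy (-n) (by omega)
  have hcov_v := F.covBy (-m) (by omega)
  refine ⟨⟨n, ?_⟩, ⟨m, ?_⟩, fun h h0 heq => ?_, fun h h0 heq => ?_, fun h h0 hc => ?_,
    fun h h0 hc => ?_, F.firstReturn_P_zero, F.firstReturn_Q_zero, ?_, fun x hx i hi hmem => ?_, ?_⟩
  · rw [F.pow_P, neg_add_cancel]
  · rw [F.pow_Q, neg_add_cancel]
  · rw [F.pow_P] at heq
    have := F.injective_P heq
    omega
  · rw [F.pow_Q] at heq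
    have := F.injective_Q heq
    omega
  · rw [F.pow_Q] at hc
    have := F.injective_Q (hc.unique_left hcov_u)
    omega
  · rw [F.pow_P] at hc
    have := F.injective_P (hc.unique_right hcov_v)
    omega
  · rw [F.pow_P, F.pow_Q, zero_add, ht]
    exact F.exists_flip.2.2.2.2
  · rw [F.pow_P, F.pow_Q, zero_add, ht]
    exact F.notMem_Ioo hx hi hmem
  · simpa only [F.pow_P, F.pow_Q, zero_add] using F.exists_P_lt_Q

end JumpFrame

end Exchange

theorem exists_first_entry {X : Type*} [LinearOrder X] {A : ℕ → X} {w : X} {i₁ i₂ : ℕ}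
    (h₁ : w < A i₁) (h₂ : A i₂ ≤ w)
    (h : ∀ n m, A n ≤ w → w < A m → ∃ k, A k ∈ Ioo (A n) (A m)) :
    ∃ n m k, n < k ∧ m < k ∧ w ∈ Ico (A n) (A m) ∧ A i₂ ≤ A n ∧ A m ≤ A i₁ ∧
      A k ∈ Ioo (A n) (A m) ∧ ∀ i < k, A i ∉ Ioo (A n) (A m) := by
  classical
  let N := max i₁ i₂
  obtain ⟨n, hn, hnmax⟩ := Finset.exists_max_image {i ∈ Finset.range (N + 1) | A i ≤ w} A
    ⟨i₂, by simp only [Finset.mem_filter, Finset.mem_range]; exact ⟨by omega, h₂⟩⟩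
  obtain ⟨m, hm, hmmin⟩ := Finset.exists_min_image {i ∈ Finset.range (N + 1) | w < A i} A
    ⟨i₁, by simp only [Finset.mem_filter, Finset.mem_range]; exact ⟨by omega, h₁⟩⟩
  simp only [Finset.mem_filter, Finset.mem_range] at hn hm hnmax hmmin
  have hk := h n m hn.2 hm.2
  have hlt : N < Nat.find hk := by
    refine (Nat.lt_find_iff hk N).2 fun i hi hmem => ?_
    rcases le_or_gt (A i) w with hle | hgt
    · exact hmem.1.not_ge (hnmax i ⟨by omega, hle⟩)
    · exact hmem.2.not_ge (hmmin i ⟨by omega, hgt⟩)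
  exact ⟨n, m, Nat.find hk, by omega, by omega, ⟨hn.2, hm.2⟩, hnmax i₂ ⟨by omega, h₂⟩,
    hmmin i₁ ⟨by omega, h₁⟩, Nat.find_spec hk, fun i hi => Nat.find_min hk hi⟩

section Aperiodic

variable {X : Type*} {f : Equiv.Perm X} {x : X}

theorem injective_zpow_apply (hx : x ∉ Function.periodicPts f) :
    Function.Injective fun i : ℤ => (f ^ i) x := by
  intro i j hij
  wlog hle : i ≤ j generalizing i j
  · exact (this hij.symm (not_le.1 hle).le).symm
  obtain ⟨n, rfl⟩ := Int.le.dest hle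
  by_contra hne
  refine pow_apply_ne_of_notMem_periodicPts hx (n := n) (by omega) ((f ^ i).injective ?_)
  simpa [zpow_add] using hij.symm

theorem injective_pow_apply (hx : x ∉ Function.periodicPts f) :
    Function.Injective fun n : ℕ => (f ^ n) x := fun m n h => by
  simpa using injective_zpow_apply hx (a₁ := m) (a₂ := n) (by simpa using h)

theorem pow_notMem_periodicPts (hx : x ∉ Function.periodicPts f) (n : ℕ) :
    (f ^ n) x ∉ Function.periodicPts f := by
  intro hper
  obtain ⟨m, hm, hper⟩ := mem_periodicPts_iff.1 hper
  refine pow_apply_ne_of_notMem_periodicPts hx hm ((f ^ n).injective ?_)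
  rwa [← Equiv.Perm.mul_apply, ← pow_add, add_comm, pow_add] at hper

theorem inv_pow_apply_ne (hx : x ∉ Function.periodicPts f) {n : ℕ} (hn : 0 < n) :
    (f⁻¹ ^ n) x ≠ x := by
  rw [inv_pow, Ne, Equiv.Perm.inv_eq_iff_eq]
  exact (pow_apply_ne_of_notMem_periodicPts hx hn).symm

theorem zpow_neg_natCast_apply (x : X) (n : ℕ) : (f ^ (-n : ℤ)) x = (f⁻¹ ^ n) x := by
  rw [inv_pow, zpow_neg, zpow_natCast]

variable [TopologicalSpace X] {g : X}

theorem Visits.exists_ne (h : Visits f x g) (hg : ∀ n : ℕ, 0 < n → (f ^ n) g ≠ g) {s : Set X}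
    (hs : s ∈ 𝓝 x) (p : X) : ∃ n : ℕ, (f ^ n) g ∈ s ∧ (f ^ n) g ≠ p := by
  obtain ⟨n, -, hn⟩ := h.exists_mem hs 0
  obtain ⟨m, hm, hm'⟩ := h.exists_mem hs (n + 1)
  by_cases hp : (f ^ n) g = p
  · refine ⟨m, hm', fun hp' => hg (m - n) (by omega) ((f ^ n).injective ?_)⟩
    rw [pow_pow_sub_apply f (by omega), hp, hp']
  · exact ⟨n, hn, hp⟩

theorem notMem_periodicPts_of_visits_inv [T1Space X] (hx : x ∉ Function.periodicPts f)
    (h : Visits f⁻¹ x g) : g ∉ Function.periodicPts f := by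
  intro hper
  obtain ⟨n, hn, hg⟩ := mem_periodicPts_iff.1 hper
  have hginv : (f⁻¹ ^ n) g = g := by rw [inv_pow, Equiv.Perm.inv_eq_iff_eq, hg]
  obtain ⟨m, rfl⟩ := h.mem_range_of_isPeriodicPt hn hginv
  refine inv_pow_apply_ne hx hn ?_
  rw [← Equiv.Perm.mul_apply, ← pow_add, add_comm, pow_add, Equiv.Perm.mul_apply, hginv]

end Aperiodic

namespace Exchange

variable {X : Type*} [LinearOrder X] {side : X → Bool} {d : ℕ} {S : Exchange X side d}
variable {a b x : X} {U : Set X}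

theorem covBy_inv_pow (hcov : b ⋖ a) (hpast : ∀ i : ℕ, 0 < i → ∀ j, (S.T⁻¹ ^ i) a ≠ S.l j)
    (i : ℕ) : (S.T⁻¹ ^ i) b ⋖ (S.T⁻¹ ^ i) a := by
  induction i with
  | zero => exact hcov
  | succ i ih =>
    rw [pow_succ', Equiv.Perm.mul_apply, Equiv.Perm.mul_apply]
    refine S.inv.covBy_apply ih fun j hj => hpast (i + 1) i.succ_pos j ?_
    rw [pow_succ', Equiv.Perm.mul_apply, hj]
    simp

theorem notMem_periodicPts_of_covBy_inv_pow (ha : a ∉ Function.periodicPts S.T)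
    (hcov : ∀ i : ℕ, (S.T⁻¹ ^ i) b ⋖ (S.T⁻¹ ^ i) a) : b ∉ Function.periodicPts S.T := by
  intro hper
  obtain ⟨n, hn, hb⟩ := mem_periodicPts_iff.1 hper
  have hbn := hcov n
  rw [inv_pow, Equiv.Perm.inv_eq_iff_eq.2 hb.symm, ← inv_pow] at hbn
  exact inv_pow_apply_ne ha hn (hbn.unique_right (hcov 0))

theorem jumpFrame_zpow [TopologicalSpace X] {n m k : ℕ} (ha : a ∉ Function.periodicPts S.T)
    (hcov : ∀ i : ℕ, (S.T⁻¹ ^ i) b ⋖ (S.T⁻¹ ^ i) a) (hn : n < k) (hm : m < k)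
    (hk : (S.T⁻¹ ^ k) a ∈ Ioo ((S.T⁻¹ ^ n) a) ((S.T⁻¹ ^ m) a))
    (hkmin : ∀ i < k, (S.T⁻¹ ^ i) a ∉ Ioo ((S.T⁻¹ ^ n) a) ((S.T⁻¹ ^ m) a))
    (hl : ∀ y ∈ Icc ((S.T⁻¹ ^ n) a) ((S.T⁻¹ ^ m) b), ∀ (i : ℕ) (j : Fin d), (S.T ^ i) y = S.l j →
      ∃ h : ℕ, h ≤ i ∧ S.l j = (S.T ^ h) a)
    (hw : ∃ w ∈ Icc ((S.T⁻¹ ^ n) a) ((S.T⁻¹ ^ m) b),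
      Visits S.T w w ∧ w ∉ Function.periodicPts S.T) :
    S.JumpFrame (fun s => (S.T ^ s) a) (fun s => (S.T ^ s) b) n m k := by
  have hadd (y : X) (i : ℕ) (s : ℤ) : (S.T ^ i) ((S.T ^ s) y) = (S.T ^ (s + i)) y := by
    rw [add_comm, zpow_add, zpow_natCast, Equiv.Perm.mul_apply]
  exact {
    pow_P := hadd a
    pow_Q := hadd b
    injective_P := injective_zpow_apply ha
    injective_Q := injective_zpow_apply (notMem_periodicPts_of_covBy_inv_pow ha hcov)
    covBy := fun s hs => by
      obtain ⟨i, rfl⟩ : ∃ i : ℕ, s = -i := ⟨(-s).toNat, by omega⟩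
      simpa only [zpow_neg_natCast_apply] using hcov i
    n_lt := hn
    m_lt := hm
    mem := by
      simpa only [zpow_neg_natCast_apply] using ⟨hk.1, (hcov m).le_of_lt hk.2⟩
    notMem := fun i hi h => by
      simp only [zpow_neg_natCast_apply] at h
      exact hkmin i hi ⟨h.1, h.2.trans_lt (hcov m).lt⟩
    exists_eq_P := by simpa only [zpow_neg_natCast_apply, zpow_natCast] using hl
    exists_recurrent := by simpa only [zpow_neg_natCast_apply] using hw }

variable [TopologicalSpace X] [OrderTopology X]

theorem exists_interval_around_recurrent (hx : Visits S.T x x) (hper : x ∉ Function.periodicPts S.T)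
    (hside : side x = true) (hcov : ∀ i : ℕ, (S.T⁻¹ ^ i) b ⋖ (S.T⁻¹ ^ i) a)
    (hvis : Visits S.T⁻¹ x a) (hU : U ∈ 𝓝 x) :
    ∃ (n i₁ i₂ : ℕ), (S.T⁻¹ ^ i₂) a < (S.T ^ n) x ∧ (S.T ^ n) x < (S.T⁻¹ ^ i₁) a ∧
      Icc ((S.T⁻¹ ^ i₂) a) ((S.T⁻¹ ^ i₁) a) ⊆ U := by
  have ha (n : ℕ) (hn : 0 < n) := inv_pow_apply_ne (notMem_periodicPts_of_visits_inv hper hvis) hn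
  obtain ⟨u, v, -, hv, hxuv, hsub⟩ := S.exists_Icc_subset hU
  obtain ⟨i₁, hi₁, hne₁⟩ := hvis.exists_ne ha (S.split.Icc_mem_nhds hside hv ⟨le_rfl, hxuv.2⟩) x
  obtain ⟨n, hn, hne⟩ := hx.exists_ne (fun _ => pow_apply_ne_of_notMem_periodicPts hper)
    (S.split.Icc_mem_nhds hside (S.split.side_of_covBy (hcov i₁)).1
      ⟨le_rfl, (hcov i₁).le_of_lt (hi₁.1.lt_of_ne hne₁.symm)⟩) x
  obtain ⟨v', u', hxv', hvu', hu', hv', -⟩ := S.split.sep (hn.1.lt_of_ne hne.symm)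
  obtain ⟨i₂, -, hi₂⟩ := hvis.exists_mem (S.split.Icc_mem_nhds hside hv' ⟨le_rfl, hxv'⟩) 0
  exact ⟨n, i₁, i₂, hi₂.2.trans_lt (hvu'.lt.trans_le hu'), hn.2.trans_lt (hcov i₁).lt,
    (Icc_subset_Icc (hxuv.1.trans hi₂.1) hi₁.2).trans hsub⟩

theorem exists_returnGap (hx : Visits S.T x x) (hper : x ∉ Function.periodicPts S.T)
    (hside : side x = true) (hcov : b ⋖ a)
    (hpast : ∀ i : ℕ, 0 < i → ∀ j, (S.T⁻¹ ^ i) a ≠ S.l j) (hvis : Visits S.T⁻¹ x a) (hU : U ∈ 𝓝 x)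
    (hl : ∀ y ∈ U, ∀ (i : ℕ) (j : Fin d), (S.T ^ i) y = S.l j →
      ∃ h : ℕ, h ≤ i ∧ S.l j = (S.T ^ h) a) :
    ∃ u v t, Icc u v ⊆ U ∧ S.ReturnGap a b u v t := by
  have hcov' := covBy_inv_pow hcov hpast
  have ha := notMem_periodicPts_of_visits_inv hper hvis
  obtain ⟨r, i₁, i₂, hi₂, hi₁, hsub⟩ :=
    exists_interval_around_recurrent hx hper hside hcov' hvis hU
  obtain ⟨n, m, k, hnk, hmk, hw, hn, hm, hk, hkmin⟩ := exists_first_entry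
    (A := fun i => (S.T⁻¹ ^ i) a) hi₁ hi₂.le fun n m hn hm => by
      obtain ⟨k, hk, hne⟩ := Visits.exists_ne ((S.visits_inv_pow_apply r).2 hvis)
        (fun _ => inv_pow_apply_ne ha)
        (S.split.Icc_mem_nhds (S.split.side_of_covBy (hcov' n)).2
          (S.split.side_of_covBy (hcov' m)).1 ⟨hn, (hcov' m).le_of_lt hm⟩) ((S.T⁻¹ ^ n) a)
      exact ⟨k, hk.1.lt_of_ne hne.symm, hk.2.trans_lt (hcov' m).lt⟩
  have hIcc : Icc ((S.T⁻¹ ^ n) a) ((S.T⁻¹ ^ m) b) ⊆ U :=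
    (Icc_subset_Icc hn ((hcov' m).le.trans hm)).trans hsub
  have hgap := (jumpFrame_zpow ha hcov' hnk hmk hk hkmin (fun y hy => hl y (hIcc hy))
    ⟨_, ⟨hw.1, (hcov' m).le_of_lt hw.2⟩, (S.visits_pow_left r).2 ((visits_pow_right r).2 hx),
      pow_notMem_periodicPts hper r⟩).returnGap
  simp only [zpow_neg_natCast_apply, zpow_zero, Equiv.Perm.one_apply] at hgap
  exact ⟨_, _, _, hIcc, hgap⟩

end Exchange

section Hits

variable {X : Type*} {d : ℕ} {f : Equiv.Perm X} {e : Fin d → X} {J : Set X} {y z : X} {n t : ℕ}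
variable {j : Fin d}

open Classical in
/-- The indices `j` for which the forward orbit of `e j` under `f` meets `J`. -/
noncomputable def hits (f : Equiv.Perm X) (e : Fin d → X) (J : Set X) : Finset (Fin d) :=
  {j | ∃ i : ℕ, (f ^ i) (e j) ∈ J}

open Classical in
/-- The indices `j` for which `e j` lies on the orbit segment `y, f y, …, f ^ (t - 1) y`. -/
noncomputable def onSegment (f : Equiv.Perm X) (e : Fin d → X) (y : X) (t : ℕ) : Finset (Fin d) :=
  {j | ∃ h < t, e j = (f ^ h) y}

theorem mem_hits : j ∈ hits f e J ↔ ∃ i : ℕ, (f ^ i) (e j) ∈ J := by simp [hits]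

theorem mem_onSegment : j ∈ onSegment f e y t ↔ ∃ h < t, e j = (f ^ h) y := by simp [onSegment]

theorem onSegment_subset_hits (h : (f ^ t) y ∈ J) : onSegment f e y t ⊆ hits f e J := by
  intro j hj
  obtain ⟨i, hi, hij⟩ := mem_onSegment.1 hj
  exact mem_hits.2 ⟨t - i, by rwa [hij, pow_sub_pow_apply f hi.le]⟩

theorem onSegment_subset_hits_inv (hz : (f ^ n) z = y) (hJ : z ∈ J) :
    onSegment f e y t ⊆ hits f⁻¹ e J := by
  intro j hj
  obtain ⟨i, -, hij⟩ := mem_onSegment.1 hj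
  refine mem_hits.2 ⟨i + n, ?_⟩
  rwa [hij, ← hz, ← Equiv.Perm.mul_apply (f ^ i), ← pow_add, inv_pow, Equiv.Perm.inv_def,
    Equiv.symm_apply_apply]

theorem FirstReturn.exists_of_mem_onSegment (h : FirstReturn f J y t)
    (hj : j ∈ onSegment f e y t) : ∃ s, FirstReturn f J (e j) s ∧ (f ^ s) (e j) = (f ^ t) y := by
  obtain ⟨i, hi, hij⟩ := mem_onSegment.1 hj
  have hend : (f ^ (t - i)) (e j) = (f ^ t) y := by rw [hij, pow_sub_pow_apply f hi.le]
  refine ⟨t - i, ⟨by omega, hend ▸ h.2.1, fun k h0 hk => ?_⟩, hend⟩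
  rw [hij, ← Equiv.Perm.mul_apply, ← pow_add]
  exact h.2.2 (k + i) (by omega) (by omega)

theorem one_lt_card_onSegment {i j : Fin d} {h : ℕ} (hy : ∀ n : ℕ, 0 < n → (f ^ n) y ≠ y)
    (hi : e i = y) (h0 : 0 < h) (ht : h < t) (hj : e j = (f ^ h) y) :
    1 < (onSegment f e y t).card :=
  Finset.one_lt_card.2 ⟨i, mem_onSegment.2 ⟨0, h0.trans ht, hi⟩, j, mem_onSegment.2 ⟨h, ht, hj⟩,
    fun hij => hy h h0 (by rw [← hj, ← hij, hi])⟩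

end Hits

namespace Exchange

variable {X : Type*} [LinearOrder X] {side : X → Bool} {d : ℕ} (S : Exchange X side d)

/-- The number of endpoint ends, that is, of backward and forward orbits of endpoints, that meet
`J`. -/
noncomputable def hitCount (J : Set X) : ℕ :=
  (hits S.T⁻¹ S.l J).card + (hits S.T⁻¹ S.r J).card + (hits S.T S.l J).card +
    (hits S.T S.r J).card

theorem dual_pow_toDual (n : ℕ) (x : X) :
    (S.dual.T ^ n) (OrderDual.toDual x) = OrderDual.toDual ((S.T ^ n) x) := by
  induction n with
  | zero => rfl
  | succ n ih => rw [pow_succ', Equiv.Perm.mul_apply, ih, pow_succ', Equiv.Perm.mul_apply]; rfl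

theorem hits_dual (u v : X) :
    hits S.dual.T S.dual.l (Icc (OrderDual.toDual v) (OrderDual.toDual u)) =
      hits S.T S.r (Icc u v) := by
  ext j
  rw [mem_hits, mem_hits]
  exact exists_congr fun i => (congrArg (· ∈ _) (S.dual_pow_toDual i (S.r j))).to_iff.trans and_comm

theorem onSegment_dual (y : X) (t : ℕ) :
    onSegment S.dual.T S.dual.l (OrderDual.toDual y) t = onSegment S.T S.r y t := by
  ext j
  rw [mem_onSegment, mem_onSegment]
  simp only [dual_pow_toDual]
  rfl

variable {S} {a b c z u v q x : X} {n t : ℕ}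

theorem firstReturn_dual :
    FirstReturn S.dual.T (Icc (OrderDual.toDual v) (OrderDual.toDual u)) (OrderDual.toDual x) t ↔
      FirstReturn S.T (Icc u v) x t := by
  simp only [FirstReturn, dual_pow_toDual, Set.Icc_toDual, mem_preimage, OrderDual.ofDual_toDual]

theorem Uncut.of_apply (h : S.Uncut n (S.T c) (S.T z)) (hlt : S.T c < S.T z)
    (hl : ∀ j, S.inv.l j ∉ Ioc (S.T c) (S.T z)) : c < z ∧ S.Uncut (n + 1) c z := by
  have hinv : IncreasingOnto ⇑S.T⁻¹ (S.T c) (S.T z) := by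
    obtain ⟨i, hi, hi'⟩ := S.inv.exists_piece_of_forall_notMem hl
    exact (S.inv.increasing i).subinterval hi hlt.le hi'
  have hmono : IncreasingOnto S.T c z := by simpa using hinv.inv
  refine ⟨by simpa using hinv.lt le_rfl hlt le_rfl, fun i hi x hx j => ?_⟩
  have hTx : S.T x ∈ Ioc (S.T c) (S.T z) :=
    ⟨hmono.lt le_rfl hx.1 hx.2, hmono.le hx.1.le hx.2 le_rfl⟩
  cases i with
  | zero =>
    rintro rfl
    exact hl j hTx
  | succ i =>
    rw [pow_succ, Equiv.Perm.mul_apply]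
    exact h i (by omega) _ hTx j

/-- The jump next to the forward orbit of a right endpoint up to time `t` was created at the last
right endpoint that this orbit meets. -/
theorem exists_left_endpoint_covBy {j : Fin d} (ht : 0 < t) (hq : (S.T ^ t) (S.r j) < q) :
    ∃ h < t, ∃ i, ∀ s, h < s → s ≤ t → (S.T ^ s) (S.r j) ⋖ (S.T ^ (s - h)) (S.l i) := by
  classical
  have hside (s : ℕ) : side ((S.T ^ s) (S.r j)) = false := by rw [S.side_pow, S.side_r]
  let p : ℕ → Prop := fun h => ∃ k, (S.T ^ h) (S.r j) = S.r k
  let h := Nat.findGreatest p (t - 1)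
  have hle : h ≤ t - 1 := Nat.findGreatest_le _
  obtain ⟨k, hk⟩ : p h := Nat.findGreatest_spec (P := p) (Nat.zero_le _) ⟨j, rfl⟩
  have hlast (s : ℕ) (hs : h < s) (hst : s < t) : ¬ p s :=
    Nat.findGreatest_is_greatest hs (by omega)
  obtain ⟨y, hy⟩ : ∃ y, (S.T ^ (h + 1)) (S.r j) ⋖ y := by
    refine (S.split.exists_succ (hside (h + 1))).resolve_left fun htop => ?_
    rcases (show h + 1 ≤ t by omega).eq_or_lt with heq | hlt
    · exact (heq ▸ htop q).not_gt hq
    · exact hlast (h + 1) h.lt_succ_self hlt (S.eq_r_of_isTop htop)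
  obtain ⟨i, rfl⟩ := S.inv.eq_l_of_r_covBy (j := k)
    (by rwa [inv_r, ← hk, ← Equiv.Perm.mul_apply, ← pow_succ'])
  refine ⟨h, by omega, i, fun s hs => Nat.le_induction (m := h + 1) ?_ (fun s hs ih hst => ?_) s hs⟩
  · intro _
    rwa [Nat.add_sub_cancel_left]
  · have hcov := ih (by omega)
    have hnext := S.covBy_apply hcov fun m hm =>
      hlast s hs (by omega) (S.eq_r_of_covBy_l (hm ▸ hcov))
    rwa [← Equiv.Perm.mul_apply, ← pow_succ', ← Equiv.Perm.mul_apply, ← pow_succ',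
      ← Nat.sub_add_comm (by omega)] at hnext

end Exchange

namespace Exchange

namespace ReturnGap

variable {X : Type*} [LinearOrder X] {side : X → Bool} {d : ℕ} {S : Exchange X side d}
variable {a b c u v x y : X} {i j : Fin d} {n s t : ℕ}

theorem dual (G : S.ReturnGap a b u v t) :
    S.dual.ReturnGap (OrderDual.toDual b) (OrderDual.toDual a) (OrderDual.toDual v)
      (OrderDual.toDual u) t where
  exists_pow_u := by
    simpa only [dual_pow_toDual, EmbeddingLike.apply_eq_iff_eq] using G.exists_pow_v
  exists_pow_v := by
    simpa only [dual_pow_toDual, EmbeddingLike.apply_eq_iff_eq] using G.exists_pow_u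
  pow_a_ne := by simpa only [dual_pow_toDual, ne_eq, EmbeddingLike.apply_eq_iff_eq] using G.pow_b_ne
  pow_b_ne := by simpa only [dual_pow_toDual, ne_eq, EmbeddingLike.apply_eq_iff_eq] using G.pow_a_ne
  not_covBy_u := by simpa only [dual_pow_toDual, toDual_covBy_toDual_iff] using G.not_v_covBy
  not_v_covBy := by simpa only [dual_pow_toDual, toDual_covBy_toDual_iff] using G.not_covBy_u
  firstReturn_a := firstReturn_dual.2 G.firstReturn_b
  firstReturn_b := firstReturn_dual.2 G.firstReturn_a
  lt := by simpa only [dual_pow_toDual, OrderDual.toDual_lt_toDual] using G.lt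
  gap := by
    intro x hx i hi hmem hgap
    obtain ⟨x, rfl⟩ := OrderDual.toDual.surjective x
    rw [dual_pow_toDual] at hmem
    simp only [dual_pow_toDual] at hgap
    exact G.gap x hx.symm i hi hmem.symm hgap.symm
  flip := by simpa only [dual_pow_toDual, OrderDual.toDual_lt_toDual] using G.flip

theorem inv_l_notMem_of_forall_endpoints (hst : s + n = t)
    (hlt : (S.T ^ s) b < (S.T ^ s) a) (hn : S.Uncut n ((S.T ^ s) b) ((S.T ^ s) a))
    (hl : ∀ j, S.inv.l j ≠ (S.T ^ s) a) (hr : ∀ i, S.inv.r i ≠ (S.T ^ s) b)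
    (hno : ∀ i j m, 0 < m → (S.T ^ t) b < (S.T ^ m) (S.r i) →
      (S.T ^ m) (S.r i) < (S.T ^ m) (S.l j) → (S.T ^ t) a ≤ (S.T ^ m) (S.l j)) (j : Fin d) :
    S.inv.l j ∉ Ioc ((S.T ^ s) b) ((S.T ^ s) a) := by
  intro hj
  obtain ⟨y, hy, hby⟩ := S.split.pred_of_lt (S.inv.side_l j) hj.1
  obtain ⟨i, rfl⟩ := S.inv.eq_r_of_covBy_l hy
  have hmono := hn.increasingOnto hlt.le
  have hadd (z : X) : (S.T ^ n) ((S.T ^ s) z) = (S.T ^ t) z := by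
    rw [← Equiv.Perm.mul_apply, ← pow_add, add_comm, hst]
  have hbi := hmono.lt le_rfl (hby.lt_of_ne (hr i).symm) (hy.le.trans hj.2)
  have hij := hmono.lt hby hy.lt hj.2
  have hja := hmono.lt hj.1.le (hj.2.lt_of_ne (hl j)) le_rfl
  rw [hadd, inv_r, ← Equiv.Perm.mul_apply, ← pow_succ] at hbi
  rw [inv_l, inv_r, ← Equiv.Perm.mul_apply, ← Equiv.Perm.mul_apply, ← pow_succ] at hij
  rw [hadd, inv_l, ← Equiv.Perm.mul_apply, ← pow_succ] at hja
  exact hja.not_ge (hno i j (n + 1) n.succ_pos hbi hij)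

variable (G : S.ReturnGap a b u v t)
include G

theorem firstReturn_of_mem_Ioo (hs : 0 < s) (h : (S.T ^ s) y ∈ Ioo ((S.T ^ t) b) ((S.T ^ t) a)) :
    FirstReturn S.T (Icc u v) y s := by
  have hmem : (S.T ^ s) y ∈ Icc u v :=
    ⟨G.firstReturn_b.2.1.1.trans h.1.le, h.2.le.trans G.firstReturn_a.2.1.2⟩
  refine ⟨hs, hmem, fun k _ hk hkmem => G.gap _ hkmem (s - k) (by omega) ?_ ?_⟩ <;>
    rwa [pow_sub_pow_apply S.T hk.le]

/-- Going backwards from an adjacent pair of return points, the two orbits remain adjacent until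
they simultaneously meet a left and a right endpoint, which must happen before the flip. -/
theorem exists_endpoints_of_covBy (h : (S.T ^ t) b ⋖ (S.T ^ t) a) :
    ∃ s, 0 < s ∧ s < t ∧ (∃ j, S.l j = (S.T ^ s) a) ∧ ∃ j, S.r j = (S.T ^ s) b := by
  by_contra! hno
  have hcov (s : ℕ) (hs : s < t) : (S.T ^ (t - s)) b ⋖ (S.T ^ (t - s)) a := by
    induction s with
    | zero => exact h
    | succ s ih =>
      have hprev := ih (by omega)
      rw [show t - s = t - (s + 1) + 1 by omega, pow_succ', Equiv.Perm.mul_apply,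
        Equiv.Perm.mul_apply] at hprev
      have hback := S.inv.covBy_apply hprev fun j hj => by
        obtain ⟨i, hi⟩ := S.inv.eq_r_of_covBy_l (hj ▸ hprev)
        exact hno (t - (s + 1)) (by omega) (by omega) ⟨j, (S.T.injective hj).symm⟩ i
          (S.T.injective hi).symm
      simpa using hback
  obtain ⟨s, h0, hst, hflip⟩ := G.flip
  have hs := hcov (t - s) (by omega)
  rw [Nat.sub_sub_self hst.le] at hs
  exact hs.lt.not_gt hflip

theorem exists_succ_left_endpoint (hb : S.r i = b) :
    ∃ j s, FirstReturn S.T (Icc u v) (S.l j) s ∧ (S.T ^ t) b ⋖ (S.T ^ s) (S.l j) := by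
  subst hb
  obtain ⟨ht, hbmem, hbout⟩ := G.firstReturn_b
  obtain ⟨h, hht, j, hcov⟩ := exists_left_endpoint_covBy ht G.lt
  have hend := hcov t hht le_rfl
  refine ⟨j, t - h, ⟨by omega, ⟨hbmem.1.trans hend.le, ?_⟩, fun k h0 hk hmem => ?_⟩, hend⟩
  · exact (hend.ge_of_gt G.lt).trans G.firstReturn_a.2.1.2
  · have hk' := hcov (k + h) (by omega) (by omega)
    rw [Nat.add_sub_cancel] at hk'
    rcases hmem.1.eq_or_lt with heq | hlt
    · exact G.not_covBy_u (k + h) (by omega) (heq ▸ hk')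
    · exact hbout (k + h) (by omega) (by omega) ⟨hk'.le_of_lt hlt, hk'.le.trans hmem.2⟩

theorem exists_mem_hits_diff (hb : S.r i = b) (h : ¬ (S.T ^ t) b ⋖ (S.T ^ t) a) :
    ∃ j ∈ hits S.T S.l (Icc u v), j ∉ onSegment S.T S.l a t ∧
      ∃ s, FirstReturn S.T (Icc u v) (S.l j) s ∧ (S.T ^ t) b ⋖ (S.T ^ s) (S.l j) := by
  obtain ⟨j, s, hs, hcov⟩ := G.exists_succ_left_endpoint hb
  refine ⟨j, mem_hits.2 ⟨s, hs.2.1⟩, fun hj => h ?_, s, hs, hcov⟩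
  obtain ⟨s', hs', heq⟩ := G.firstReturn_a.exists_of_mem_onSegment hj
  rwa [hs.unique hs', heq] at hcov

theorem onSegment_subset_hits_l : onSegment S.T S.l a t ⊆ hits S.T S.l (Icc u v) :=
  onSegment_subset_hits G.firstReturn_a.2.1

theorem card_onSegment_lt (hb : S.r i = b) (h : ¬ (S.T ^ t) b ⋖ (S.T ^ t) a) :
    (onSegment S.T S.l a t).card < (hits S.T S.l (Icc u v)).card := by
  obtain ⟨j, hj, hj', -⟩ := G.exists_mem_hits_diff hb h
  exact Finset.card_lt_card ⟨G.onSegment_subset_hits_l, fun hsub => hj' (hsub hj)⟩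

theorem card_onSegment_add_two_le (hb : S.r i = b) (hx : x ∈ Ioo ((S.T ^ t) b) ((S.T ^ t) a))
    (hs : 0 < s) (hj : (S.T ^ s) (S.l j) ∈ Ioo x ((S.T ^ t) a)) :
    (onSegment S.T S.l a t).card + 2 ≤ (hits S.T S.l (Icc u v)).card := by
  have hret := G.firstReturn_of_mem_Ioo hs ⟨hx.1.trans hj.1, hj.2⟩
  obtain ⟨j', hj'mem, hj'out, s', hs', hcov⟩ := G.exists_mem_hits_diff hb fun h => h.2 hx.1 hx.2
  have hj'j : j' ∉ insert j (onSegment S.T S.l a t) := by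
    rw [Finset.mem_insert, not_or]
    refine ⟨?_, hj'out⟩
    rintro rfl
    exact (hs'.unique hret ▸ hcov).2 hx.1 hj.1
  have hjout : j ∉ onSegment S.T S.l a t := fun hmem => by
    obtain ⟨r, hr, heq⟩ := G.firstReturn_a.exists_of_mem_onSegment hmem
    rw [hr.unique hret] at heq
    exact hj.2.ne heq
  rw [← one_add_one_eq_two, ← add_assoc, ← Finset.card_insert_of_notMem hjout,
    ← Finset.card_insert_of_notMem hj'j]
  exact Finset.card_le_card (Finset.insert_subset hj'mem
    (Finset.insert_subset (mem_hits.2 ⟨s, hret.2.1⟩) G.onSegment_subset_hits_l))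

/-- Going backwards from the return points, the interval between the two orbits stays uncut until
one of them meets an endpoint or an endpoint pair appears inside, which must happen before the
flip. -/
theorem exists_endpoints_in_gap (hl : ∀ s, 0 < s → s < t → ∀ j, S.l j ≠ (S.T ^ s) a)
    (hr : ∀ s, 0 < s → s < t → ∀ i, S.r i ≠ (S.T ^ s) b) :
    ∃ i j s, 0 < s ∧ (S.T ^ t) b < (S.T ^ s) (S.r i) ∧ (S.T ^ s) (S.r i) < (S.T ^ s) (S.l j) ∧
      (S.T ^ s) (S.l j) < (S.T ^ t) a := by
  by_contra! hno
  have huncut (n s : ℕ) (h0 : 0 < s) (hst : s + n = t) :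
      (S.T ^ s) b < (S.T ^ s) a ∧ S.Uncut n ((S.T ^ s) b) ((S.T ^ s) a) := by
    induction n generalizing s with
    | zero =>
      obtain rfl : s = t := hst
      exact ⟨G.lt, fun i hi => absurd hi i.not_lt_zero⟩
    | succ n ih =>
      obtain ⟨hlt, hn⟩ := ih (s + 1) s.succ_pos (by omega)
      have hout := inv_l_notMem_of_forall_endpoints (by omega) hlt hn
        (fun j hj => hl s h0 (by omega) j (S.T.injective (by rwa [pow_succ'] at hj)))
        (fun i hi => hr s h0 (by omega) i (S.T.injective (by rwa [pow_succ'] at hi))) hno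
      rw [pow_succ'] at hlt hn hout
      exact hn.of_apply hlt hout
  obtain ⟨s, h0, hst, hflip⟩ := G.flip
  exact (huncut (t - s) s h0 (by omega)).1.not_gt hflip

theorem eight_le_hitCount (ha : S.l j = a) (hb : S.r i = b) : 8 ≤ S.hitCount (Icc u v) := by
  obtain ⟨n, hn⟩ := G.exists_pow_u
  obtain ⟨m, hm⟩ := G.exists_pow_v
  have huv := G.firstReturn_a.2.1.1.trans G.firstReturn_a.2.1.2
  have hLB := Finset.card_le_card (onSegment_subset_hits_inv (e := S.l) (t := t) hn
    (left_mem_Icc.2 huv))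
  have hRB := Finset.card_le_card (onSegment_subset_hits_inv (e := S.r) (t := t) hm
    (right_mem_Icc.2 huv))
  have hLF := Finset.card_le_card G.onSegment_subset_hits_l
  have hRF := Finset.card_le_card (onSegment_subset_hits (e := S.r) G.firstReturn_b.2.1)
  have hL : 0 < (onSegment S.T S.l a t).card :=
    Finset.card_pos.2 ⟨j, mem_onSegment.2 ⟨0, G.firstReturn_a.1, ha⟩⟩
  have hR : 0 < (onSegment S.T S.r b t).card :=
    Finset.card_pos.2 ⟨i, mem_onSegment.2 ⟨0, G.firstReturn_b.1, hb⟩⟩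
  unfold hitCount
  by_cases hcov : (S.T ^ t) b ⋖ (S.T ^ t) a
  · obtain ⟨s, h0, hst, ⟨j', hj'⟩, i', hi'⟩ := G.exists_endpoints_of_covBy hcov
    have hL2 := one_lt_card_onSegment G.pow_a_ne ha h0 hst hj'
    have hR2 := one_lt_card_onSegment G.pow_b_ne hb h0 hst hi'
    omega
  · have hLF1 := G.card_onSegment_lt hb hcov
    have hRF1 := G.dual.card_onSegment_lt (congrArg OrderDual.toDual ha)
      (by rwa [dual_pow_toDual, dual_pow_toDual, toDual_covBy_toDual_iff])
    rw [hits_dual, onSegment_dual] at hRF1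
    by_contra! hlt
    obtain ⟨i', j', s, hs, hbi, hij, hja⟩ := G.exists_endpoints_in_gap
      (fun s h0 hst j' hj' => by
        have := one_lt_card_onSegment G.pow_a_ne ha h0 hst hj'
        omega)
      (fun s h0 hst i' hi' => by
        have := one_lt_card_onSegment G.pow_b_ne hb h0 hst hi'
        omega)
    have hLF2 := G.card_onSegment_add_two_le hb ⟨hbi, hij.trans hja⟩ hs ⟨hij, hja⟩
    have hRF2 := G.dual.card_onSegment_add_two_le (congrArg OrderDual.toDual ha)
      (x := OrderDual.toDual ((S.T ^ s) (S.l j'))) (s := s) (j := i')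
    rw [hits_dual, onSegment_dual] at hRF2
    simp only [dual_pow_toDual] at hRF2
    have := hRF2 ⟨hja, hbi.trans hij⟩ hs ⟨hij, hbi⟩
    omega

end ReturnGap

end Exchange

section Aperiodic

variable {X : Type*} {d : ℕ} {f : Equiv.Perm X} {g : X}

theorem notMem_periodicPts_inv (hg : g ∉ Function.periodicPts f) :
    g ∉ Function.periodicPts ⇑f⁻¹ := by
  intro hper
  obtain ⟨n, hn, hfix⟩ := mem_periodicPts_iff.1 hper
  exact inv_pow_apply_ne hg hn hfix

theorem finite_setOf_pow_apply_eq (hg : g ∉ Function.periodicPts f) (e : Fin d → X) :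
    {h : ℕ | ∃ j, (f ^ h) g = e j}.Finite := by
  refine ((finite_range e).preimage (injective_pow_apply hg).injOn).subset ?_
  rintro h ⟨j, hj⟩
  exact ⟨j, hj.symm⟩

theorem exists_pow_forall_pow_apply_ne (hg : g ∉ Function.periodicPts f) (e : Fin d → X) :
    ∃ N : ℕ, ∀ (i : ℕ) j, (f ^ i) ((f ^ N) g) ≠ e j := by
  obtain ⟨N, hN⟩ := (finite_setOf_pow_apply_eq hg e).bddAbove
  refine ⟨N + 1, fun i j hi => ?_⟩
  rw [← Equiv.Perm.mul_apply, ← pow_add] at hi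
  have hle : i + (N + 1) ≤ N := hN ⟨j, hi⟩
  omega

end Aperiodic

/-! ### Endpoint orbits that visit a recurrent point -/

section Visitors

variable {X : Type*} [TopologicalSpace X] {d : ℕ} {f : Equiv.Perm X} {e : Fin d → X} {x g : X}
variable {J : Set X} {j : Fin d}

theorem Visits.eventually_of_pow_eq [T1Space X] (hx : Visits f x x) (g : X) :
    ∀ᶠ y in 𝓝 x, ∀ i : ℕ, (f ^ i) g = y → Visits f x g := by
  by_cases hg : Visits f x g
  · exact Eventually.of_forall fun _ _ _ => hg
  have hg' := hg
  rw [Visits, mapClusterPt_iff_frequently] at hg'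
  push Not at hg'
  obtain ⟨s, hs, hev⟩ := hg'
  obtain ⟨N, hN⟩ := eventually_atTop.1 hev
  have hne : ∀ᶠ y in 𝓝 x, ∀ i ∈ Finset.range N, y ≠ (f ^ i) g := by
    refine (eventually_all_finset _).2 fun i _ => eventually_ne_nhds fun hi => hg ?_
    exact (visits_pow_right i).1 (hi ▸ hx)
  filter_upwards [hs, hne] with y hy hne i hi
  rcases lt_or_ge i N with h | h
  · exact absurd hi.symm (hne i (Finset.mem_range.2 h))
  · exact absurd (hi ▸ hy) (hN i h)

open Classical in
/-- The indices `j` for which the orbit of `e j` under `f` visits `x`. -/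
noncomputable def visitors (f : Equiv.Perm X) (e : Fin d → X) (x : X) : Finset (Fin d) :=
  {j | Visits f x (e j)}

theorem mem_visitors : j ∈ visitors f e x ↔ Visits f x (e j) := by simp [visitors]

theorem Visits.exists_nhds_hits_subset [T1Space X] (hx : Visits f x x) (e : Fin d → X) :
    ∃ U ∈ 𝓝 x, ∀ J ⊆ U, hits f e J ⊆ visitors f e x :=
  ⟨_, eventually_all.2 fun j => hx.eventually_of_pow_eq (e j), fun J hJ j hj => by
    obtain ⟨i, hi⟩ := mem_hits.1 hj
    exact mem_visitors.2 (hJ hi j i rfl)⟩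

end Visitors

namespace Exchange

variable {X : Type*} [LinearOrder X] {side : X → Bool} {d : ℕ} (S : Exchange X side d)
variable [TopologicalSpace X] {x g a : X} {j : Fin d}

/-- The number of endpoint ends, that is, of backward and forward orbits of endpoints, that visit
`x`. -/
noncomputable def visitCount (x : X) : ℕ :=
  (visitors S.T⁻¹ S.l x).card + (visitors S.T⁻¹ S.r x).card + (visitors S.T S.l x).card +
    (visitors S.T S.r x).card

theorem visitors_apply (e : Fin d → X) (x : X) :
    visitors S.T (S.T ∘ e) x = visitors S.T e x := by
  ext j
  exact mem_visitors.trans ((visits_pow_right 1).trans mem_visitors.symm)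

theorem visitors_inv_apply (e : Fin d → X) (x : X) :
    visitors S.T⁻¹ (S.T ∘ e) x = visitors S.T⁻¹ e x := by
  ext j
  exact mem_visitors.trans ((visits_inv_pow_right 1).trans mem_visitors.symm)

theorem visitors_inv_l (x : X) : visitors S.inv.T⁻¹ S.inv.l x = visitors S.T S.l x := by
  rw [inv_T, inv_inv]
  exact S.visitors_apply S.l x

theorem visitors_inv_r (x : X) : visitors S.inv.T⁻¹ S.inv.r x = visitors S.T S.r x := by
  rw [inv_T, inv_inv]
  exact S.visitors_apply S.r x

theorem visitCount_inv (x : X) : S.inv.visitCount x = S.visitCount x := by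
  have hl : visitors S.inv.T S.inv.l x = visitors S.T⁻¹ S.l x := S.visitors_inv_apply S.l x
  have hr : visitors S.inv.T S.inv.r x = visitors S.T⁻¹ S.r x := S.visitors_inv_apply S.r x
  rw [visitCount, visitors_inv_l, visitors_inv_r, hl, hr, visitCount]
  omega

theorem visits_dual :
    Visits S.dual.T (OrderDual.toDual x) (OrderDual.toDual g) ↔ Visits S.T x g := by
  simp only [Visits, dual_pow_toDual]
  rfl

theorem visits_dual_inv :
    Visits S.dual.T⁻¹ (OrderDual.toDual x) (OrderDual.toDual g) ↔ Visits S.T⁻¹ x g :=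
  S.inv.visits_dual

theorem visitCount_dual (x : X) : S.dual.visitCount (OrderDual.toDual x) = S.visitCount x := by
  have hl : visitors S.dual.T S.dual.l (OrderDual.toDual x) = visitors S.T S.r x := by
    ext j; exact mem_visitors.trans (S.visits_dual.trans mem_visitors.symm)
  have hr : visitors S.dual.T S.dual.r (OrderDual.toDual x) = visitors S.T S.l x := by
    ext j; exact mem_visitors.trans (S.visits_dual.trans mem_visitors.symm)
  have hl' : visitors S.dual.T⁻¹ S.dual.l (OrderDual.toDual x) = visitors S.T⁻¹ S.r x := by
    ext j; exact mem_visitors.trans (S.visits_dual_inv.trans mem_visitors.symm)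
  have hr' : visitors S.dual.T⁻¹ S.dual.r (OrderDual.toDual x) = visitors S.T⁻¹ S.l x := by
    ext j; exact mem_visitors.trans (S.visits_dual_inv.trans mem_visitors.symm)
  rw [visitCount, hl, hr, hl', hr', visitCount]
  omega

/-- The backward orbit of `l j` visits `x` and meets no further left endpoint. -/
def IsFirstVisitor (x : X) (j : Fin d) : Prop :=
  Visits S.T⁻¹ x (S.l j) ∧ ∀ i : ℕ, 0 < i → ∀ j', (S.T⁻¹ ^ i) (S.l j) ≠ S.l j'

variable {S}

theorem IsFirstVisitor.exists_r_covBy (h : S.IsFirstVisitor x j) : ∃ i, S.r i ⋖ S.l j := by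
  rcases S.split.exists_pred (S.side_l j) with hbot | ⟨v, hv⟩
  · obtain ⟨j', hj'⟩ := S.inv.eq_l_of_isBot hbot
    exact absurd (by rw [hj']; simp) (h.2 1 one_pos j')
  · obtain ⟨i, rfl⟩ := S.eq_r_of_covBy_l hv
    exact ⟨i, hv⟩

variable [OrderTopology X]

theorem exists_isFirstVisitor (hper : x ∉ Function.periodicPts S.T) (h : Visits S.T⁻¹ x (S.l j)) :
    ∃ j₀, S.IsFirstVisitor x j₀ ∧ ∃ h : ℕ, S.l j = (S.T ^ h) (S.l j₀) := by
  have hlj := notMem_periodicPts_of_visits_inv hper h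
  obtain ⟨h₀, ⟨j₀, hj₀⟩, hmax⟩ :=
    Set.exists_max_image _ id (finite_setOf_pow_apply_eq (notMem_periodicPts_inv hlj) S.l)
      ⟨0, j, rfl⟩
  refine ⟨j₀, ⟨hj₀ ▸ (visits_pow_right h₀).2 h, fun i hi j' hj' => ?_⟩, h₀, ?_⟩
  · rw [← hj₀, ← Equiv.Perm.mul_apply, ← pow_add] at hj'
    have hle : i + h₀ ≤ h₀ := hmax _ ⟨j', hj'⟩
    omega
  · rw [← hj₀, inv_pow, Equiv.Perm.inv_def, Equiv.apply_symm_apply]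

theorem exists_nhds_hitCount_le (hx : Visits S.T x x) :
    ∃ U ∈ 𝓝 x, ∀ J ⊆ U, S.hitCount J ≤ S.visitCount x := by
  have hx' := S.visits_inv_self hx
  obtain ⟨U₁, hU₁, h₁⟩ := hx'.exists_nhds_hits_subset S.l
  obtain ⟨U₂, hU₂, h₂⟩ := hx'.exists_nhds_hits_subset S.r
  obtain ⟨U₃, hU₃, h₃⟩ := hx.exists_nhds_hits_subset S.l
  obtain ⟨U₄, hU₄, h₄⟩ := hx.exists_nhds_hits_subset S.r
  refine ⟨_, inter_mem (inter_mem hU₁ hU₂) (inter_mem hU₃ hU₄), fun J hJ => ?_⟩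
  exact Nat.add_le_add (Nat.add_le_add (Nat.add_le_add
    (Finset.card_le_card (h₁ J fun y hy => (hJ hy).1.1))
    (Finset.card_le_card (h₂ J fun y hy => (hJ hy).1.2)))
    (Finset.card_le_card (h₃ J fun y hy => (hJ hy).2.1)))
    (Finset.card_le_card (h₄ J fun y hy => (hJ hy).2.2))

theorem eventually_exists_pow_eq_l (hx : Visits S.T x x) (hfut : ∀ (i : ℕ) j, (S.T ^ i) x ≠ S.l j)
    (ha : ∀ j, Visits S.T⁻¹ x (S.l j) → ∃ h : ℕ, S.l j = (S.T ^ h) a) :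
    ∀ᶠ y in 𝓝 x, ∀ j (i : ℕ), (S.T ^ i) y = S.l j → ∃ h ≤ i, S.l j = (S.T ^ h) a := by
  refine eventually_all.2 fun j => ?_
  have hpast {y : X} {i : ℕ} (hi : (S.T ^ i) y = S.l j) : (S.T⁻¹ ^ i) (S.l j) = y := by
    rw [inv_pow, Equiv.Perm.inv_eq_iff_eq, hi]
  by_cases hj : Visits S.T⁻¹ x (S.l j)
  · obtain ⟨h, hh⟩ := ha j hj
    have hlate : ∀ᶠ y in 𝓝 x, ∀ i ∈ Finset.range h, (S.T ^ i) y ≠ S.l j :=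
      (eventually_all_finset _).2 fun i _ =>
        (S.continuous_pow i).continuousAt.eventually (eventually_ne_nhds (hfut i j))
    filter_upwards [hlate] with y hy i hi
    exact ⟨h, not_lt.1 fun hih => hy i (Finset.mem_range.2 hih) hi, hh⟩
  · filter_upwards [(S.visits_inv_self hx).eventually_of_pow_eq (S.l j)] with y hy i hi
    exact absurd (hy i (hpast hi)) hj

end Exchange

namespace Exchange

variable {X : Type*} [LinearOrder X] [TopologicalSpace X] [OrderTopology X] {side : X → Bool}
variable {d : ℕ} {S : Exchange X side d} {x a b : X} {j : Fin d}

theorem visitCount_pow (n : ℕ) (x : X) : S.visitCount ((S.T ^ n) x) = S.visitCount x := by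
  have hfut (e : Fin d → X) : visitors S.T e ((S.T ^ n) x) = visitors S.T e x := by
    ext j
    rw [mem_visitors, mem_visitors, visits_pow_left]
  have hpast (e : Fin d → X) : visitors S.T⁻¹ e ((S.T ^ n) x) = visitors S.T⁻¹ e x := by
    ext j
    rw [mem_visitors, mem_visitors, visits_inv_pow_apply]
  rw [visitCount, hfut, hfut, hpast, hpast, visitCount]

theorem isFirstVisitor_pow (n : ℕ) : S.IsFirstVisitor ((S.T ^ n) x) j ↔ S.IsFirstVisitor x j := by
  rw [IsFirstVisitor, visits_inv_pow_apply, IsFirstVisitor]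

theorem visits_pred (hper : x ∉ Function.periodicPts S.T) (hcov : b ⋖ a)
    (hpast : ∀ i : ℕ, 0 < i → ∀ j, (S.T⁻¹ ^ i) a ≠ S.l j) (h : Visits S.T⁻¹ x a) :
    Visits S.T⁻¹ x b := by
  refine visits_iff.2 fun s hs N => ?_
  obtain ⟨u, v, hu, hv, hx, hsub⟩ := S.exists_Icc_subset hs
  have hN : Visits S.T⁻¹ x ((S.T⁻¹ ^ N) a) := (visits_pow_right N).2 h
  obtain ⟨n, hn, hne⟩ := hN.exists_ne
    (fun n hn => inv_pow_apply_ne (notMem_periodicPts_of_visits_inv hper hN) hn)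
    (S.split.Icc_mem_nhds hu hv hx) u
  rw [← Equiv.Perm.mul_apply, ← pow_add] at hn hne
  have hcov' := covBy_inv_pow hcov hpast (n + N)
  exact ⟨n + N, Nat.le_add_left N n,
    hsub ⟨hcov'.le_of_lt (hn.1.lt_of_ne hne.symm), hcov'.le.trans hn.2⟩⟩

theorem exists_isFirstVisitor_of_forall_ne (hx : Visits S.T x x)
    (hper : x ∉ Function.periodicPts S.T) (hside : side x = true)
    (hfut : ∀ (i : ℕ) j, (S.T ^ i) x ≠ S.l j) : ∃ j, S.IsFirstVisitor x j := by
  by_contra! hfirst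
  have hx' := S.visits_inv_self hx
  have hno (j : Fin d) (hj : Visits S.T⁻¹ x (S.l j)) : False := by
    obtain ⟨j₀, hj₀, -⟩ := exists_isFirstVisitor hper hj
    exact hfirst j₀ hj₀
  obtain ⟨b, hb⟩ : ∃ b, b ⋖ x := (S.split.exists_pred hside).resolve_left fun hbot => by
    obtain ⟨j, hj⟩ := S.eq_l_of_isBot hbot
    exact hfut 0 j hj
  have hU := eventually_exists_pow_eq_l (a := x) hx hfut fun j hj => (hno j hj).elim
  obtain ⟨u, v, t, -, G⟩ := exists_returnGap hx hper hside hb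
    (fun i _ j hi => hno j (hi ▸ (visits_pow_right i).2 hx')) hx' hU fun y hy i j => hy j i
  have hcov (h : ℕ) : (S.T ^ h) b ⋖ (S.T ^ h) x := by
    induction h with
    | zero => exact hb
    | succ h ih =>
      rw [pow_succ', Equiv.Perm.mul_apply, Equiv.Perm.mul_apply]
      exact S.covBy_apply ih fun j => hfut h j
  obtain ⟨h, -, -, hflip⟩ := G.flip
  exact hflip.not_gt (hcov h).lt

theorem eight_le_visitCount_of_unique (hx : Visits S.T x x)
    (hper : x ∉ Function.periodicPts S.T) (hside : side x = true)
    (huniq : {j | S.IsFirstVisitor x j}.Subsingleton) : 8 ≤ S.visitCount x := by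
  wlog hfut : ∀ (i : ℕ) j, (S.T ^ i) x ≠ S.l j generalizing x
  · obtain ⟨N, hN⟩ := exists_pow_forall_pow_apply_ne hper S.l
    rw [← visitCount_pow N]
    refine this ((S.visits_pow_left N).2 ((visits_pow_right N).2 hx))
      (pow_notMem_periodicPts hper N) (by rwa [S.side_pow]) ?_ hN
    simpa only [isFirstVisitor_pow] using huniq
  obtain ⟨j₀, hj₀⟩ := exists_isFirstVisitor_of_forall_ne hx hper hside hfut
  obtain ⟨i, hi⟩ := hj₀.exists_r_covBy
  have hpow (j : Fin d) (hj : Visits S.T⁻¹ x (S.l j)) : ∃ h : ℕ, S.l j = (S.T ^ h) (S.l j₀) := by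
    obtain ⟨j', hj', hpow⟩ := exists_isFirstVisitor hper hj
    rwa [huniq hj' hj₀] at hpow
  obtain ⟨U, hU, hcount⟩ := exists_nhds_hitCount_le hx
  obtain ⟨u, v, t, hJ, G⟩ := exists_returnGap hx hper hside hi hj₀.2 hj₀.1
    (inter_mem hU (eventually_exists_pow_eq_l hx hfut hpow)) fun y hy i j => hy.2 j i
  exact (G.eight_le_hitCount rfl rfl).trans (hcount _ (hJ.trans inter_subset_left))

theorem two_le_card_visitors (hper : x ∉ Function.periodicPts S.T)
    (h : {j | S.IsFirstVisitor x j}.Nontrivial) :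
    2 ≤ (visitors S.T⁻¹ S.l x).card ∧ 2 ≤ (visitors S.T⁻¹ S.r x).card := by
  obtain ⟨j, hj, j', hj', hne⟩ := h
  obtain ⟨i, hi⟩ := hj.exists_r_covBy
  obtain ⟨i', hi'⟩ := hj'.exists_r_covBy
  refine ⟨Finset.one_lt_card.2 ⟨j, mem_visitors.2 hj.1, j', mem_visitors.2 hj'.1, hne⟩,
    Finset.one_lt_card.2 ⟨i, mem_visitors.2 (visits_pred hper hi hj.2 hj.1), i',
      mem_visitors.2 (visits_pred hper hi' hj'.2 hj'.1), ?_⟩⟩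
  rintro rfl
  have hl := hi.unique_right hi'
  exact hne (S.uniq ⟨le_rfl, S.le j⟩ ⟨hl.ge, hl.le.trans (S.le j')⟩)

theorem eight_le_visitCount_of_side (hx : Visits S.T x x) (hper : x ∉ Function.periodicPts S.T)
    (hside : side x = true) : 8 ≤ S.visitCount x := by
  rcases {j | S.IsFirstVisitor x j}.subsingleton_or_nontrivial with h | h
  · exact eight_le_visitCount_of_unique hx hper hside h
  have hper' := notMem_periodicPts_inv hper
  rcases {j | S.inv.IsFirstVisitor x j}.subsingleton_or_nontrivial with h' | h'
  · rw [← S.visitCount_inv]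
    exact eight_le_visitCount_of_unique (S.visits_inv_self hx) hper' hside h'
  have hpast := two_le_card_visitors hper h
  have hfuture := two_le_card_visitors hper' h'
  rw [visitors_inv_l, visitors_inv_r] at hfuture
  rw [visitCount]
  omega

theorem eight_le_visitCount (hx : Visits S.T x x) (hper : x ∉ Function.periodicPts S.T) :
    8 ≤ S.visitCount x := by
  cases hside : side x
  · rw [← S.visitCount_dual]
    exact eight_le_visitCount_of_side (S.visits_dual.2 hx) hper (by simp [hside])
  · exact eight_le_visitCount_of_side hx hper hside

end Exchange

section Periodic

variable {X : Type*} {f : Equiv.Perm X} {x : X} {n : ℕ}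

theorem exists_inv_pow_eq_pow (hn : 0 < n) (h : (f ^ n) x = x) (k : ℕ) :
    ∃ m : ℕ, (f⁻¹ ^ m) x = (f ^ k) x := by
  have hfix : (f ^ (n * k)) x = x := by
    rw [pow_mul, ← Equiv.Perm.iterate_eq_pow]
    exact Function.iterate_fixed h k
  refine ⟨n * k - k, ?_⟩
  rw [inv_pow, Equiv.Perm.inv_eq_iff_eq, pow_sub_pow_apply f (Nat.le_mul_of_pos_left k hn), hfix]

end Periodic

/-! ### Affine exchanges -/

namespace Exchange

variable {X : Type*} [LinearOrder X] {side : X → Bool} {d : ℕ} (S : Exchange X side d)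
variable {n : ℕ} {p w x y z R : X} {j : Fin d}

/-- In the real coordinate `pos`, the exchange is affine on every piece, with slope `slope`. Two
distinct points may have the same coordinate only if they are the two sides of a split point. -/
structure IsAffine (pos slope : X → ℝ) : Prop where
  slope_pos : ∀ x, 0 < slope x
  slope_eq : ∀ ⦃i x z⦄, x ∈ Icc (S.l i) (S.r i) → z ∈ Icc (S.l i) (S.r i) → slope x = slope z
  pos_apply_sub : ∀ ⦃i x z⦄, x ∈ Icc (S.l i) (S.r i) → z ∈ Icc (S.l i) (S.r i) →
    pos (S.T z) - pos (S.T x) = slope x * (pos z - pos x)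
  monotone : Monotone pos
  lt_of_side_left : ∀ ⦃x z⦄, x < z → side x = true → pos x < pos z
  lt_of_side_right : ∀ ⦃x z⦄, x < z → side z = false → pos x < pos z

/-- The multiplier of `T ^ n` at `p`, that is, the slope of `T ^ n` there. -/
noncomputable def multiplier (slope : X → ℝ) (n : ℕ) (p : X) : ℝ :=
  ∏ i ∈ Finset.range n, slope ((S.T ^ i) p)

variable {S} {pos slope : X → ℝ}

theorem IsAffine.eq_of_pos_eq (hA : S.IsAffine pos slope) (h : pos x = pos y)
    (hside : side x = side y) : x = y := by
  have not_lt {x y : X} (h : pos x = pos y) (hside : side x = side y) : ¬x < y := fun hlt => by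
    cases hx : side x
    · exact (hA.lt_of_side_right hlt (hside ▸ hx)).ne h
    · exact (hA.lt_of_side_left hlt hx).ne h
  exact le_antisymm (le_of_not_gt (not_lt h.symm hside.symm)) (le_of_not_gt (not_lt h hside))

theorem IsAffine.inv (hA : S.IsAffine pos slope) :
    S.inv.IsAffine pos fun z => (slope (S.T⁻¹ z))⁻¹ where
  slope_pos x := inv_pos.2 (hA.slope_pos _)
  slope_eq i x z hx hz := by
    obtain ⟨x, hx', rfl⟩ := (S.increasing i).2 hx
    obtain ⟨z, hz', rfl⟩ := (S.increasing i).2 hz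
    simp [hA.slope_eq hx' hz']
  pos_apply_sub i x z hx hz := by
    obtain ⟨x, hx', rfl⟩ := (S.increasing i).2 hx
    obtain ⟨z, hz', rfl⟩ := (S.increasing i).2 hz
    simp only [inv_T, Equiv.Perm.inv_def, Equiv.symm_apply_apply]
    rw [hA.pos_apply_sub hx' hz', inv_mul_cancel_left₀ (hA.slope_pos x).ne']
  monotone := hA.monotone
  lt_of_side_left := hA.lt_of_side_left
  lt_of_side_right := hA.lt_of_side_right

theorem IsAffine.dual (hA : S.IsAffine pos slope) :
    S.dual.IsAffine (fun z => -pos (OrderDual.ofDual z)) (slope ∘ OrderDual.ofDual) where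
  slope_pos _ := hA.slope_pos _
  slope_eq _ _ _ hx hz := hA.slope_eq hx.symm hz.symm
  pos_apply_sub _ _ _ hx hz := by
    have h := hA.pos_apply_sub hx.symm hz.symm
    simp only [Function.comp_apply]
    linarith! [h]
  monotone _ _ h := neg_le_neg (hA.monotone (OrderDual.ofDual_le_ofDual.2 h))
  lt_of_side_left _ _ h hs := neg_lt_neg
    (hA.lt_of_side_right (OrderDual.ofDual_lt_ofDual.2 h) (by simpa using hs))
  lt_of_side_right _ _ h hs := neg_lt_neg
    (hA.lt_of_side_left (OrderDual.ofDual_lt_ofDual.2 h) (by simpa using hs))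

theorem IsAffine.multiplier_pos (hA : S.IsAffine pos slope) (n : ℕ) (x : X) :
    0 < S.multiplier slope n x :=
  Finset.prod_pos fun _ _ => hA.slope_pos _

theorem multiplier_apply (h : (S.T ^ n) x = x) :
    S.multiplier slope n (S.T x) = S.multiplier slope n x := by
  cases n with
  | zero => rfl
  | succ n =>
    have hpow (i : ℕ) : (S.T ^ i) (S.T x) = (S.T ^ (i + 1)) x := by
      rw [pow_succ, Equiv.Perm.mul_apply]
    simp only [multiplier, hpow]
    rw [Finset.prod_range_succ, h, Finset.prod_range_succ' _ n, pow_zero, Equiv.Perm.one_apply]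

theorem multiplier_inv (h : (S.T ^ n) x = x) :
    S.inv.multiplier (fun z => (slope (S.T⁻¹ z))⁻¹) n x = (S.multiplier slope n x)⁻¹ := by
  rw [multiplier, Finset.prod_inv_distrib, multiplier,
    ← Finset.prod_range_reflect fun j => slope ((S.T ^ j) x)]
  refine congrArg _ (Finset.prod_congr rfl fun i hi => congrArg _ ?_)
  have hn : i + 1 + (n - 1 - i) = n := by have := Finset.mem_range.1 hi; omega
  rw [inv_T, ← Equiv.Perm.mul_apply, ← pow_succ', inv_pow, Equiv.Perm.inv_eq_iff_eq,
    ← Equiv.Perm.mul_apply, ← pow_add, hn, h]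

theorem multiplier_dual :
    S.dual.multiplier (slope ∘ OrderDual.ofDual) n (OrderDual.toDual x) =
      S.multiplier slope n x := by
  simp only [multiplier, dual_pow_toDual]
  rfl

theorem Uncut.pos_pow_sub (hA : S.IsAffine pos slope) (h : S.Uncut n p z) (hpz : p ≤ z) :
    pos ((S.T ^ n) z) - pos ((S.T ^ n) p) = S.multiplier slope n p * (pos z - pos p) := by
  induction n with
  | zero => simp [multiplier]
  | succ n ih =>
    have hn := h.mono n.le_succ le_rfl le_rfl
    obtain ⟨i, hp, hz⟩ := h.exists_piece (hn.increasingOnto hpz)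
    have hle := (hn.increasingOnto hpz).le le_rfl hpz le_rfl
    rw [pow_succ', Equiv.Perm.mul_apply, Equiv.Perm.mul_apply,
      hA.pos_apply_sub ⟨hp, hle.trans hz⟩ ⟨hp.trans hle, hz⟩, ih hn, multiplier, multiplier,
      Finset.prod_range_succ]
    ring

variable (S) in
theorem exists_isGreatest_uncut (p : X) (hn : 0 < n) :
    ∃ R, side R = false ∧ IsGreatest {z | p ≤ z ∧ S.Uncut n p z} R := by
  set cuts : Set X := {x | p < x ∧ ∃ i < n, ∃ j, (S.T ^ i) x = S.l j}
  have hfin : cuts.Finite := by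
    refine (((finite_lt_nat n).prod (finite_range S.l)).image
      fun q => (S.T ^ q.1).symm q.2).subset ?_
    rintro x ⟨-, i, hi, j, hj⟩
    exact ⟨(i, S.l j), ⟨hi, j, rfl⟩, (S.T ^ i).symm_apply_eq.2 hj.symm⟩
  rcases cuts.eq_empty_or_nonempty with hemp | hne
  · obtain ⟨i, hi⟩ := S.cover p
    refine ⟨S.r i, S.side_r i, ⟨hi.2, fun k hk x hx j hj => ?_⟩, fun z _ => not_lt.1 fun hlt => ?_⟩
    · exact hemp.subset (show x ∈ cuts from ⟨hx.1, k, hk, j, hj⟩)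
    · obtain ⟨w, hw, -⟩ := S.split.succ_of_lt (S.side_r i) hlt
      obtain ⟨j, rfl⟩ := S.eq_l_of_r_covBy hw
      exact hemp.subset (show S.l j ∈ cuts from ⟨hi.2.trans_lt hw.lt, 0, hn, j, rfl⟩)
  · obtain ⟨c, ⟨hpc, i, hi, j, hj⟩, hmin⟩ := hfin.exists_minimal hne
    have hside : side c = true := by rw [← S.side_pow i, hj, S.side_l]
    obtain ⟨R, hR, hpR⟩ := S.split.pred_of_lt hside hpc
    refine ⟨R, (S.split.side_of_covBy hR).1, ⟨hpR, fun k hk x hx j' hj' => ?_⟩, fun z hz => ?_⟩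
    · exact (hmin ⟨hx.1, k, hk, j', hj'⟩ (hx.2.trans hR.le)).not_gt (hx.2.trans_lt hR.lt)
    · exact hR.le_of_lt (not_le.1 fun hcz => hz.2 i hi c ⟨hpc, hcz⟩ j hj)

theorem IsAffine.exists_fixed (hA : S.IsAffine pos slope) (hn : 0 < n) (h : (S.T ^ n) x = x)
    (hside : side x = true) (hm : S.multiplier slope n x = 1) :
    ∃ R, x < R ∧ ∀ z ∈ Icc x R, (S.T ^ n) z = z := by
  obtain ⟨R, hR, ⟨hxR, huncut⟩, -⟩ := S.exists_isGreatest_uncut x hn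
  refine ⟨R, hxR.lt_of_ne fun e => ?_, fun z hz => hA.eq_of_pos_eq ?_ (S.side_pow n z)⟩
  · simp [← e, hside] at hR
  · have hpos := (huncut.mono le_rfl le_rfl hz.2).pos_pow_sub hA hz.1
    rw [h, hm, one_mul] at hpos
    linarith

theorem IsAffine.periodic_of_covBy (hA : S.IsAffine pos slope) (hcov : y ⋖ x)
    (h : (S.T ^ n) x = x) (hno : ∀ (k : ℕ) j, (S.T ^ k) x ≠ S.l j) :
    (∀ k : ℕ, (S.T ^ k) y ⋖ (S.T ^ k) x) ∧ (S.T ^ n) y = y ∧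
      S.multiplier slope n y = S.multiplier slope n x := by
  have hpow := S.covBy_pow hcov hno
  refine ⟨hpow, (h ▸ hpow n).unique_left hcov, Finset.prod_congr rfl fun k _ => ?_⟩
  obtain ⟨i, hl, hr⟩ := S.exists_piece_of_forall_notMem fun j hj =>
    hno k j (((hpow k).ge_of_gt hj.1).antisymm hj.2)
  exact hA.slope_eq ⟨hl, (hpow k).le.trans hr⟩ ⟨hl.trans (hpow k).le, hr⟩

/-- `p` is a right germ of period `n` that attracts nearby points under `T ^ n`. -/
structure IsAttracting (S : Exchange X side d) (slope : X → ℝ) (n : ℕ) (p : X) : Prop where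
  period_pos : 0 < n
  fixed : (S.T ^ n) p = p
  side_eq : side p = true
  multiplier_lt_one : S.multiplier slope n p < 1

namespace IsAttracting

theorem apply (hp : S.IsAttracting slope n p) : S.IsAttracting slope n (S.T p) where
  period_pos := hp.period_pos
  fixed := by simpa using pow_apply_pow_of_isPeriodicPt hp.fixed 1
  side_eq := by rw [S.side_T, hp.side_eq]
  multiplier_lt_one := by rw [multiplier_apply hp.fixed]; exact hp.multiplier_lt_one

theorem pow (hp : S.IsAttracting slope n p) (k : ℕ) : S.IsAttracting slope n ((S.T ^ k) p) := by
  induction k with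
  | zero => exact hp
  | succ k ih => rw [pow_succ', Equiv.Perm.mul_apply]; exact ih.apply

variable (hA : S.IsAffine pos slope) (hp : S.IsAttracting slope n p)
include hA hp

theorem pow_mem_Ioo (hz : p < z) (huncut : S.Uncut n p z) : (S.T ^ n) z ∈ Ioo p z := by
  have hlt := (huncut.increasingOnto hz.le).lt le_rfl hz le_rfl
  have hpos := huncut.pos_pow_sub hA hz.le
  rw [hp.fixed] at hlt hpos
  refine ⟨hlt, not_le.1 fun hle => ?_⟩
  have := hA.monotone hle
  have := hA.lt_of_side_left hz hp.side_eq
  nlinarith [hp.multiplier_lt_one]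

theorem pow_mul_mem_Ioc (hz : p < z) (huncut : S.Uncut n p z) (j : ℕ) :
    (S.T ^ (n * j)) z ∈ Ioc p z ∧
      pos ((S.T ^ (n * j)) z) - pos p = S.multiplier slope n p ^ j * (pos z - pos p) := by
  induction j with
  | zero => simpa using hz
  | succ j ih =>
    obtain ⟨⟨hlt, hle⟩, hpos⟩ := ih
    have huncut' := huncut.mono le_rfl le_rfl hle
    have hmem := hp.pow_mem_Ioo hA hlt huncut'
    rw [Nat.mul_succ, add_comm, pow_add, Equiv.Perm.mul_apply]
    refine ⟨⟨hmem.1, hmem.2.le.trans hle⟩, ?_⟩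
    have hstep := huncut'.pos_pow_sub hA hlt.le
    rw [hp.fixed] at hstep
    rw [hstep, hpos, pow_succ', mul_assoc]

theorem uncut (huncut : S.Uncut n p z) (m : ℕ) : S.Uncut m p z := fun i _ x hx j hj => by
  have hmem := (hp.pow_mul_mem_Ioc hA hx.1 (huncut.mono le_rfl le_rfl hx.2) (i / n)).1
  refine huncut (i % n) (i.mod_lt hp.period_pos) _ ⟨hmem.1, hmem.2.trans hx.2⟩ j ?_
  rw [← Equiv.Perm.mul_apply, ← pow_add, Nat.mod_add_div, hj]

theorem visits [TopologicalSpace X] [OrderTopology X] (hz : p < z) (huncut : S.Uncut n p z) :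
    Visits S.T p z := by
  refine visits_iff.2 fun s hs N => ?_
  obtain ⟨v, hv, hpv, hsub⟩ := S.exists_Icc_subset_right hs
  have hpv : pos p < pos v := by
    refine hA.lt_of_side_left (hpv.lt_of_ne fun e => ?_) hp.side_eq
    simp [← e, hp.side_eq] at hv
  have hlim : Tendsto (fun j : ℕ => S.multiplier slope n p ^ j * (pos z - pos p)) atTop (𝓝 0) := by
    simpa using (tendsto_pow_atTop_nhds_zero_of_lt_one (hA.multiplier_pos n p).le
      hp.multiplier_lt_one).mul_const (pos z - pos p)
  obtain ⟨j, hj, hjN⟩ := ((hlim.eventually (gt_mem_nhds (sub_pos.2 hpv))).and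
    (eventually_ge_atTop N)).exists
  obtain ⟨hmem, hpos⟩ := hp.pow_mul_mem_Ioc hA hz huncut j
  refine ⟨n * j, hjN.trans (Nat.le_mul_of_pos_left _ hp.period_pos),
    hsub ⟨hmem.1.le, not_lt.1 fun hlt => ?_⟩⟩
  have := hA.monotone hlt.le
  linarith

end IsAttracting

variable (S) in
/-- The largest interval with left end `p` that is never cut by a left endpoint. -/
def uncutSegment (p : X) : Set X := {z | p ≤ z ∧ ∀ m, S.Uncut m p z}

theorem increasingOnto_of_mem_uncutSegment (hz : z ∈ S.uncutSegment p) :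
    IncreasingOnto S.T p z := by
  simpa using (hz.2 1).increasingOnto hz.1

theorem apply_mem_uncutSegment (hz : z ∈ S.uncutSegment p) : S.T z ∈ S.uncutSegment (S.T p) := by
  have hinc := increasingOnto_of_mem_uncutSegment hz
  refine ⟨hinc.le le_rfl hz.1 le_rfl, fun m i _ y hy j hj => ?_⟩
  obtain ⟨x, hx, rfl⟩ := hinc.2 (Ioc_subset_Icc_self hy)
  refine hz.2 (i + 2) (i + 1) (i + 1).lt_succ_self x
    ⟨hx.1.lt_of_ne (ne_of_apply_ne S.T hy.1.ne), hx.2⟩ j ?_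
  rw [pow_succ, Equiv.Perm.mul_apply, hj]

theorem eq_r_of_isGreatest_uncutSegment (hR : IsGreatest (S.uncutSegment p) R)
    (hside : side R = false) (hw : w ∈ S.uncutSegment (S.T p)) (hlt : S.T R < w) :
    ∃ j, R = S.r j := by
  obtain ⟨j, hj⟩ := S.cover R
  refine ⟨j, hj.2.antisymm (not_lt.1 fun hRr => ?_)⟩
  obtain ⟨R', hcov, hR'⟩ := S.split.succ_of_lt hside hRr
  have hcovT : S.T R ⋖ S.T R' := (S.increasing j).covBy hj.1 hcov hR'
  have hTp : S.T p ≤ S.T R := (increasingOnto_of_mem_uncutSegment hR.1).le le_rfl hR.1.1 le_rfl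
  refine hcov.lt.not_ge (hR.2 ⟨hR.1.1.trans hcov.le, fun m i hi x hx i' hx' => ?_⟩)
  rcases hx.2.lt_or_eq with hxR | rfl
  · exact hR.1.2 m i hi x ⟨hx.1, hcov.le_of_lt hxR⟩ i' hx'
  cases i with
  | zero =>
    obtain rfl : x = S.l i' := hx'
    obtain rfl := S.uniq ⟨hj.1.trans hcov.le, hR'⟩ ⟨le_rfl, S.le i'⟩
    exact hcov.lt.not_ge hj.1
  | succ i =>
    rw [pow_succ, Equiv.Perm.mul_apply] at hx'
    exact hw.2 (i + 1) i i.lt_succ_self _ ⟨hTp.trans_lt hcovT.lt, hcovT.ge_of_gt hlt⟩ i' hx'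

theorem IsAttracting.exists_isGreatest (hA : S.IsAffine pos slope)
    (hp : S.IsAttracting slope n p) :
    ∃ R, side R = false ∧ p < R ∧ IsGreatest (S.uncutSegment p) R := by
  obtain ⟨R, hside, hR, hmax⟩ := S.exists_isGreatest_uncut p hp.period_pos
  refine ⟨R, hside, hR.1.lt_of_ne fun e => ?_, ⟨hR.1, hp.uncut hA hR.2⟩,
    fun z hz => hmax ⟨hz.1, hz.2 n⟩⟩
  simp [← e, hp.side_eq] at hside

/-- If `T` mapped each maximal segment onto the next, its `n`-th power would fix their right ends,
contradicting contraction. A right end whose image falls short is a right endpoint. -/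
theorem IsAttracting.exists_r_lt (hA : S.IsAffine pos slope) (hp : S.IsAttracting slope n p) :
    ∃ (k : ℕ) (j : Fin d) (w : X), (S.T ^ (k + 1)) p < S.T (S.r j) ∧ S.T (S.r j) < w ∧
      w ∈ S.uncutSegment ((S.T ^ (k + 1)) p) := by
  choose R hside hlt hR using fun k => (hp.pow k).exists_isGreatest hA
  have hnext (k : ℕ) : S.T ((S.T ^ k) p) = (S.T ^ (k + 1)) p := by
    rw [pow_succ', Equiv.Perm.mul_apply]
  have hmem (k : ℕ) : S.T (R k) ∈ S.uncutSegment ((S.T ^ (k + 1)) p) :=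
    hnext k ▸ apply_mem_uncutSegment (hR k).1
  obtain ⟨k, hk⟩ : ∃ k, S.T (R k) < R (k + 1) := by
    by_contra! hle
    have hiter (k : ℕ) : (S.T ^ k) (R 0) = R k := by
      induction k with
      | zero => rfl
      | succ k ih =>
        rw [pow_succ', Equiv.Perm.mul_apply, ih]
        exact ((hR (k + 1)).2 (hmem k)).antisymm (hle k)
    have hRn : R n = R 0 := (hp.fixed ▸ hR n).unique (hR 0)
    exact (hp.pow_mem_Ioo hA (hlt 0) ((hR 0).1.2 n)).2.ne ((hiter n).trans hRn)
  obtain ⟨j, hj⟩ := eq_r_of_isGreatest_uncutSegment (hR k) (hside k)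
    ((hnext k).symm ▸ (hR (k + 1)).1) hk
  refine ⟨k, j, R (k + 1), ?_, hj ▸ hk, (hR (k + 1)).1⟩
  rw [← hj, ← hnext k]
  exact (increasingOnto_of_mem_uncutSegment (hR k).1).lt le_rfl (hlt k) le_rfl

theorem isAttracting_or_inv (hn : 0 < n) (h : (S.T ^ n) x = x) (hside : side x = true)
    (hm : S.multiplier slope n x ≠ 1) :
    S.IsAttracting slope n x ∨ S.inv.IsAttracting (fun z => (slope (S.T⁻¹ z))⁻¹) n x := by
  rcases hm.lt_or_gt with hlt | hgt
  · exact Or.inl ⟨hn, h, hside, hlt⟩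
  · refine Or.inr ⟨hn, ?_, hside, ?_⟩
    · rw [inv_T, inv_pow, Equiv.Perm.inv_eq_iff_eq, h]
    · rw [multiplier_inv h]
      exact inv_lt_one_of_one_lt₀ hgt

section Topology

variable [TopologicalSpace X] [OrderTopology X]

theorem IsAttracting.exists_visits (hA : S.IsAffine pos slope) (hp : S.IsAttracting slope n p) :
    ∃ j j', Visits S.T p (S.r j) ∧ Visits S.T p (S.l j') ∧ (S.T ^ n) (S.l j') ≠ S.l j' := by
  obtain ⟨k, j, w, hpr, hrw, hw⟩ := hp.exists_r_lt hA
  obtain ⟨u, hu, huw⟩ := S.split.succ_of_lt (S.inv.side_r j) hrw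
  obtain ⟨j', rfl⟩ := S.inv.eq_l_of_r_covBy hu
  have hpl : (S.T ^ (k + 1)) p < S.T (S.l j') := hpr.trans hu.lt
  have hvisits {z : X} (hz : (S.T ^ (k + 1)) p < S.T z) (hzw : S.T z ≤ w) : Visits S.T p z :=
    (visits_pow_right 1).1 ((S.visits_pow_left (k + 1)).1
      ((hp.pow (k + 1)).visits hA hz ((hw.2 n).mono le_rfl le_rfl hzw)))
  refine ⟨j, j', hvisits hpr hrw.le, hvisits hpl huw, fun hfix => ?_⟩
  refine ((hp.pow (k + 1)).pow_mem_Ioo hA hpl ((hw.2 n).mono le_rfl le_rfl huw)).2.ne ?_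
  simpa using pow_apply_pow_of_isPeriodicPt hfix 1

theorem IsAttracting.two_le_visitCount (hA : S.IsAffine pos slope)
    (hp : S.IsAttracting slope n p) : 2 ≤ S.visitCount p := by
  obtain ⟨j, j', hr, hl, -⟩ := hp.exists_visits hA
  have hr := Finset.card_pos.2 ⟨j, mem_visitors.2 hr⟩
  have hl := Finset.card_pos.2 ⟨j', mem_visitors.2 hl⟩
  rw [visitCount]
  omega

theorem IsAttracting.four_le_visitCount (hA : S.IsAffine pos slope)
    (hp : S.IsAttracting slope n p) {k : ℕ} (hk : (S.T ^ k) p = S.l j) : 4 ≤ S.visitCount p := by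
  obtain ⟨i, j', hr, hl, hne⟩ := hp.exists_visits hA
  have hself : Visits S.T p p := visits_self_of_isPeriodicPt hp.period_pos hp.fixed
  have hfut : Visits S.T p (S.l j) := hk ▸ (visits_pow_right k).2 hself
  have hpast : Visits S.T⁻¹ p (S.l j) := hk ▸ (visits_inv_pow_right k).2 (S.visits_inv_self hself)
  have hjj' : j ≠ j' := by
    rintro rfl
    exact hne (hk ▸ pow_apply_pow_of_isPeriodicPt hp.fixed k)
  have hr := Finset.card_pos.2 ⟨i, mem_visitors.2 hr⟩
  have hl := Finset.one_lt_card.2 ⟨j, mem_visitors.2 hfut, j', mem_visitors.2 hl, hjj'⟩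
  have hpast := Finset.card_pos.2 ⟨j, mem_visitors.2 hpast⟩
  rw [visitCount]
  omega

theorem IsAffine.four_le_visitCount (hA : S.IsAffine pos slope) (hn : 0 < n)
    (h : (S.T ^ n) x = x) (hside : side x = true) (hm : S.multiplier slope n x ≠ 1) {k : ℕ}
    (hk : (S.T ^ k) x = S.l j) : 4 ≤ S.visitCount x := by
  rcases isAttracting_or_inv hn h hside hm with hx | hx
  · exact hx.four_le_visitCount hA hk
  · obtain ⟨m, hm⟩ := exists_inv_pow_eq_pow hn h (k + 1)
    rw [← S.visitCount_inv]
    refine hx.four_le_visitCount hA.inv (j := j) (k := m) ?_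
    rw [inv_T, hm, pow_succ', Equiv.Perm.mul_apply, hk, inv_l]

theorem IsAffine.two_le_visitCount_of_side (hA : S.IsAffine pos slope) (hn : 0 < n)
    (h : (S.T ^ n) x = x) (hside : side x = true) (hm : S.multiplier slope n x ≠ 1) :
    2 ≤ S.visitCount x := by
  rcases isAttracting_or_inv hn h hside hm with hx | hx
  · exact hx.two_le_visitCount hA
  · exact S.visitCount_inv x ▸ hx.two_le_visitCount hA.inv

theorem IsAffine.two_le_visitCount (hA : S.IsAffine pos slope) (hn : 0 < n)
    (h : (S.T ^ n) x = x) (hm : S.multiplier slope n x ≠ 1) : 2 ≤ S.visitCount x := by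
  cases hside : side x
  · rw [← S.visitCount_dual]
    refine hA.dual.two_le_visitCount_of_side hn ?_ (by simp [hside]) (by rwa [multiplier_dual])
    rw [dual_pow_toDual, h]
  · exact hA.two_le_visitCount_of_side hn h hside hm

end Topology

end Exchange

namespace Exchange

variable {X : Type*} [LinearOrder X] {side : X → Bool} {d : ℕ} (S : Exchange X side d)
variable {w x y z : X}

theorem notMem_periodicPts_of_covBy (hw : w ∉ Function.periodicPts S.T)
    (h : ∀ k : ℕ, (S.T ^ k) y ⋖ (S.T ^ k) w) : y ∉ Function.periodicPts S.T := by
  intro hper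
  obtain ⟨n, hn, hfix⟩ := mem_periodicPts_iff.1 hper
  exact pow_apply_ne_of_notMem_periodicPts hw hn ((hfix ▸ h n).unique_right (h 0))

variable [TopologicalSpace X] [OrderTopology X]

theorem visits_of_covBy (hy : y ∉ Function.periodicPts S.T)
    (h : ∀ k : ℕ, (S.T ^ k) y ⋖ (S.T ^ k) w) (hv : Visits S.T z y) : Visits S.T z w := by
  refine visits_iff.2 fun s hs N => ?_
  obtain ⟨u, v, hu, hv', hz, hs'⟩ := S.exists_Icc_subset hs
  obtain ⟨n, hn, hne⟩ := ((visits_pow_right N).2 hv).exists_ne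
    (fun _ => pow_apply_ne_of_notMem_periodicPts (pow_notMem_periodicPts hy N))
    (S.split.Icc_mem_nhds hu hv' hz) v
  rw [← Equiv.Perm.mul_apply, ← pow_add] at hn hne
  exact ⟨n + N, N.le_add_left n, hs' ⟨hn.1.trans (h _).le, (h _).ge_of_gt (hn.2.lt_of_ne hne)⟩⟩

theorem visits_iff_of_covBy (hw : w ∉ Function.periodicPts S.T)
    (h : ∀ k : ℕ, (S.T ^ k) y ⋖ (S.T ^ k) w) : Visits S.T z y ↔ Visits S.T z w := by
  refine ⟨S.visits_of_covBy (S.notMem_periodicPts_of_covBy hw h) h, fun hv => S.visits_dual.1 ?_⟩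
  refine S.dual.visits_of_covBy (w := OrderDual.toDual y) (y := OrderDual.toDual w) hw
    (fun k => ?_) (S.visits_dual.2 hv)
  simpa only [dual_pow_toDual] using (h k).toDual

theorem sum_card_visitors_le {f : Equiv.Perm X} (hf : f = S.T ∨ f = S.T⁻¹) (e : Fin d → X)
    {G : Finset X} (hrec : ∀ g ∈ G, Visits S.T g g) (hinj : Set.InjOn S.limitSet G) :
    ∑ g ∈ G, (visitors f e g).card ≤ d := by
  classical
  rw [← Finset.card_biUnion]
  · exact (Finset.card_le_univ _).trans (Fintype.card_fin d).le
  · intro g hg g' hg' hne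
    refine Finset.disjoint_left.2 fun j hj hj' => hne (hinj hg hg' ?_)
    exact S.limitSet_eq_of_visits hf (hrec g hg) (hrec g' hg') (mem_visitors.1 hj)
      (mem_visitors.1 hj')

theorem sum_visitCount_le {G : Finset X} (hrec : ∀ g ∈ G, Visits S.T g g)
    (hinj : Set.InjOn S.limitSet G) : ∑ g ∈ G, S.visitCount g ≤ 4 * d := by
  simp only [visitCount, Finset.sum_add_distrib]
  linarith [S.sum_card_visitors_le (Or.inr rfl) S.l hrec hinj,
    S.sum_card_visitors_le (Or.inr rfl) S.r hrec hinj,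
    S.sum_card_visitors_le (Or.inl rfl) S.l hrec hinj,
    S.sum_card_visitors_le (Or.inl rfl) S.r hrec hinj]

theorem sum_weight_le {ι : Type*} {φ : Set X → ι} {𝒪 : Finset ι} {weight : ι → ℕ}
    (h : ∀ Ω ∈ 𝒪, ∃ A : Finset X, (∀ g ∈ A, Visits S.T g g ∧ φ (S.limitSet g) = Ω) ∧
      Set.InjOn S.limitSet A ∧ weight Ω ≤ ∑ g ∈ A, S.visitCount g) :
    ∑ Ω ∈ 𝒪, weight Ω ≤ 4 * d := by
  classical
  choose! A hA hinj hweight using h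
  have hdisj : (𝒪 : Set ι).PairwiseDisjoint A := fun Ω hΩ Ω' hΩ' hne =>
    Finset.disjoint_left.2 fun g hg hg' => hne ((hA Ω hΩ g hg).2 ▸ (hA Ω' hΩ' g hg').2)
  calc ∑ Ω ∈ 𝒪, weight Ω ≤ ∑ Ω ∈ 𝒪, ∑ g ∈ A Ω, S.visitCount g := Finset.sum_le_sum hweight
    _ = ∑ g ∈ 𝒪.biUnion A, S.visitCount g := (Finset.sum_biUnion hdisj).symm
    _ ≤ 4 * d := by
      refine S.sum_visitCount_le (fun g hg => ?_) fun g hg g' hg' heq => ?_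
      · obtain ⟨Ω, hΩ, hgA⟩ := Finset.mem_biUnion.1 hg
        exact (hA Ω hΩ g hgA).1
      · obtain ⟨Ω, hΩ, hgA⟩ := Finset.mem_biUnion.1 (Finset.mem_coe.1 hg)
        obtain ⟨Ω', hΩ', hgA'⟩ := Finset.mem_biUnion.1 (Finset.mem_coe.1 hg')
        obtain rfl : Ω = Ω' := (hA Ω hΩ g hgA).2 ▸ heq ▸ (hA Ω' hΩ' g' hgA').2
        exact hinj Ω hΩ hgA hgA' heq

end Exchange

/-! ### Germs of the unit interval -/

/-- The points `x` for which the right germ `x⁺` (side `true`) or the left germ `x⁻` (side `false`)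
is a germ of the interval `[a, b)`. -/
def sideIco (a b : ℝ) : Bool → Set ℝ
  | true => Ico a b
  | false => Ioc a b

theorem sideIco_subset_sideIco {a b a' b' : ℝ} (ha : a' ≤ a) (hb : b ≤ b') (σ : Bool) :
    sideIco a b σ ⊆ sideIco a' b' σ := by
  cases σ
  exacts [Ioc_subset_Ioc ha hb, Ico_subset_Ico ha hb]

theorem mul_add_mem_sideIco {a b s t x : ℝ} (hs : 0 < s) {σ : Bool} :
    s * x + t ∈ sideIco (s * a + t) (s * b + t) σ ↔ x ∈ sideIco a b σ := by
  cases σ <;> simp [sideIco, hs]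

/-- The one-sided germs of the unit interval: the right germs `x⁺` (side `true`) for `0 ≤ x < 1` and
the left germs `x⁻` (side `false`) for `0 < x ≤ 1`. They are ordered lexicographically, so that `x⁻`
and `x⁺` are adjacent. -/
@[ext]
structure Germ where
  pos : ℝ
  side : Bool
  pos_mem : pos ∈ sideIco 0 1 side

namespace Germ

variable {a b : ℝ} {g h : Germ}

noncomputable instance : LinearOrder Germ :=
  LinearOrder.lift' (fun g => toLex (g.pos, g.side)) fun _ _ hgh =>
    Germ.ext (congrArg Prod.fst (toLex_inj.1 hgh)) (congrArg Prod.snd (toLex_inj.1 hgh))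

noncomputable instance : TopologicalSpace Germ := Preorder.topology Germ

instance : OrderTopology Germ := ⟨rfl⟩

theorem lt_iff : g < h ↔ g.pos < h.pos ∨ g.pos = h.pos ∧ g.side < h.side :=
  Prod.Lex.lt_iff

theorem le_iff : g ≤ h ↔ g.pos < h.pos ∨ g.pos = h.pos ∧ g.side ≤ h.side :=
  Prod.Lex.le_iff

theorem le_of_pos_lt (hgh : g.pos < h.pos) : g ≤ h :=
  le_iff.2 (Or.inl hgh)

theorem monotone_pos : Monotone pos := fun _ _ hgh =>
  (le_iff.1 hgh).elim le_of_lt fun heq => heq.1.le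

theorem le_iff_of_side_left (hg : g.side = true) :
    h ≤ g ↔ h.pos ≤ g.pos := by
  simp [le_iff, le_iff_lt_or_eq (a := h.pos), hg, Bool.le_true]

theorem le_iff_of_side_right (hg : g.side = false) :
    g ≤ h ↔ g.pos ≤ h.pos := by
  simp [le_iff, le_iff_lt_or_eq (a := g.pos), hg]

theorem pos_lt_of_side_left (hgh : g < h) (hg : g.side = true) : g.pos < h.pos :=
  lt_of_not_ge fun hle => hgh.not_ge ((le_iff_of_side_left hg).2 hle)

theorem pos_lt_of_side_right (hgh : g < h) (hh : h.side = false) : g.pos < h.pos :=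
  lt_of_not_ge fun hle => hgh.not_ge ((le_iff_of_side_right hh).2 hle)

theorem pos_mem_Icc (g : Germ) : g.pos ∈ Icc (0 : ℝ) 1 := by
  obtain ⟨x, _ | _, hx⟩ := g
  exacts [Ioc_subset_Icc_self hx, Ico_subset_Icc_self hx]

theorem pos_mem_of_side (g : Germ) {σ : Bool} (hg : g.side = σ) : g.pos ∈ sideIco 0 1 σ :=
  hg ▸ g.pos_mem

theorem pos_mem_sideIco_iff (ha : a ∈ sideIco 0 1 true) (hb : b ∈ sideIco 0 1 false) :
    g.pos ∈ sideIco a b g.side ↔ g ∈ Icc ⟨a, true, ha⟩ ⟨b, false, hb⟩ := by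
  obtain ⟨x, σ, hx⟩ := g
  cases σ <;> simp [sideIco, le_iff, le_iff_lt_or_eq (α := ℝ)]

theorem covBy_of_pos_eq (hpos : g.pos = h.pos) (hg : g.side = false) (hh : h.side = true) :
    g ⋖ h := by
  refine ⟨lt_iff.2 (Or.inr ⟨hpos, by simp [hg, hh]⟩), fun k hgk hkh => ?_⟩
  cases hk : k.side
  · exact ((monotone_pos hkh.le).trans hpos.ge).not_gt (pos_lt_of_side_right hgk hk)
  · exact (hpos.ge.trans (monotone_pos hgk.le)).not_gt (pos_lt_of_side_left hkh hk)

theorem exists_covBy_of_pos_lt (hlt : g.pos < h.pos) :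
    ∃ v u : Germ, g < v ∧ v ⋖ u ∧ u < h ∧ v.side = false ∧ u.side = true := by
  obtain ⟨c, hgc, hch⟩ := exists_between hlt
  have h0 : 0 < c := g.pos_mem_Icc.1.trans_lt hgc
  have h1 : c < 1 := hch.trans_le h.pos_mem_Icc.2
  exact ⟨⟨c, false, h0, h1.le⟩, ⟨c, true, h0.le, h1⟩, lt_iff.2 (Or.inl hgc),
    covBy_of_pos_eq rfl rfl rfl, lt_iff.2 (Or.inl hch), rfl, rfl⟩

theorem isBot_of_pos_eq_zero (hpos : g.pos = 0) : IsBot g := by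
  refine fun h => le_of_not_gt fun hlt => ?_
  cases hh : h.side
  · have hmem := h.pos_mem_of_side hh
    exact ((monotone_pos hlt.le).trans hpos.le).not_gt hmem.1
  · exact (hpos.trans_le h.pos_mem_Icc.1).not_gt (pos_lt_of_side_left hlt hh)

theorem isTop_of_pos_eq_one (hpos : g.pos = 1) : IsTop g := by
  refine fun h => le_of_not_gt fun hlt => ?_
  cases hh : h.side
  · exact (h.pos_mem_Icc.2.trans hpos.ge).not_gt (pos_lt_of_side_right hlt hh)
  · have hmem := h.pos_mem_of_side hh
    exact (hpos.ge.trans (monotone_pos hlt.le)).not_gt hmem.2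

theorem isSplitOrder : IsSplitOrder Germ side where
  sep g h hgh := by
    rcases lt_iff.1 hgh with hlt | ⟨heq, hside⟩
    · obtain ⟨v, u, hv, hvu, hu, hside⟩ := exists_covBy_of_pos_lt hlt
      exact ⟨v, u, hv.le, hvu, hu.le, hside⟩
    · obtain ⟨hg, hh⟩ := Bool.lt_iff.1 hside
      exact ⟨g, h, le_rfl, covBy_of_pos_eq heq hg hh, le_rfl, hg, hh⟩
  exists_pred {g} hg := by
    have hmem : g.pos ∈ Ico (0 : ℝ) 1 := g.pos_mem_of_side hg
    rcases hmem.1.eq_or_lt with heq | hlt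
    · exact Or.inl (isBot_of_pos_eq_zero heq.symm)
    · exact Or.inr ⟨⟨g.pos, false, hlt, hmem.2.le⟩, covBy_of_pos_eq rfl rfl hg⟩
  exists_succ {g} hg := by
    have hmem : g.pos ∈ Ioc (0 : ℝ) 1 := g.pos_mem_of_side hg
    rcases hmem.2.eq_or_lt with heq | hlt
    · exact Or.inl (isTop_of_pos_eq_one heq)
    · exact Or.inr ⟨⟨g.pos, true, hmem.1.le, hlt⟩, covBy_of_pos_eq rfl hg rfl⟩

theorem pos_eq_of_covBy (hc : g ⋖ h) : g.pos = h.pos := by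
  refine (monotone_pos hc.le).eq_of_not_lt fun hlt => ?_
  obtain ⟨v, u, hv, hvu, hu, -⟩ := exists_covBy_of_pos_lt hlt
  exact hc.2 hv (hvu.lt.trans hu)

theorem continuous_pos : Continuous pos := by
  have hcont : Continuous fun g : Germ => (⟨g.pos, g.pos_mem_Icc⟩ : Icc (0 : ℝ) 1) := by
    refine Monotone.continuous_of_surjective (fun g h hgh => monotone_pos hgh) fun x => ?_
    rcases x.2.2.eq_or_lt with heq | hlt
    · exact ⟨⟨x, false, one_pos.trans_eq heq.symm, x.2.2⟩, rfl⟩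
    · exact ⟨⟨x, true, x.2.1, hlt⟩, rfl⟩
  exact continuous_subtype_val.comp hcont

end Germ

/-- The intervals `[a i, b i)` are non-empty and partition `[0, 1)`. -/
structure IsPartition {d : ℕ} (a b : Fin d → ℝ) : Prop where
  lt : ∀ i, a i < b i
  uniq : ∀ ⦃i j x⦄, x ∈ Ico (a i) (b i) → x ∈ Ico (a j) (b j) → i = j
  mem_iff : ∀ x, (∃ i, x ∈ Ico (a i) (b i)) ↔ x ∈ Ico (0 : ℝ) 1

namespace IsPartition

variable {d : ℕ} {a b : Fin d → ℝ} {i j : Fin d} {x : ℝ} {σ : Bool}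

theorem left_mem (h : IsPartition a b) (i : Fin d) : a i ∈ sideIco 0 1 true :=
  (h.mem_iff _).1 ⟨i, le_rfl, h.lt i⟩

theorem right_mem (h : IsPartition a b) (i : Fin d) : b i ∈ sideIco 0 1 false := by
  refine ⟨(h.left_mem i).1.trans_lt (h.lt i), le_of_not_gt fun hlt => ?_⟩
  exact lt_irrefl _ ((h.mem_iff 1).1 ⟨i, (h.left_mem i).2.le, hlt⟩).2

theorem sideIco_subset (h : IsPartition a b) (i : Fin d) (σ : Bool) :
    sideIco (a i) (b i) σ ⊆ sideIco 0 1 σ :=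
  sideIco_subset_sideIco (h.left_mem i).1 (h.right_mem i).2 σ

theorem eq_of_mem_sideIco (h : IsPartition a b) (hi : x ∈ sideIco (a i) (b i) σ)
    (hj : x ∈ sideIco (a j) (b j) σ) : i = j := by
  cases σ
  · have hlt : max (a i) (a j) < x := max_lt hi.1 hj.1
    exact h.uniq ⟨le_max_left _ _, hlt.trans_le hi.2⟩ ⟨le_max_right _ _, hlt.trans_le hj.2⟩
  · exact h.uniq hi hj

theorem exists_mem_Ioc (h : IsPartition a b) (hx : x ∈ Ioc (0 : ℝ) 1) :
    ∃ i, x ∈ Ioc (a i) (b i) := by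
  obtain ⟨i₀, hi₀⟩ := (h.mem_iff 0).2 ⟨le_rfl, one_pos⟩
  obtain ⟨i, hi, hmax⟩ := Set.exists_max_image {i | a i < x} a (toFinite _)
    ⟨i₀, hi₀.1.trans_lt hx.1⟩
  refine ⟨i, hi, le_of_not_gt fun hlt => ?_⟩
  obtain ⟨j, hj⟩ := (h.mem_iff (b i)).2 ⟨(h.right_mem i).1.le, hlt.trans_le hx.2⟩
  obtain rfl : i = j :=
    h.uniq ⟨le_rfl, h.lt i⟩ ⟨hmax j (hj.1.trans_lt hlt), (h.lt i).trans hj.2⟩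
  exact lt_irrefl _ hj.2

theorem exists_mem_sideIco (h : IsPartition a b) (hx : x ∈ sideIco 0 1 σ) :
    ∃ i, x ∈ sideIco (a i) (b i) σ := by
  cases σ
  exacts [h.exists_mem_Ioc hx, (h.mem_iff x).2 hx]

/-- The index of the interval to which a germ belongs. -/
noncomputable def index (h : IsPartition a b) (g : Germ) : Fin d :=
  (h.exists_mem_sideIco g.pos_mem).choose

theorem pos_mem_index (h : IsPartition a b) (g : Germ) :
    g.pos ∈ sideIco (a (h.index g)) (b (h.index g)) g.side :=
  (h.exists_mem_sideIco g.pos_mem).choose_spec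

theorem index_eq (h : IsPartition a b) {g : Germ} (hi : g.pos ∈ sideIco (a i) (b i) g.side) :
    h.index g = i :=
  h.eq_of_mem_sideIco (h.pos_mem_index g) hi

end IsPartition

section GermExchange

variable {d : ℕ} {a b slope shift : Fin d → ℝ} (h : IsPartition a b)
variable (h' : IsPartition (fun i => slope i * a i + shift i) (fun i => slope i * b i + shift i))
variable (hslope : ∀ i, 0 < slope i) {g k : Germ} {i : Fin d}

/-- The action on germs of the bijection of `[0, 1)` that is `x ↦ slope i * x + shift i` on
`[a i, b i)`. -/
noncomputable def germMap (g : Germ) : Germ where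
  pos := slope (h.index g) * g.pos + shift (h.index g)
  side := g.side
  pos_mem := h'.sideIco_subset _ _ ((mul_add_mem_sideIco (hslope _)).2 (h.pos_mem_index g))

theorem pos_germMap (hi : g.pos ∈ sideIco (a i) (b i) g.side) :
    (germMap h h' hslope g).pos = slope i * g.pos + shift i := by
  rw [← h.index_eq hi]
  rfl

theorem pos_germMap_mem_iff :
    (germMap h h' hslope g).pos ∈
      sideIco (slope i * a i + shift i) (slope i * b i + shift i) g.side ↔
      g.pos ∈ sideIco (a i) (b i) g.side := by
  have himage {j : Fin d} (hj : g.pos ∈ sideIco (a j) (b j) g.side) :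
      (germMap h h' hslope g).pos ∈
        sideIco (slope j * a j + shift j) (slope j * b j + shift j) g.side := by
    rw [pos_germMap h h' hslope hj]
    exact (mul_add_mem_sideIco (hslope j)).2 hj
  refine ⟨fun hi => ?_, himage⟩
  rw [h'.eq_of_mem_sideIco hi (himage (h.pos_mem_index g))]
  exact h.pos_mem_index g

theorem exists_germMap_eq
    (hk : k.pos ∈ sideIco (slope i * a i + shift i) (slope i * b i + shift i) k.side) :
    ∃ g : Germ, g.pos ∈ sideIco (a i) (b i) g.side ∧ germMap h h' hslope g = k := by
  have hpos : slope i * ((k.pos - shift i) / slope i) + shift i = k.pos := by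
    rw [mul_div_cancel₀ _ (hslope i).ne', sub_add_cancel]
  have hmem : (k.pos - shift i) / slope i ∈ sideIco (a i) (b i) k.side :=
    (mul_add_mem_sideIco (hslope i)).1 (hpos.symm ▸ hk)
  exact ⟨⟨_, k.side, h.sideIco_subset i _ hmem⟩, hmem,
    Germ.ext ((pos_germMap h h' hslope hmem).trans hpos) rfl⟩

theorem bijective_germMap : Function.Bijective (germMap h h' hslope) := by
  refine ⟨fun g k hgk => ?_, fun k => ?_⟩
  · have hside := congrArg Germ.side hgk
    change g.side = k.side at hside
    have hk := h.pos_mem_index k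
    have hg : g.pos ∈ sideIco (a (h.index k)) (b (h.index k)) g.side := by
      rw [← pos_germMap_mem_iff h h' hslope, hgk, hside]
      exact (pos_germMap_mem_iff h h' hslope).2 hk
    have hpos := congrArg Germ.pos hgk
    rw [pos_germMap h h' hslope hg, pos_germMap h h' hslope hk, add_left_inj] at hpos
    exact Germ.ext (mul_left_cancel₀ (hslope _).ne' hpos) hside
  · obtain ⟨i, hi⟩ := h'.exists_mem_sideIco k.pos_mem
    exact (exists_germMap_eq h h' hslope hi).imp fun _ hg => hg.2

theorem germMap_lt (hg : g.pos ∈ sideIco (a i) (b i) g.side)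
    (hk : k.pos ∈ sideIco (a i) (b i) k.side) (hgk : g < k) :
    germMap h h' hslope g < germMap h h' hslope k := by
  rw [Germ.lt_iff, pos_germMap h h' hslope hg, pos_germMap h h' hslope hk]
  refine (Germ.lt_iff.1 hgk).imp (fun hlt => ?_) fun ⟨heq, hside⟩ => ⟨by rw [heq], hside⟩
  have := hslope i
  gcongr

theorem increasingOnto_germMap (i : Fin d) :
    IncreasingOnto (germMap h h' hslope) ⟨a i, true, h.left_mem i⟩ ⟨b i, false, h.right_mem i⟩ := by
  refine ⟨fun g hg k hk => germMap_lt h h' hslope (Germ.pos_mem_sideIco_iff _ _ |>.2 hg)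
    (Germ.pos_mem_sideIco_iff _ _ |>.2 hk), fun k hk => ?_⟩
  have hleft : germMap h h' hslope ⟨a i, true, h.left_mem i⟩ = ⟨_, true, h'.left_mem i⟩ :=
    Germ.ext (pos_germMap h h' hslope ⟨le_rfl, h.lt i⟩) rfl
  have hright : germMap h h' hslope ⟨b i, false, h.right_mem i⟩ = ⟨_, false, h'.right_mem i⟩ :=
    Germ.ext (pos_germMap h h' hslope ⟨h.lt i, le_rfl⟩) rfl
  rw [hleft, hright, ← Germ.pos_mem_sideIco_iff] at hk
  obtain ⟨g, hg, hgk⟩ := exists_germMap_eq h h' hslope hk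
  exact ⟨g, (Germ.pos_mem_sideIco_iff _ _).1 hg, hgk⟩

/-- The exchange of the germs of the intervals `[a i, b i)` whose map is `germMap`. -/
noncomputable def germExchange : Exchange Germ Germ.side d where
  T := Equiv.ofBijective _ (bijective_germMap h h' hslope)
  l := fun i => ⟨a i, true, h.left_mem i⟩
  r := fun i => ⟨b i, false, h.right_mem i⟩
  le := fun i => Germ.le_of_pos_lt (h.lt i)
  cover := fun g => (h.exists_mem_sideIco g.pos_mem).imp fun _ => (Germ.pos_mem_sideIco_iff _ _).1
  uniq := fun _ _ _ hi hj => h.eq_of_mem_sideIco ((Germ.pos_mem_sideIco_iff _ _).2 hi)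
    ((Germ.pos_mem_sideIco_iff _ _).2 hj)
  increasing := increasingOnto_germMap h h' hslope
  side_l := fun _ => rfl
  side_r := fun _ => rfl
  side_T := fun _ => rfl
  split := Germ.isSplitOrder

theorem isAffine_germExchange :
    (germExchange h h' hslope).IsAffine Germ.pos (fun g => slope (h.index g)) where
  slope_pos _ := hslope _
  slope_eq i g k hg hk := by
    rw [h.index_eq ((Germ.pos_mem_sideIco_iff _ _).2 hg),
      h.index_eq ((Germ.pos_mem_sideIco_iff _ _).2 hk)]
  pos_apply_sub i g k hg hk := by
    replace hg := (Germ.pos_mem_sideIco_iff _ _).2 hg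
    replace hk := (Germ.pos_mem_sideIco_iff _ _).2 hk
    change (germMap h h' hslope k).pos - (germMap h h' hslope g).pos = _
    rw [pos_germMap h h' hslope hg, pos_germMap h h' hslope hk, h.index_eq hg]
    ring
  monotone := Germ.monotone_pos
  lt_of_side_left _ _ := Germ.pos_lt_of_side_left
  lt_of_side_right _ _ := Germ.pos_lt_of_side_right

end GermExchange

/-- The right germ of a point of `[0, 1)`. -/
def rightGerm (x : I01) : Germ := ⟨x, true, x.2⟩

theorem rightGerm_injective : Function.Injective rightGerm := fun _ _ h =>
  Subtype.ext (congrArg Germ.pos h)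

section IsAIET

variable {d : ℕ} {T : Equiv.Perm I01} {a b slope shift : Fin d → ℝ}

theorem exists_apply_eq (h : IsPartition a b) (hslope : ∀ i, 0 < slope i)
    (hT : ∀ i, ∀ x : I01, (x : ℝ) ∈ Ico (a i) (b i) → (T x : ℝ) = slope i * x + shift i)
    {i : Fin d} {y : ℝ} (hy : y ∈ Ico (slope i * a i + shift i) (slope i * b i + shift i)) :
    ∃ x : I01, (x : ℝ) ∈ Ico (a i) (b i) ∧ (T x : ℝ) = y := by
  have hy' : slope i * ((y - shift i) / slope i) + shift i = y := by
    rw [mul_div_cancel₀ _ (hslope i).ne', sub_add_cancel]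
  have hx : (y - shift i) / slope i ∈ Ico (a i) (b i) :=
    (mul_add_mem_sideIco (σ := true) (hslope i)).1 (hy'.symm ▸ hy)
  exact ⟨⟨_, (h.mem_iff _).1 ⟨i, hx⟩⟩, hx, (hT i _ hx).trans hy'⟩

theorem IsPartition.image (h : IsPartition a b) (hslope : ∀ i, 0 < slope i)
    (hT : ∀ i, ∀ x : I01, (x : ℝ) ∈ Ico (a i) (b i) → (T x : ℝ) = slope i * x + shift i) :
    IsPartition (fun i => slope i * a i + shift i) (fun i => slope i * b i + shift i) where
  lt i := by
    have := hslope i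
    have := h.lt i
    gcongr
  uniq i j y hi hj := by
    obtain ⟨x, hx, hxy⟩ := exists_apply_eq h hslope hT hi
    obtain ⟨x', hx', hxy'⟩ := exists_apply_eq h hslope hT hj
    obtain rfl : x = x' := T.injective (Subtype.ext (hxy.trans hxy'.symm))
    exact h.uniq hx hx'
  mem_iff y := by
    constructor
    · rintro ⟨i, hi⟩
      obtain ⟨x, -, rfl⟩ := exists_apply_eq h hslope hT hi
      exact (T x).2
    · intro hy
      obtain ⟨x, hx⟩ := T.surjective ⟨y, hy⟩
      obtain ⟨i, hi⟩ := (h.mem_iff x).2 x.2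
      obtain rfl : (T x : ℝ) = y := congrArg Subtype.val hx
      refine ⟨i, ?_⟩
      rw [hT i x hi]
      exact (mul_add_mem_sideIco (σ := true) (hslope i)).2 hi

theorem exists_isAffine_exchange (hT : IsAIET d T) :
    ∃ (S : Exchange Germ Germ.side d) (slope : Germ → ℝ), S.IsAffine Germ.pos slope ∧
      ∀ x, S.T (rightGerm x) = rightGerm (T x) := by
  obtain ⟨a, b, slope, shift, hlt, hdisj, hcover, hslope, hT⟩ := hT
  have h : IsPartition a b :=
    ⟨hlt, fun i j x hi hj => by_contra fun hne => disjoint_left.1 (hdisj i j hne) hi hj,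
      fun x => by rw [← hcover, mem_iUnion]⟩
  have h' := h.image hslope hT
  refine ⟨germExchange h h' hslope, _, isAffine_germExchange h h' hslope, fun x => ?_⟩
  obtain ⟨i, hi⟩ := (h.mem_iff x).2 x.2
  exact Germ.ext ((pos_germMap h h' hslope (g := rightGerm x) hi).trans (hT i x hi).symm) rfl

end IsAIET

/-! ### From germs to points -/

namespace Germ

variable {F : Filter Germ} {g : Germ}

theorem le_nhds_of_side_eq_false (hg : g.side = false) (hpos : Tendsto pos F (𝓝 g.pos))
    (hle : ∀ᶠ k in F, k ≤ g) : F ≤ 𝓝 g := by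
  refine tendsto_id'.1 (tendsto_order.2 ⟨fun k hk => ?_, fun k hk => ?_⟩)
  · filter_upwards [hpos.eventually_const_lt (pos_lt_of_side_right hk hg)] with k' hk'
    exact lt_iff.2 (Or.inl hk')
  · filter_upwards [hle] with k' hk'
    exact hk'.trans_lt hk

theorem le_nhds_of_side_eq_true (hg : g.side = true) (hpos : Tendsto pos F (𝓝 g.pos))
    (hle : ∀ᶠ k in F, g ≤ k) : F ≤ 𝓝 g := by
  refine tendsto_id'.1 (tendsto_order.2 ⟨fun k hk => ?_, fun k hk => ?_⟩)
  · filter_upwards [hle] with k' hk'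
    exact hk.trans_le hk'
  · filter_upwards [hpos.eventually_lt_const (pos_lt_of_side_left hk hg)] with k' hk'
    exact lt_iff.2 (Or.inl hk')

theorem isProperMap_pos : IsProperMap pos := by
  refine isProperMap_iff_ultrafilter.2 ⟨continuous_pos, fun 𝒰 x hx => ?_⟩
  have hmem : x ∈ Icc (0 : ℝ) 1 :=
    isClosed_Icc.mem_of_tendsto hx (Eventually.of_forall pos_mem_Icc)
  rcases 𝒰.eventually_or.1 (Eventually.of_forall fun k : Germ =>
      em (k.pos < x ∨ k.pos = x ∧ k.side = false)) with h | h
  · obtain ⟨k, hk⟩ := h.exists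
    have hx0 : 0 < x := hk.elim k.pos_mem_Icc.1.trans_lt fun hk =>
      hk.1 ▸ (k.pos_mem_of_side hk.2).1
    refine ⟨⟨x, false, hx0, hmem.2⟩, rfl, le_nhds_of_side_eq_false rfl hx (h.mono fun k hk => ?_)⟩
    exact le_iff.2 (hk.imp_right fun hk => ⟨hk.1, hk.2.le⟩)
  · have hleft : ∀ᶠ k in (𝒰 : Filter Germ), x < k.pos ∨ k.pos = x ∧ k.side = true :=
      h.mono fun k hk => by grind
    obtain ⟨k, hk⟩ := hleft.exists
    have hx1 : x < 1 := hk.elim (·.trans_le k.pos_mem_Icc.2) fun hk =>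
      hk.1 ▸ (k.pos_mem_of_side hk.2).2
    refine ⟨⟨x, true, hmem.1, hx1⟩, rfl, le_nhds_of_side_eq_true rfl hx (hleft.mono fun k hk => ?_)⟩
    exact le_iff.2 (hk.imp_right fun hk => ⟨hk.1.symm, hk.2.ge⟩)

end Germ

theorem accPt_range_iff_mapClusterPt {X : Type*} [TopologicalSpace X] [T1Space X] {u : ℕ → X}
    (hu : Function.Injective u) {x : X} :
    AccPt x (𝓟 (range u)) ↔ MapClusterPt x atTop u := by
  simp only [accPt_iff_nhds, mapClusterPt_iff_frequently, frequently_atTop]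
  refine ⟨fun h s hs N => ?_, fun h s hs => ?_⟩
  · have hfin : (u '' Iio N \ {x}).Finite := ((finite_Iio N).image u).sdiff
    obtain ⟨-, ⟨hn, n, rfl⟩, hne⟩ := h _ (inter_mem hs
      (hfin.isClosed.isOpen_compl.mem_nhds (notMem_sdiff_of_mem rfl)))
    exact ⟨n, not_lt.1 fun hlt => hn.2 ⟨mem_image_of_mem u hlt, hne⟩, hn.1⟩
  · obtain ⟨n, -, hn⟩ := h s hs 0
    obtain ⟨m, hm, hm'⟩ := h s hs (n + 1)
    by_cases hx : u n = x
    · exact ⟨u m, ⟨hm', m, rfl⟩, fun h => by have := hu (h.trans hx.symm); omega⟩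
    · exact ⟨u n, ⟨hn, n, rfl⟩, hx⟩

section Orbits

variable {T : Equiv.Perm I01} {x : I01} {n : ℕ}

theorem fullOrbit_of_isPeriodicPt (hn : 0 < n) (h : (T ^ n) x = x) :
    fullOrbit T x = range fun m : ℕ => (T ^ m) x := by
  refine union_eq_left.2 ?_
  rintro - ⟨k, rfl⟩
  have hinv : (T⁻¹ ^ n) x = x := by rw [inv_pow, Equiv.Perm.inv_eq_iff_eq, h]
  obtain ⟨m, hm⟩ := exists_inv_pow_eq_pow hn hinv k
  exact ⟨m, hm⟩

theorem finite_fullOrbit_iff : (fullOrbit T x).Finite ↔ x ∈ Function.periodicPts T := by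
  refine ⟨fun hfin => ?_, fun hx => ?_⟩
  · by_contra hx
    exact infinite_range_of_injective (injective_pow_apply hx) (hfin.subset subset_union_left)
  · obtain ⟨n, hn, h⟩ := mem_periodicPts_iff.1 hx
    rw [fullOrbit_of_isPeriodicPt hn h]
    exact finite_range_pow_of_isPeriodicPt hn h

theorem omegaLim_eq_setOf_visits (hx : x ∉ Function.periodicPts T) :
    omegaLim T x = {z | Visits T z x} :=
  ext fun _ => accPt_range_iff_mapClusterPt (injective_pow_apply hx)

theorem closure_fullOrbit (h : fullOrbit T x ⊆ omegaLim T x) :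
    closure (fullOrbit T x) = omegaLim T x := by
  refine (closure_minimal h (isClosed_derivedSet _)).antisymm fun z hz => ?_
  exact closure_mono subset_union_left (mem_closure_iff_clusterPt.2 (AccPt.clusterPt hz))

end Orbits

/-- The points of `[0, 1)` with a germ in `A`. -/
def shadow (A : Set Germ) : Set I01 := {z | ∃ g ∈ A, g.pos = z}

section Translation

variable {d : ℕ} {T : Equiv.Perm I01} {S : Exchange Germ Germ.side d} {x z : I01}
  (hST : ∀ x, S.T (rightGerm x) = rightGerm (T x))

include hST

theorem pow_rightGerm (n : ℕ) (x : I01) : (S.T ^ n) (rightGerm x) = rightGerm ((T ^ n) x) := by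
  induction n with
  | zero => rfl
  | succ n ih => rw [pow_succ', Equiv.Perm.mul_apply, ih, hST, pow_succ', Equiv.Perm.mul_apply]

theorem rightGerm_mem_periodicPts_iff :
    rightGerm x ∈ Function.periodicPts S.T ↔ x ∈ Function.periodicPts T := by
  simp only [mem_periodicPts_iff, pow_rightGerm hST, rightGerm_injective.eq_iff]

-- Positions form a proper map, so a cluster point of positions lifts to a cluster point of germs.
theorem shadow_limitSet_rightGerm (x : I01) :
    shadow (S.limitSet (rightGerm x)) = {z | Visits T z x} := by
  have hpos : (fun n : ℕ => ((S.T ^ n) (rightGerm x)).pos) = fun n : ℕ => ((T ^ n) x : ℝ) :=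
    funext fun n => congrArg Germ.pos (pow_rightGerm hST n x)
  ext z
  have hz : Visits T z x ↔ MapClusterPt (z : ℝ)
      (map (fun n : ℕ => (S.T ^ n) (rightGerm x)) atTop) Germ.pos := by
    rw [MapClusterPt, Filter.map_map, Function.comp_def, hpos]
    exact IsInducing.subtypeVal.mapClusterPt_iff.symm
  refine Iff.trans ⟨?_, fun h => ?_⟩ hz.symm
  · rintro ⟨g, hg, hgz⟩
    exact hgz ▸ MapClusterPt.continuousAt_comp Germ.continuous_pos.continuousAt hg
  · obtain ⟨g, hgz, hg⟩ := Germ.isProperMap_pos.clusterPt_of_mapClusterPt h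
    exact ⟨g, hg, hgz⟩

theorem exists_covBy_of_not_visits_self (hrec : ¬ Visits S.T (rightGerm x) (rightGerm x))
    {n : ℕ} (h : Visits T ((T ^ n) x) x) :
    ∃ g, Visits S.T g (rightGerm x) ∧ g ⋖ rightGerm ((T ^ n) x) := by
  obtain ⟨g, hg, hgpos⟩ := (shadow_limitSet_rightGerm hST x).symm.subset h
  refine ⟨g, hg, Germ.covBy_of_pos_eq hgpos (Bool.eq_false_iff.2 fun hside => hrec ?_) rfl⟩
  obtain rfl : g = (S.T ^ n) (rightGerm x) :=
    (Germ.ext hgpos hside).trans (pow_rightGerm hST n x).symm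
  exact (S.visits_pow_left n).1 hg

theorem exists_covBy_pow_of_not_visits_self (hx : x ∉ Function.periodicPts T)
    (hω : ∀ n : ℕ, Visits T ((T ^ n) x) x) (hrec : ¬ Visits S.T (rightGerm x) (rightGerm x)) :
    ∃ y N, Visits S.T y (rightGerm x) ∧
      ∀ k : ℕ, (S.T ^ k) y ⋖ (S.T ^ k) ((S.T ^ N) (rightGerm x)) := by
  obtain ⟨N, hN⟩ := exists_pow_forall_pow_apply_ne
    (mt (rightGerm_mem_periodicPts_iff hST).1 hx) S.l
  obtain ⟨y, hy, hcov⟩ := exists_covBy_of_not_visits_self hST hrec (hω N)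
  rw [← pow_rightGerm hST] at hcov
  exact ⟨y, N, hy, S.covBy_pow hcov hN⟩

-- If the right germ of a recurrent point is not recurrent, then the orbit of the point returns from
-- the left only, and the left germs of a late part of the orbit are recurrent instead.
theorem exists_germ_of_mem_quasiminimals {Ω : Set I01} (hΩ : Ω ∈ quasiminimals T) :
    ∃ g, Visits S.T g g ∧ g ∉ Function.periodicPts S.T ∧ shadow (S.limitSet g) = Ω := by
  obtain ⟨x, ⟨hinf, hω, -⟩, rfl⟩ := hΩ
  have hx : x ∉ Function.periodicPts T := mt finite_fullOrbit_iff.2 hinf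
  have hx' := mt (rightGerm_mem_periodicPts_iff hST).1 hx
  rw [closure_fullOrbit hω, omegaLim_eq_setOf_visits hx, ← shadow_limitSet_rightGerm hST]
  by_cases hrec : Visits S.T (rightGerm x) (rightGerm x)
  · exact ⟨rightGerm x, hrec, hx', rfl⟩
  obtain ⟨y, N, hy, hcov⟩ := exists_covBy_pow_of_not_visits_self hST hx
    (fun n => (omegaLim_eq_setOf_visits hx).subset (hω (Or.inl ⟨n, rfl⟩))) hrec
  have hper := pow_notMem_periodicPts hx' N
  have hvisits (z : Germ) : Visits S.T z y ↔ Visits S.T z (rightGerm x) :=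
    (S.visits_iff_of_covBy hper hcov).trans (visits_pow_right N)
  exact ⟨y, (hvisits y).2 hy, S.notMem_periodicPts_of_covBy hper hcov,
    congrArg shadow (ext hvisits)⟩

theorem shadow_limitSet_rightGerm_of_isPeriodicPt {n : ℕ} (hn : 0 < n) (h : (T ^ n) x = x) :
    shadow (S.limitSet (rightGerm x)) = fullOrbit T x := by
  rw [shadow_limitSet_rightGerm hST, setOf_visits_of_isPeriodicPt hn h,
    fullOrbit_of_isPeriodicPt hn h]

variable {slope : Germ → ℝ} (hA : S.IsAffine Germ.pos slope)

include hA

theorem infinite_periodicOrbits {n : ℕ} (hn : 0 < n) (h : (T ^ n) x = x)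
    (hm : S.multiplier slope n (rightGerm x) = 1) : (periodicOrbits T).Infinite := by
  intro hfin
  obtain ⟨R, hR, hfix⟩ :=
    hA.exists_fixed hn (x := rightGerm x) (by rw [pow_rightGerm hST, h]) rfl hm
  obtain ⟨c, hxc, hc⟩ := exists_between (lt_min (hA.lt_of_side_left hR rfl) x.2.2)
  obtain ⟨hcR, hc1⟩ := lt_min_iff.1 hc
  have hinf : (Ico x ⟨c, x.2.1.trans hxc.le, hc1⟩).Infinite := Ico_infinite hxc
  refine hinf ((hfin.sUnion fun O ⟨_, _, hO⟩ => hO).subset fun y hy => ?_)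
  have hy' : (T ^ n) y = y := by
    refine rightGerm_injective ((pow_rightGerm hST n y).symm.trans (hfix _ ⟨?_, ?_⟩))
    · exact (Germ.le_iff_of_side_left rfl).2 hy.1
    · exact Germ.le_of_pos_lt (lt_trans hy.2 hcR)
  exact ⟨_, ⟨y, rfl, finite_fullOrbit_iff.2 (mem_periodicPts_iff.2 ⟨n, hn, hy'⟩)⟩,
    Or.inl ⟨0, rfl⟩⟩

theorem exists_germs_of_forall_ne {n : ℕ} (hn : 0 < n) (h : (T ^ n) x = x)
    (hm : S.multiplier slope n (rightGerm x) ≠ 1)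
    (hne : ∀ (k : ℕ) j, (S.T ^ k) (rightGerm x) ≠ S.l j) :
    ∃ A : Finset Germ, (∀ g ∈ A, Visits S.T g g ∧ shadow (S.limitSet g) = fullOrbit T x) ∧
      Set.InjOn S.limitSet A ∧ 4 ≤ ∑ g ∈ A, S.visitCount g := by
  have h' : (S.T ^ n) (rightGerm x) = rightGerm x := by rw [pow_rightGerm hST, h]
  obtain ⟨y, hy⟩ := (S.split.exists_pred (u := rightGerm x) rfl).resolve_left fun hbot =>
    let ⟨j, hj⟩ := S.eq_l_of_isBot hbot
    hne 0 j hj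
  obtain ⟨hcov, hyn, hmy⟩ := hA.periodic_of_covBy hy h' hne
  have hside : y.side = false := (S.split.side_of_covBy hy).1
  have hx := setOf_visits_of_isPeriodicPt hn h'
  have hlim : S.limitSet (rightGerm x) ≠ S.limitSet y := fun heq => by
    have hmem : y ∈ S.limitSet (rightGerm x) := heq ▸ visits_self_of_isPeriodicPt hn hyn
    obtain ⟨m, rfl⟩ := hmem.mem_range_of_isPeriodicPt hn h'
    simp [S.side_pow, rightGerm] at hside
  have hshadow : shadow (S.limitSet y) = shadow (S.limitSet (rightGerm x)) := by
    rw [Exchange.limitSet, Exchange.limitSet, hx, setOf_visits_of_isPeriodicPt hn hyn]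
    ext z
    simp [shadow, fun m => Germ.pos_eq_of_covBy (hcov m)]
  have hO := shadow_limitSet_rightGerm_of_isPeriodicPt hST hn h
  refine ⟨{rightGerm x, y}, ?_, ?_, ?_⟩
  · simp only [Finset.mem_insert, Finset.mem_singleton, forall_eq_or_imp, forall_eq]
    exact ⟨⟨visits_self_of_isPeriodicPt hn h', hO⟩,
      visits_self_of_isPeriodicPt hn hyn, hshadow.trans hO⟩
  · rw [Finset.coe_pair, injOn_pair]
    exact fun heq => absurd heq hlim
  · rw [Finset.sum_pair (ne_of_apply_ne _ hlim)]
    exact add_le_add (hA.two_le_visitCount hn h' hm) (hA.two_le_visitCount hn hyn (hmy ▸ hm))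

-- The left neighbour of a periodic right germ is periodic as well, unless the orbit of the right
-- germ meets a left endpoint.
theorem exists_germs_of_mem_periodicOrbits (hfin : (periodicOrbits T).Finite) {O : Set I01}
    (hO : O ∈ periodicOrbits T) :
    ∃ A : Finset Germ, (∀ g ∈ A, Visits S.T g g ∧ shadow (S.limitSet g) = O) ∧
      Set.InjOn S.limitSet A ∧ 4 ≤ ∑ g ∈ A, S.visitCount g := by
  obtain ⟨x, rfl, hO⟩ := hO
  obtain ⟨n, hn, h⟩ := mem_periodicPts_iff.1 (finite_fullOrbit_iff.1 hO)
  have h' : (S.T ^ n) (rightGerm x) = rightGerm x := by rw [pow_rightGerm hST, h]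
  have hm : S.multiplier slope n (rightGerm x) ≠ 1 := fun heq =>
    infinite_periodicOrbits hST hA hn h heq hfin
  by_cases! hmeet : ∃ (k : ℕ) (j : Fin d), (S.T ^ k) (rightGerm x) = S.l j
  · obtain ⟨k, j, hk⟩ := hmeet
    refine ⟨{rightGerm x}, fun g hg => ?_, by simp, ?_⟩
    · rw [Finset.mem_singleton.1 hg]
      exact ⟨visits_self_of_isPeriodicPt hn h',
        shadow_limitSet_rightGerm_of_isPeriodicPt hST hn h⟩
    · rw [Finset.sum_singleton]
      exact hA.four_le_visitCount hn h' rfl hm hk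
  · exact exists_germs_of_forall_ne hST hA hn h hm hmeet

end Translation

theorem disjoint_quasiminimals_periodicOrbits (T : Equiv.Perm I01) :
    Disjoint (quasiminimals T) (periodicOrbits T) := by
  refine disjoint_left.2 ?_
  rintro - ⟨x, hx, rfl⟩ ⟨_, _, hfin⟩
  exact hx.1 (hfin.subset subset_closure)

theorem card_quasiminimals_periodicOrbits_le {d : ℕ} {T : Equiv.Perm I01} (hT : IsAIET d T)
    {Q P : Finset (Set I01)} (hQ : ↑Q ⊆ quasiminimals T) (hP : ↑P ⊆ periodicOrbits T)
    (hfin : P.Nonempty → (periodicOrbits T).Finite) : 8 * Q.card + 4 * P.card ≤ 4 * d := by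
  classical
  obtain ⟨S, slope, hA, hST⟩ := exists_isAffine_exchange hT
  have hdisj : ∀ O ∈ P, O ∉ Q := fun O hO hOQ =>
    disjoint_left.1 (disjoint_quasiminimals_periodicOrbits T) (hQ hOQ) (hP hO)
  calc 8 * Q.card + 4 * P.card
      = ∑ Ω ∈ Q ∪ P, if Ω ∈ Q then 8 else 4 := by
        rw [Finset.sum_union (Finset.disjoint_left.2 fun O hOQ hO => hdisj O hO hOQ),
          Finset.sum_congr rfl fun Ω hΩ => if_pos hΩ,
          Finset.sum_congr rfl fun O hO => if_neg (hdisj O hO)]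
        simp [mul_comm]
    _ ≤ 4 * d := S.sum_weight_le (φ := shadow) fun Ω hΩ => ?_
  split_ifs with hΩQ
  · obtain ⟨g, hrec, hper, hg⟩ := exists_germ_of_mem_quasiminimals hST (hQ hΩQ)
    refine ⟨{g}, ?_, by simp, ?_⟩
    · simpa using ⟨hrec, hg⟩
    · simpa using S.eight_le_visitCount hrec hper
  · have hΩP := (Finset.mem_union.1 hΩ).resolve_left hΩQ
    exact exists_germs_of_mem_periodicOrbits hST hA (hfin ⟨Ω, hΩP⟩) (hP hΩP)

end GIET

end

theorem corollary1p4 (d : ℕ) (T : Equiv.Perm (Set.Ico (0 : ℝ) 1)) (hT : GIET.IsAIET d T) :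
    (GIET.quasiminimals T).Finite ∧
      ((GIET.periodicOrbits T).Infinite ∨
        ((GIET.periodicOrbits T).ncard : ℤ) ≤ (d : ℤ) - 2 * ((GIET.quasiminimals T).ncard : ℤ)) := by
  have hfin : (GIET.quasiminimals T).Finite := by
    by_contra hinf
    obtain ⟨Q, hQ, hcard⟩ := Set.Infinite.exists_subset_card_eq hinf (d + 1)
    have := GIET.card_quasiminimals_periodicOrbits_le hT (P := ∅) hQ (by simp) (by simp)
    simp only [Finset.card_empty] at this
    omega
  refine ⟨hfin, ?_⟩
  by_cases hP : (GIET.periodicOrbits T).Finite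
  · right
    have := GIET.card_quasiminimals_periodicOrbits_le hT (Q := hfin.toFinset) (P := hP.toFinset)
      (by simp) (by simp) (fun _ => hP)
    rw [Set.ncard_eq_toFinset_card _ hfin, Set.ncard_eq_toFinset_card _ hP]
    omega
  · exact Or.inl hP
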